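/- **Setting.** Let $d\in\mathbb N_0$, let $\mathfrak L^-$ be a finite set, $\mathfrak s\in[1,\infty)^d$, $\eta>0$, $\alpha_{\mathfrak l}\in\mathbb R$ for $\mathfrak l\in\mathfrak L^-$, $\alpha_0=0$, and let $\mathrm{reg}:\mathfrak L^-\cup\{0\}\to\mathbb R$ and $r\in\mathbb R$ satisfy $\mathrm{reg}(\mathfrak l)<\alpha_{\mathfrak l}$ for all $\mathfrak l\in\mathfrak L^-\cup\{0\}$ and $r\le \mathfrak s_i$ for $i=1,\dots,d$. For a set $I$, $M(I)$ denotes the finitely supported maps $I\to\mathbb N_0$, $e_i$ the unit multi-indices, $m!=\prod_i m(i)!$. Put $|\mathbf n|=\sum_i\mathfrak s_i\mathbf n(i)$ for $\mathbf n\in\mathbb N_0^d$. Consider commuting variables $\mathsf z_{(\mathfrak l,k)}$ ($\mathfrak l\in\mathfrak L^-\cup\{0\}$, $k\in M(\mathbb N_0^d)$) and $\mathsf z_{\mathbf n}$ ($\mathbf n\in\mathbb N_0^d$), and write $\mathsf z^\beta$ for the monomial of a multi-index $\beta$ over the set of their indices. The pair $(\mathfrak l,k)$ is *subcritical* if $r<\eta+\min\{\mathrm{reg}(\mathfrak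 l),\,m_k,\,\mathrm{reg}(\mathfrak l)+m_k\}$, where $m_k=\min_{0<k'\le k}\sum_{\mathbf n}(r-|\mathbf n|)k'(\mathbf n)$ (and $m_0=+\infty$); $\beta$ is subcritical if $\beta(\mathfrak l,k)\ne0$ implies that $(\mathfrak l,k)$ is subcritical. Put $$[\beta]=\sum_{(\mathfrak l,k)}\Big(1-\sum_{\mathbf n}k(\mathbf n)\Big)\beta(\mathfrak l,k)+\sum_{\mathbf n}\beta(\mathbf n),$$ $$|\beta|=\sum_{(\mathfrak l,k)}\Big(\alpha_{\mathfrak l}+\sum_{\mathbf n}(\eta-|\mathbf n|)k(\mathbf n)\Big)\beta(\mathfrak l,k)+\sum_{\mathbf n}(|\mathbf n|-\eta)\beta(\mathbf n).$$ Let $\mathcal N^-$ be the set of subcritical $\beta$ with $[\beta]=1$ and $\beta(\mathbf n)=0$ whenever $|\mathbf n|<r$; let $\mathcal N$ be the set of $\beta\in\mathcal N^-$ with $\sum_{\mathfrak l\in\mathfrak L^-}\sum_k\beta(\mathfrak l,k)>0$; and let $\mathcal P=\{e_{\mathbf n}\}_{\mathbf n}\sqcup\mathcal N$. Let $T_{\mathcal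 P\cup\mathcal N^-}$ be the vector space with basis $\{\mathsf z_\beta\}_{\beta\in\mathcal P\cup\mathcal N^-}$. Consider the derivations $$D^{(\mathbf n)}=\sum_{(\mathfrak l,k+e_{\mathbf n})\text{ subcritical}}(k(\mathbf n)+1)\,\mathsf z_{(\mathfrak l,k+e_{\mathbf n})}\partial_{\mathsf z_{(\mathfrak l,k)}}+\partial_{\mathsf z_{\mathbf n}},\qquad \boldsymbol\partial_i=\sum_{\mathbf n}(\mathbf n(i)+1)\,\mathsf z_{\mathbf n+e_i}D^{(\mathbf n)},$$ let $\mathcal M^+=\{(\gamma,\mathbf n)\in\mathcal N\times\mathbb N_0^d : |\mathbf n|<\eta+|\gamma|\}$, let $L^+$ be the Lie algebra of derivations generated by $\{\mathsf z^\gamma D^{(\mathbf n)}\}_{(\gamma,\mathbf n)\in\mathcal M^+}\sqcup\{\boldsymbol\partial_i\}_{i=1}^d$, and let $\rho$ be the action of its universal enveloping algebra $\mathrm U(L^+)$ extending the action by derivations. For $(\gamma,\mathbf n)\in\mathcal M^+$ define linear maps $U\mapsto\mathsf z^\gamma UD^{(\mathbf n)}$ on $\mathrm U(L^+)$ by $\mathsf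 z^\gamma 1D^{(\mathbf n)}=\mathsf z^\gamma D^{(\mathbf n)}$ and $$\mathsf z^\gamma (DU)D^{(\mathbf n)}=D\,(\mathsf z^\gamma UD^{(\mathbf n)})-\sum_\beta D^\gamma_\beta\,\mathsf z^\beta UD^{(\mathbf n)}\qquad(D\in L^+),\qquad\text{where } D\mathsf z^\gamma=\sum_\beta D_\beta^\gamma\mathsf z^\beta.$$ For $J\in M(\mathcal M^+)$ and $\mathbf m\in\mathbb N_0^d$ let $$\mathsf D_{(J,\mathbf m)}=\frac1{J!\,\mathbf m!}\prod_{(\gamma,\mathbf n)}(\mathsf z^\gamma)^{J(\gamma,\mathbf n)}\;\boldsymbol\partial^{\mathbf m}\prod_{(\gamma,\mathbf n)}(D^{(\mathbf n)})^{J(\gamma,\mathbf n)},$$ i.e. apply to $\boldsymbol\partial^{\mathbf m}=\prod_i\boldsymbol\partial_i^{\mathbf m(i)}$ each map $U\mapsto\mathsf z^\gamma UD^{(\mathbf n)}$ exactly $J(\gamma,\mathbf n)$ times, in any order, and divide by $J!\,\mathbf m!$. Let $T^+=\mathbb R[\mathcal M^+\sqcup\{1,\dots,d\}]$ be the polynomial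 algebra with monomials $\mathsf Z^{(J,\mathbf m)}$, and put $|(J,\mathbf m)|=\sum_{(\gamma,\mathbf n)}J(\gamma,\mathbf n)(|\gamma|+\eta-|\mathbf n|)+\sum_i\mathbf m(i)\mathfrak s_i$. **Proposition.** The $\mathsf D_{(J,\mathbf m)}$ do not depend on the order chosen and form a basis of $\mathrm U(L^+)$. Let $(\Delta)_{(J',\mathbf m'),(J'',\mathbf m'')}^{(J,\mathbf m)}$ be the coefficient of $\mathsf D_{(J,\mathbf m)}$ in the product $\mathsf D_{(J',\mathbf m')}\mathsf D_{(J'',\mathbf m'')}$ and $(\Delta)^{\gamma}_{(J,\mathbf m),\beta}$ the coefficient of $\mathsf z^\beta$ in $\rho(\mathsf D_{(J,\mathbf m)})\mathsf z^\gamma$. For fixed $(J,\mathbf m)$ only finitely many $((J',\mathbf m'),(J'',\mathbf m''))$ have a non-zero coefficient of the first kind, and for fixed $\beta\in\mathcal P\cup\mathcal N^-$ only finitely many $((J,\mathbf m),\gamma)$ with $\gamma\in\mathcal P\cup\mathcal N^-$ have a non-zero coefficient of the second kind. Moreover: 1. With the coproduct $$\Delta^+\mathsf Z^{(J,\mathbf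 m)}=\sum_{(J',\mathbf m'),(J'',\mathbf m'')}(\Delta)_{(J',\mathbf m'),(J'',\mathbf m'')}^{(J,\mathbf m)}\,\mathsf Z^{(J',\mathbf m')}\otimes\mathsf Z^{(J'',\mathbf m'')},$$ the constant coefficient as counit, and a suitable antipode $\mathcal A^+$, the polynomial algebra $T^+$ is a Hopf algebra. It is graded by $|(J,\mathbf m)|\in[0,\infty)$ (product, coproduct, counit and antipode respect the degree) and connected (its part of degree $0$ is $\mathbb R1$). The antipode is the transpose of the antipode $S$ of $\mathrm U(L^+)$ (the anti-automorphism extending $x\mapsto-x$): $\langle U,\mathcal A^+M\rangle=\langle SU,M\rangle$ for all $U\in\mathrm U(L^+)$, $M\in T^+$, where $\langle\mathsf D_{(J,\mathbf m)},\mathsf Z^{(J',\mathbf m')}\rangle=\delta_{(J,\mathbf m)}^{(J',\mathbf m')}$. 2. With $$\Delta^+\mathsf z_\beta=\sum_{(J,\mathbf m),\ \gamma\in\mathcal P\cup\mathcal N^-}(\Delta)^\gamma_{(J,\mathbf m),\beta}\,\mathsf Z^{(J,\mathbf m)}\otimes\mathsf z_\gamma,$$ the space $T_{\mathcal P\cup\mathcal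 N^-}$ is a left comodule over $T^+$: $(\mathrm{id}\otimes\Delta^+)\Delta^+=(\Delta^+\otimes\mathrm{id})\Delta^+$, and $(\varepsilon\otimes\mathrm{id})\Delta^+=\mathrm{id}$ for the counit $\varepsilon$ of $T^+$. -/

import Mathlib

open scoped TensorProduct

noncomputable section

/-! ### General algebra: Hopf algebras, gradings, comodules, antipode of an enveloping algebra -/

/-- `Δ`, `ε`, `S` make the (unital associative) real algebra `A` a Hopf algebra. -/
structure IsHopfAlgebraWith {A : Type*} [Ring A] [Algebra ℝ A]
    (Δ : A →ₗ[ℝ] A ⊗[ℝ] A) (ε : A →ₗ[ℝ] ℝ) (S : A →ₗ[ℝ] A) : Prop where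
  coassoc : TensorProduct.assoc ℝ A A A ∘ₗ Δ.rTensor A ∘ₗ Δ = Δ.lTensor A ∘ₗ Δ
  rTensor_counit : ε.rTensor A ∘ₗ Δ = TensorProduct.mk ℝ ℝ A 1
  lTensor_counit : ε.lTensor A ∘ₗ Δ = (TensorProduct.mk ℝ A ℝ).flip 1
  comul_one : Δ 1 = 1
  comul_mul : ∀ x y : A, Δ (x * y) = Δ x * Δ y
  counit_one : ε 1 = 1
  counit_mul : ∀ x y : A, ε (x * y) = ε x * ε y
  antipode_left : LinearMap.mul' ℝ A ∘ₗ S.rTensor A ∘ₗ Δ = Algebra.linearMap ℝ A ∘ₗ ε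
  antipode_right : LinearMap.mul' ℝ A ∘ₗ S.lTensor A ∘ₗ Δ = Algebra.linearMap ℝ A ∘ₗ ε

/-- Such data are a Hopf algebra in the sense of Mathlib, on the given algebra. -/
@[reducible] def IsHopfAlgebraWith.toHopfAlgebra {A : Type*} [Ring A] [Algebra ℝ A]
    {Δ : A →ₗ[ℝ] A ⊗[ℝ] A} {ε : A →ₗ[ℝ] ℝ} {S : A →ₗ[ℝ] A}
    (h : IsHopfAlgebraWith Δ ε S) : HopfAlgebra ℝ A :=
  letI : Bialgebra ℝ A :=
    Bialgebra.ofAlgHom (AlgHom.ofLinearMap Δ h.comul_one h.comul_mul)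
      (AlgHom.ofLinearMap ε h.counit_one h.counit_mul)
      (AlgHom.ext fun x => LinearMap.congr_fun h.coassoc x)
      (AlgHom.ext fun x => LinearMap.congr_fun h.rTensor_counit x)
      (AlgHom.ext fun x => LinearMap.congr_fun h.lTensor_counit x)
  { antipode := S
    mul_antipode_rTensor_comul := h.antipode_left
    mul_antipode_lTensor_comul := h.antipode_right }

/-- The family `𝒜 ν`, `ν ∈ ℝ`, is a grading of the Hopf algebra `(A, Δ, ε, S)`, it is concentrated
in degrees `ν ≥ 0`, and its part of degree `0` is `ℝ · 1`. -/
structure IsConnectedGradedHopfAlgebra {A : Type*} [Ring A] [Algebra ℝ A]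
    (Δ : A →ₗ[ℝ] A ⊗[ℝ] A) (ε : A →ₗ[ℝ] ℝ) (S : A →ₗ[ℝ] A) (𝒜 : ℝ → Submodule ℝ A) :
    Prop where
  isHopf : IsHopfAlgebraWith Δ ε S
  isInternal : DirectSum.IsInternal 𝒜
  one_mem : (1 : A) ∈ 𝒜 0
  mul_mem : ∀ μ ν : ℝ, ∀ x ∈ 𝒜 μ, ∀ y ∈ 𝒜 ν, x * y ∈ 𝒜 (μ + ν)
  comul_mem : ∀ ν : ℝ, ∀ x ∈ 𝒜 ν,
    Δ x ∈ ⨆ p : {p : ℝ × ℝ // p.1 + p.2 = ν},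
      LinearMap.range (TensorProduct.map (𝒜 p.1.1).subtype (𝒜 p.1.2).subtype)
  counit_mem : ∀ ν : ℝ, ν ≠ 0 → ∀ x ∈ 𝒜 ν, ε x = 0
  antipode_mem : ∀ ν : ℝ, ∀ x ∈ 𝒜 ν, S x ∈ 𝒜 ν
  nonneg : ∀ ν : ℝ, ν < 0 → 𝒜 ν = ⊥
  connected : 𝒜 0 = Submodule.span ℝ {(1 : A)}

/-- `δ : V → A ⊗ V` makes `V` a left comodule over the coalgebra `(A, Δ, ε)`. -/
structure IsLeftComodule {A V : Type*} [Ring A] [Algebra ℝ A] [AddCommGroup V] [Module ℝ V]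
    (Δ : A →ₗ[ℝ] A ⊗[ℝ] A) (ε : A →ₗ[ℝ] ℝ) (δ : V →ₗ[ℝ] A ⊗[ℝ] V) : Prop where
  coassoc : δ.lTensor A ∘ₗ δ = TensorProduct.assoc ℝ A A V ∘ₗ Δ.rTensor V ∘ₗ δ
  counit : ε.rTensor V ∘ₗ δ = TensorProduct.mk ℝ ℝ V 1

section Enveloping

attribute [local instance] LieRing.ofAssociativeRing

variable {L : Type*} [LieRing L] [LieAlgebra ℝ L]

/-- The antipode of `U(L)`, as an algebra morphism to the opposite algebra: the extension of
`x ↦ -x`. -/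
def envelopingAntipodeOp :
    UniversalEnvelopingAlgebra ℝ L →ₐ[ℝ] (UniversalEnvelopingAlgebra ℝ L)ᵐᵒᵖ :=
  UniversalEnvelopingAlgebra.lift ℝ
    { toFun := fun x => MulOpposite.op (-(UniversalEnvelopingAlgebra.ι ℝ x))
      map_add' := by intro x y; simp only [map_add, neg_add, MulOpposite.op_add]
      map_smul' := by
        intro c x; simp only [map_smul, ← smul_neg, MulOpposite.op_smul, RingHom.id_apply]
      map_lie' := by
        intro x y
        simp only [LieHom.map_lie, LieRing.of_associative_ring_bracket, ← MulOpposite.op_mul,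
          ← MulOpposite.op_sub]
        congr 1
        noncomm_ring }

/-- The antipode of `U(L)`: the anti-automorphism extending `x ↦ -x`. -/
def envelopingAntipode :
    UniversalEnvelopingAlgebra ℝ L →ₗ[ℝ] UniversalEnvelopingAlgebra ℝ L :=
  (MulOpposite.opLinearEquiv ℝ).symm.toLinearMap ∘ₗ envelopingAntipodeOp.toLinearMap

end Enveloping

/-! ### Multi-indices -/

/-- Elements `𝐧` of `ℕ₀^d`. -/
abbrev NVec (d : ℕ) := Fin d →₀ ℕ

/-- Indices of the coordinates `z_{(𝔩,k)}` (left, `none` being the index `0` of the additive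
term `ξ₀ = 1`) and `z_𝐧` (right). -/
abbrev Coord (d : ℕ) (𝔏 : Type*) := (Option 𝔏 × (NVec d →₀ ℕ)) ⊕ NVec d

/-- Multi-indices `β ∈ M(Coord)`. -/
abbrev CoordIdx (d : ℕ) (𝔏 : Type*) := Coord d 𝔏 →₀ ℕ

/-- The parameters: scaling `𝔰`, order `η` of the regularization, homogeneities `α_𝔩` of the
noises, and the placeholders `reg(𝔩)`, `𝔩 ∈ 𝔏⁻ ∪ {0}`, and `regSol` of the regularity of the noises
and of the solution. -/
structure RegParams (d : ℕ) (𝔏 : Type*) where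
  scal : Fin d → ℝ
  η : ℝ
  α : 𝔏 → ℝ
  reg : Option 𝔏 → ℝ
  regSol : ℝ

namespace RegParams

variable {d : ℕ} {𝔏 : Type*} (P : RegParams d 𝔏)

/-- `α_𝔩` for `𝔩 ∈ 𝔏⁻ ∪ {0}`, with `α_0 = 0`. -/
def alpha (l : Option 𝔏) : ℝ := l.elim 0 P.α

/-- The scaled degree `|𝐧| = ∑ᵢ 𝔰ᵢ 𝐧(i)`. -/
def scaledDeg (n : NVec d) : ℝ := ∑ i, P.scal i * n i

/-- Subcriticality of `(𝔩, k)`. An inequality `regSol < η + min …` is written as the family of the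
inequalities for the members of the set; the minimum over the empty set (`k = 0`) is `+∞`. -/
def SubcritPair (l : Option 𝔏) (k : NVec d →₀ ℕ) : Prop :=
  P.regSol < P.η + P.reg l ∧
  ∀ k' : NVec d →₀ ℕ, k' ≠ 0 → k' ≤ k →
    P.regSol < P.η + k'.sum (fun n j => (P.regSol - P.scaledDeg n) * j) ∧
    P.regSol < P.η + (P.reg l + k'.sum (fun n j => (P.regSol - P.scaledDeg n) * j))

/-- `β` is subcritical. -/
def Subcrit (β : CoordIdx d 𝔏) : Prop :=
  ∀ l k, β (Sum.inl (l, k)) ≠ 0 → P.SubcritPair l k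

/-- `[β] = ∑_{(𝔩,k)} (1 - length k) β(𝔩,k) + ∑_𝐧 β(𝐧)`. -/
def bracket (β : CoordIdx d 𝔏) : ℤ :=
  β.sum fun c j => Sum.elim (fun p => 1 - (p.2.sum fun _ i => (i : ℤ))) (fun _ => 1) c * (j : ℤ)

/-- The noise homogeneity `∑_{𝔩 ∈ 𝔏⁻} ∑_k β(𝔩,k)`. -/
def noiseHom (β : CoordIdx d 𝔏) : ℕ :=
  β.sum fun c j => Sum.elim (fun p => if p.1.isSome then 1 else 0) (fun _ => 0) c * j

/-- The homogeneity `|β|`. -/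
def hom (β : CoordIdx d 𝔏) : ℝ :=
  β.sum fun c j =>
    Sum.elim (fun p => P.alpha p.1 + p.2.sum (fun n i => (P.η - P.scaledDeg n) * (i : ℝ)))
      (fun n => P.scaledDeg n - P.η) c * (j : ℝ)

/-- The set `𝒩⁻`. -/
def NMinus : Set (CoordIdx d 𝔏) :=
  {β | bracket β = 1 ∧ P.Subcrit β ∧ ∀ n, P.scaledDeg n < P.regSol → β (Sum.inr n) = 0}

/-- The set `𝒩`. -/
def NSet : Set (CoordIdx d 𝔏) := {β | β ∈ P.NMinus ∧ 0 < noiseHom β}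

/-- The set `𝒫` of the purely polynomial multi-indices `e_𝐧`. -/
def PolySet : Set (CoordIdx d 𝔏) := Set.range fun n : NVec d => Finsupp.single (Sum.inr n) 1

/-- The set of populated multi-indices, `𝒫 ⊔ 𝒩`. -/
def Populated : Set (CoordIdx d 𝔏) := PolySet ∪ P.NSet

/-- The index set of the model space: the union of the populated multi-indices and `𝒩⁻`. -/
abbrev ModelIdx := {β : CoordIdx d 𝔏 // β ∈ P.Populated ∪ P.NMinus}

/-- The vector space with basis `z_β`, `β` populated or in `𝒩⁻`. -/
abbrev ModelSpace := P.ModelIdx →₀ ℝ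

/-! ### The generators and the Lie algebra `L⁺` -/

/-- Polynomials in the coordinates. The subcriticality restriction makes `D^{(𝐧)}` and `∂ᵢ`
derivations of this algebra; as operators on power series they are given by the same matrix
coefficients. -/
abbrev CoordPoly (d : ℕ) (𝔏 : Type*) := MvPolynomial (Coord d 𝔏) ℝ

open Classical in
/-- The derivation
`D^{(𝐧)} = ∑_{(𝔩,k) : (𝔩,k+e_𝐧) subcritical} (k(𝐧)+1) z_{(𝔩,k+e_𝐧)} ∂_{z_{(𝔩,k)}} + ∂_{z_𝐧}`. -/
def dN (n : NVec d) : Derivation ℝ (CoordPoly d 𝔏) (CoordPoly d 𝔏) :=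
  MvPolynomial.mkDerivation ℝ <| Sum.elim
    (fun p => if P.SubcritPair p.1 (p.2 + Finsupp.single n 1) then
        ((p.2 n : ℝ) + 1) • MvPolynomial.X (Sum.inl (p.1, p.2 + Finsupp.single n 1))
      else 0)
    (fun m => if m = n then 1 else 0)

/-- The derivation `∂ᵢ = ∑_𝐧 (𝐧(i)+1) z_{𝐧+eᵢ} D^{(𝐧)}`, given by its values on the variables, for
which the sum over `𝐧` is finite. -/
def dX (i : Fin d) : Derivation ℝ (CoordPoly d 𝔏) (CoordPoly d 𝔏) :=
  MvPolynomial.mkDerivation ℝ fun c =>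
    ∑ᶠ n : NVec d, ((n i : ℝ) + 1) •
      (MvPolynomial.X (Sum.inr (n + Finsupp.single i 1)) * P.dN n (MvPolynomial.X c))

/-- The derivation `z^γ D^{(𝐧)}`. -/
def zD (γ : CoordIdx d 𝔏) (n : NVec d) : Derivation ℝ (CoordPoly d 𝔏) (CoordPoly d 𝔏) :=
  (MvPolynomial.monomial γ (1 : ℝ)) • P.dN n

/-- The set `ℳ⁺` of the `(γ,𝐧) ∈ 𝒩 × ℕ₀^d` with `|𝐧| < η + |γ|`. -/
def MPlus : Set (CoordIdx d 𝔏 × NVec d) :=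
  {p | p.1 ∈ P.NSet ∧ P.scaledDeg p.2 < P.η + P.hom p.1}

/-- The index set `ℳ⁺ ⊔ {1,…,d}` of the generators. -/
abbrev PlusGen := P.MPlus ⊕ Fin d

/-- The generator with a given index. -/
def genDer : P.PlusGen → Derivation ℝ (CoordPoly d 𝔏) (CoordPoly d 𝔏) :=
  Sum.elim (fun p => P.zD p.1.1 p.1.2) P.dX

/-- The Lie algebra `L⁺` generated by the `z^γ D^{(𝐧)}`, `(γ,𝐧) ∈ ℳ⁺`, and the `∂ᵢ`. -/
def LPlus : LieSubalgebra ℝ (Derivation ℝ (CoordPoly d 𝔏) (CoordPoly d 𝔏)) :=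
  LieSubalgebra.lieSpan ℝ _ (Set.range P.genDer)

/-- The generators as elements of `L⁺`. -/
def gen (g : P.PlusGen) : P.LPlus :=
  ⟨P.genDer g, LieSubalgebra.subset_lieSpan (Set.mem_range_self g)⟩

/-- The universal enveloping algebra `U(L⁺)`. -/
abbrev UPlus := UniversalEnvelopingAlgebra ℝ P.LPlus

/-- The generators as elements of `U(L⁺)`. -/
def uGen (g : P.PlusGen) : P.UPlus := UniversalEnvelopingAlgebra.ι ℝ (P.gen g)

section Actions

attribute [local instance] LieRing.ofAssociativeRing

/-- The representation `ρ` of `U(L⁺)` extending the action of `L⁺` by derivations. -/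
def rho : P.UPlus →ₐ[ℝ] Module.End ℝ (CoordPoly d 𝔏) :=
  UniversalEnvelopingAlgebra.lift ℝ
    { toFun := fun D => (D.1 : CoordPoly d 𝔏 →ₗ[ℝ] CoordPoly d 𝔏)
      map_add' := fun _ _ => rfl
      map_smul' := fun _ _ => rfl
      map_lie' := by
        intro x y
        ext1 p
        simp [LieRing.of_associative_ring_bracket] }

/-- The action of `L⁺` on linear maps `f` from polynomials to `U(L⁺)`,
`(D · f)(π) = D f(π) - f(D π)`, extended to `U(L⁺)`. -/
def homAction : P.UPlus →ₐ[ℝ] Module.End ℝ (CoordPoly d 𝔏 →ₗ[ℝ] P.UPlus) :=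
  UniversalEnvelopingAlgebra.lift ℝ
    { toFun := fun D =>
        { toFun := fun f => LinearMap.mulLeft ℝ (UniversalEnvelopingAlgebra.ι ℝ D) ∘ₗ f -
            f ∘ₗ (D.1 : CoordPoly d 𝔏 →ₗ[ℝ] CoordPoly d 𝔏)
          map_add' := by
            intro f g
            refine LinearMap.ext fun p => ?_
            simp only [LinearMap.sub_apply, LinearMap.add_apply, LinearMap.comp_apply, map_add]
            abel
          map_smul' := by
            intro c f
            refine LinearMap.ext fun p => ?_
            simp only [LinearMap.sub_apply, LinearMap.smul_apply, LinearMap.comp_apply, map_smul,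
              RingHom.id_apply, smul_sub] }
      map_add' := by
        intro x y
        refine LinearMap.ext fun f => LinearMap.ext fun p => ?_
        simp only [LinearMap.coe_mk, AddHom.coe_mk, LinearMap.add_apply, LinearMap.sub_apply,
          LinearMap.comp_apply, LinearMap.mulLeft_apply, map_add, add_mul, AddMemClass.coe_add,
          Derivation.coe_add_linearMap]
        abel
      map_smul' := by
        intro c x
        refine LinearMap.ext fun f => LinearMap.ext fun p => ?_
        simp only [LinearMap.coe_mk, AddHom.coe_mk, LinearMap.smul_apply, LinearMap.sub_apply,
          LinearMap.comp_apply, LinearMap.mulLeft_apply, map_smul, smul_mul_assoc, smul_sub,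
          SetLike.val_smul, Derivation.coe_smul_linearMap, RingHom.id_apply]
      map_lie' := by
        intro x y
        refine LinearMap.ext fun f => LinearMap.ext fun p => ?_
        simp only [LinearMap.coe_mk, AddHom.coe_mk, LinearMap.sub_apply,
          LinearMap.comp_apply, LinearMap.mulLeft_apply, LieHom.map_lie,
          LieRing.of_associative_ring_bracket, Module.End.mul_apply, map_sub, sub_mul,
          LieSubalgebra.coe_bracket, Derivation.commutator_coe_linear_map, mul_assoc]
        abel }

end Actions

open Classical in
/-- The linear map `z^γ ↦ z^γ D^{(𝐧)} ∈ U(L⁺)`, for `(γ,𝐧) ∈ ℳ⁺` (and `0` for other `γ`). -/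
def zDLinear (n : NVec d) : CoordPoly d 𝔏 →ₗ[ℝ] P.UPlus :=
  (MvPolynomial.basisMonomials (Coord d 𝔏) ℝ).constr ℝ fun γ =>
    if h : (γ, n) ∈ P.MPlus then P.uGen (Sum.inl ⟨(γ, n), h⟩) else 0

/-- The element `z^γ U D^{(𝐧)}` of `U(L⁺)`, for `(γ,𝐧) ∈ ℳ⁺` and `U ∈ U(L⁺)`. -/
def sandwich (p : P.MPlus) (U : P.UPlus) : P.UPlus :=
  P.homAction U (P.zDLinear p.1.2) (MvPolynomial.monomial p.1.1 1)

/-- `z^γ 1 D^{(𝐧)} = z^γ D^{(𝐧)}`. -/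
theorem sandwich_one (p : P.MPlus) : P.sandwich p 1 = P.uGen (Sum.inl p) := by
  classical
  rw [sandwich, map_one, Module.End.one_apply, zDLinear,
    ← congrFun (MvPolynomial.coe_basisMonomials (Coord d 𝔏) ℝ) p.1.1, Module.Basis.constr_basis]
  exact dif_pos p.2

/-- The recursion `z^γ (D U) D^{(𝐧)} = D (z^γ U D^{(𝐧)}) - ∑_β D_β^γ z^β U D^{(𝐧)}`. -/
theorem sandwich_ι_mul (p : P.MPlus) (D : P.LPlus) (U : P.UPlus) :
    P.sandwich p (UniversalEnvelopingAlgebra.ι ℝ D * U) =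
      UniversalEnvelopingAlgebra.ι ℝ D * P.sandwich p U -
        P.homAction U (P.zDLinear p.1.2) (D.1 (MvPolynomial.monomial p.1.1 1)) := by
  simp only [sandwich, map_mul, homAction]
  rw [Module.End.mul_apply, UniversalEnvelopingAlgebra.lift_ι_apply]
  rfl

/-! ### The order-independent basis of `U(L⁺)` -/

/-- Multi-indices `(J,𝐦) ∈ M(ℳ⁺) × ℕ₀^d`, as multi-indices over `ℳ⁺ ⊔ {1,…,d}`. -/
abbrev PlusIdx := P.PlusGen →₀ ℕ

/-- The component `J` of `K = (J,𝐦)`, as a multiset of elements of `ℳ⁺`. -/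
def jPart (K : P.PlusIdx) : Multiset P.MPlus :=
  Finsupp.toMultiset (K.comapDomain Sum.inl Sum.inl_injective.injOn)

/-- The degree `|(γ,𝐧)| = |γ| + η - |𝐧|`, `|i| = |eᵢ| = 𝔰ᵢ` of a generator. -/
def genDeg : P.PlusGen → ℝ :=
  Sum.elim (fun p => P.hom p.1.1 + P.η - P.scaledDeg p.1.2) P.scal

/-- `∂^𝐦 = ∏ᵢ ∂ᵢ^{𝐦(i)}` in `U(L⁺)`, for `K = (J,𝐦)`. -/
def dXPow (K : P.PlusIdx) : P.UPlus :=
  (List.ofFn fun i : Fin d => P.uGen (Sum.inr i) ^ K (Sum.inr i)).prod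

/-- The element `(1 / (J! 𝐦!)) ∏ z^γ ∂^𝐦 ∏ D^{(𝐧)}` of `U(L⁺)`, for `K = (J,𝐦)`, obtained from
`∂^𝐦` by applying the maps `U ↦ z^γ U D^{(𝐧)}` for the entries `(γ,𝐧)` of a list `l`, which is to
be an enumeration of `J`. -/
def sfD (K : P.PlusIdx) (l : List P.MPlus) : P.UPlus :=
  ((K.prod fun _ j => (j.factorial : ℝ))⁻¹) • l.foldr P.sandwich (P.dXPow K)

/-! ### `T⁺` and the transposed maps -/

/-- `T⁺ = ℝ[ℳ⁺ ⊔ {1,…,d}]`. -/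
abbrev TPlus := MvPolynomial P.PlusGen ℝ

/-- The monomials `Z^{(J,𝐦)}`. -/
def Zmon (K : P.PlusIdx) : P.TPlus := MvPolynomial.monomial K 1

/-- The part of `T⁺` of degree `ν`, spanned by the `Z^{(J,𝐦)}` with `|(J,𝐦)| = ν`. -/
def gradePlus (ν : ℝ) : Submodule ℝ P.TPlus :=
  MvPolynomial.weightedHomogeneousSubmodule ℝ P.genDeg ν

/-- The counit: the constant coefficient. -/
def counitPlus : P.TPlus →ₗ[ℝ] ℝ := MvPolynomial.lcoeff ℝ (0 : P.PlusIdx)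

section Transpose

variable {P} (b : Module.Basis P.PlusIdx ℝ P.UPlus)

/-- The pairing between `U(L⁺)` and `T⁺` for which the basis `b` is dual to the monomials. -/
def pairing : P.UPlus →ₗ[ℝ] P.TPlus →ₗ[ℝ] ℝ :=
  b.constr ℝ fun K => MvPolynomial.lcoeff ℝ K

/-- The structure constant of the product: the `K`-coefficient of `b K' * b K''`. -/
def prodCoeff (K' K'' K : P.PlusIdx) : ℝ := b.repr (b K' * b K'') K

/-- The structure constant of the action: the `z^β`-coefficient of `ρ(b K) z^γ`. -/
def actCoeff (K : P.PlusIdx) (β γ : CoordIdx d 𝔏) : ℝ :=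
  MvPolynomial.coeff β (P.rho (b K) (MvPolynomial.monomial γ 1))

/-- The transposed product `Δ⁺ Z^K = ∑_{K',K''} (b K' b K'')_K Z^{K'} ⊗ Z^{K''}`. -/
def comulPlus : P.TPlus →ₗ[ℝ] P.TPlus ⊗[ℝ] P.TPlus :=
  (MvPolynomial.basisMonomials P.PlusGen ℝ).constr ℝ fun K =>
    ∑ᶠ q : P.PlusIdx × P.PlusIdx, prodCoeff b q.1 q.2 K • (P.Zmon q.1 ⊗ₜ[ℝ] P.Zmon q.2)

/-- The transposed action `Δ⁺ z_β = ∑_{K,γ} (b K)_β^γ Z^K ⊗ z_γ`. -/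
def coactPlus : P.ModelSpace →ₗ[ℝ] P.TPlus ⊗[ℝ] P.ModelSpace :=
  Finsupp.basisSingleOne.constr ℝ fun β : P.ModelIdx =>
    ∑ᶠ q : P.PlusIdx × P.ModelIdx,
      actCoeff b q.1 β.1 q.2.1 • (P.Zmon q.1 ⊗ₜ[ℝ] Finsupp.single q.2 (1 : ℝ))

end Transpose

end RegParams

end

/-! The enveloping algebra `U(L⁺)` is a bialgebra in which `L⁺` is primitive, and `T⁺` is its dual
with respect to the family 𝖣_K, K = (J,𝐦). Everything rests on showing that the 𝖣_K form a basis of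
divided powers: Δ𝖣_K = ∑_{K'+K''=K} 𝖣_{K'} ⊗ 𝖣_{K''}. Dually this says that the monomials Z^K
multiply as in a polynomial algebra.

The maps U ↦ π U D^{(𝐧)} are the main tool. Since generators strictly raise the homogeneity, `L⁺`
preserves the admissible coefficients π (`LPlus_map_mem_coeffSpan`), so the defining recursion stays
inside `U(L⁺)`. Induction along this recursion gives ρ(πUD^{(𝐧)}) = π ρ(U) D^{(𝐧)}, the commutation
of any two such maps (because the D^{(𝐧)} commute), and the coderivation property. Order
independence and the coproduct formula follow.

The 𝖣_K span because their span is stable under left multiplication by generators: the recursion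
moves a factor past z^γ ⋯ D^{(𝐧)}, and [D^{(𝐧)}, ∂ᵢ] = 𝐧(i) D^{(𝐧-eᵢ)} moves it past ∂ᵢ. They are
independent without appeal to Poincaré–Birkhoff–Witt. A coefficient of ρ(U)z_𝐧 gives a functional
dual to a single generator (`genCoeff_dividedD`), and convolution products of these functionals are
dual to all 𝖣_K (`exists_dual_functional`).

The same functionals express structure constants of the product through matrix coefficients of ρ.
Finiteness and conservation of weight are therefore proved first for the action, where a fixed
target z^β bounds K, and then transferred to the product.

Every Hopf and comodule axiom is then checked by pairing against `U(L⁺)`. Only the transposed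
antipode needs more: it must send polynomials to polynomials. It is built by recursion over an
auxiliary conserved weight, the degree shifted by the noise homogeneity, which is at least 1 on
every generator. -/

section EnvelopingBialgebra

-- Coproduct, counit and antipode of an enveloping algebra.

attribute [local instance] LieRing.ofAssociativeRing

variable {L : Type*} [LieRing L] [LieAlgebra ℝ L]

local notation "𝒰" => UniversalEnvelopingAlgebra ℝ L

/-- The elements whose left multiplication preserves `B` form a subalgebra containing the image of
`L`. By the universal property it is everything, and applying `u` to `1 ∈ B` gives the claim. -/
theorem enveloping_left_induction (B : Submodule ℝ 𝒰) (h1 : 1 ∈ B)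
    (hι : ∀ x : L, ∀ u ∈ B, UniversalEnvelopingAlgebra.ι ℝ x * u ∈ B) (u : 𝒰) : u ∈ B := by
  let A : Subalgebra ℝ 𝒰 :=
    { carrier := {a | ∀ v ∈ B, a * v ∈ B}
      mul_mem' := fun {a c} ha hc v hv => by rw [mul_assoc]; exact ha _ (hc _ hv)
      add_mem' := fun {a c} ha hc v hv => by rw [add_mul]; exact B.add_mem (ha _ hv) (hc _ hv)
      algebraMap_mem' := fun r v hv => by
        rw [← Algebra.smul_def]; exact B.smul_mem _ hv }
  let f : L →ₗ⁅ℝ⁆ A :=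
    { toFun := fun x => ⟨UniversalEnvelopingAlgebra.ι ℝ x, fun v hv => hι x v hv⟩
      map_add' := fun x y => Subtype.ext (map_add _ _ _)
      map_smul' := fun c x => Subtype.ext (map_smul _ _ _)
      map_lie' := fun {x y} => Subtype.ext (LieHom.map_lie _ _ _) }
  have hF : A.val.comp (UniversalEnvelopingAlgebra.lift ℝ f) = AlgHom.id ℝ 𝒰 := by
    apply UniversalEnvelopingAlgebra.hom_ext
    ext x
    change A.val (UniversalEnvelopingAlgebra.lift ℝ f (UniversalEnvelopingAlgebra.ι ℝ x)) =
      UniversalEnvelopingAlgebra.ι ℝ x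
    rw [UniversalEnvelopingAlgebra.lift_ι_apply]
    rfl
  have h := (UniversalEnvelopingAlgebra.lift ℝ f u).2 1 h1
  rw [mul_one] at h
  have e : ((UniversalEnvelopingAlgebra.lift ℝ f u : A) : 𝒰) = u :=
    DFunLike.congr_fun hF u
  rwa [e] at h

theorem enveloping_ι_lie (x y : L) :
    UniversalEnvelopingAlgebra.ι ℝ ⁅x, y⁆ =
      UniversalEnvelopingAlgebra.ι ℝ x * UniversalEnvelopingAlgebra.ι ℝ y -
        UniversalEnvelopingAlgebra.ι ℝ y * UniversalEnvelopingAlgebra.ι ℝ x := by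
  rw [LieHom.map_lie, LieRing.of_associative_ring_bracket]

/-- Two linear maps on `U(L)` agree if they agree at `1` and satisfy the same recursion. -/
theorem enveloping_linearMap_ext {V : Type*} [AddCommGroup V] [Module ℝ V] {f g : 𝒰 →ₗ[ℝ] V}
    (h1 : f 1 = g 1)
    (hι : ∀ (x : L) (u : 𝒰), f u = g u →
      f (UniversalEnvelopingAlgebra.ι ℝ x * u) = g (UniversalEnvelopingAlgebra.ι ℝ x * u)) :
    f = g := by
  ext u
  exact enveloping_left_induction (LinearMap.eqLocus f g) h1 (fun x u hu => hι x u hu) u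

/-- The coproduct of `U(L)` for which the elements of `L` are primitive. -/
noncomputable def envelopingComul : 𝒰 →ₐ[ℝ] 𝒰 ⊗[ℝ] 𝒰 :=
  UniversalEnvelopingAlgebra.lift ℝ
    { toFun := fun x => UniversalEnvelopingAlgebra.ι ℝ x ⊗ₜ[ℝ] (1 : 𝒰) +
        (1 : 𝒰) ⊗ₜ[ℝ] UniversalEnvelopingAlgebra.ι ℝ x
      map_add' := by
        intro x y
        simp only [map_add, TensorProduct.add_tmul, TensorProduct.tmul_add]
        abel
      map_smul' := by
        intro c x
        simp only [map_smul, TensorProduct.smul_tmul', TensorProduct.tmul_smul, smul_add,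
          RingHom.id_apply]
      map_lie' := by
        intro x y
        simp only [LieHom.map_lie, LieRing.of_associative_ring_bracket, mul_add, add_mul,
          Algebra.TensorProduct.tmul_mul_tmul, mul_one, one_mul, TensorProduct.sub_tmul,
          TensorProduct.tmul_sub]
        abel }

/-- The counit of `U(L)`. -/
noncomputable def envelopingCounit : 𝒰 →ₐ[ℝ] ℝ :=
  UniversalEnvelopingAlgebra.lift ℝ 0

theorem envelopingComul_ι (x : L) :
    envelopingComul (UniversalEnvelopingAlgebra.ι ℝ x) =
      UniversalEnvelopingAlgebra.ι ℝ x ⊗ₜ[ℝ] (1 : 𝒰) +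
        (1 : 𝒰) ⊗ₜ[ℝ] UniversalEnvelopingAlgebra.ι ℝ x := by
  rw [envelopingComul, UniversalEnvelopingAlgebra.lift_ι_apply]
  rfl

theorem envelopingCounit_ι (x : L) :
    envelopingCounit (UniversalEnvelopingAlgebra.ι ℝ x) = 0 := by
  rw [envelopingCounit, UniversalEnvelopingAlgebra.lift_ι_apply]
  rfl

theorem envelopingAntipode_mul (u v : 𝒰) :
    envelopingAntipode (u * v) = envelopingAntipode v * envelopingAntipode u := by
  simp only [envelopingAntipode, LinearMap.comp_apply, AlgHom.toLinearMap_apply, map_mul]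
  rfl

theorem envelopingAntipode_one : envelopingAntipode (1 : 𝒰) = 1 := by
  simp only [envelopingAntipode, LinearMap.comp_apply, AlgHom.toLinearMap_apply, map_one]
  rfl

theorem envelopingAntipode_ι (x : L) :
    envelopingAntipode (UniversalEnvelopingAlgebra.ι ℝ x) =
      -UniversalEnvelopingAlgebra.ι ℝ x := by
  simp only [envelopingAntipode, LinearMap.comp_apply, AlgHom.toLinearMap_apply,
    envelopingAntipodeOp]
  rw [UniversalEnvelopingAlgebra.lift_ι_apply]
  rfl

theorem envelopingAntipode_left_inv (u : 𝒰) :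
    LinearMap.mul' ℝ 𝒰 (envelopingAntipode.rTensor 𝒰 (envelopingComul u)) =
      algebraMap ℝ 𝒰 (envelopingCounit u) := by
  let f : 𝒰 →ₗ[ℝ] 𝒰 :=
    LinearMap.mul' ℝ 𝒰 ∘ₗ envelopingAntipode.rTensor 𝒰 ∘ₗ envelopingComul.toLinearMap
  let g : 𝒰 →ₗ[ℝ] 𝒰 := Algebra.linearMap ℝ 𝒰 ∘ₗ envelopingCounit.toLinearMap
  suffices h : f = g from LinearMap.congr_fun h u
  refine enveloping_linearMap_ext ?_ fun x u _ => ?_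
  · simp [f, g, Algebra.TensorProduct.one_def, envelopingAntipode_one]
  -- On a ⊗ c the two summands are S(xa)c = -S(a)xc and S(a)xc, which cancel.
  · have hz : ∀ t : 𝒰 ⊗[ℝ] 𝒰, LinearMap.mul' ℝ 𝒰 (envelopingAntipode.rTensor 𝒰
        ((UniversalEnvelopingAlgebra.ι ℝ x ⊗ₜ[ℝ] (1 : 𝒰) +
          (1 : 𝒰) ⊗ₜ[ℝ] UniversalEnvelopingAlgebra.ι ℝ x) * t)) = 0 := by
      intro t
      induction t with
      | zero => simp
      | add a c ha hc => rw [mul_add, map_add, map_add, ha, hc, add_zero]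
      | tmul a c =>
        simp only [add_mul, Algebra.TensorProduct.tmul_mul_tmul, one_mul, map_add,
          LinearMap.rTensor_tmul, LinearMap.mul'_apply, envelopingAntipode_mul,
          envelopingAntipode_ι]
        noncomm_ring
    simp only [f, g, LinearMap.comp_apply, AlgHom.toLinearMap_apply, map_mul,
      envelopingComul_ι, envelopingCounit_ι, zero_mul, map_zero]
    exact hz _

theorem envelopingAntipode_right_inv (u : 𝒰) :
    LinearMap.mul' ℝ 𝒰 (envelopingAntipode.lTensor 𝒰 (envelopingComul u)) =
      algebraMap ℝ 𝒰 (envelopingCounit u) := by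
  let f : 𝒰 →ₗ[ℝ] 𝒰 :=
    LinearMap.mul' ℝ 𝒰 ∘ₗ envelopingAntipode.lTensor 𝒰 ∘ₗ envelopingComul.toLinearMap
  let g : 𝒰 →ₗ[ℝ] 𝒰 := Algebra.linearMap ℝ 𝒰 ∘ₗ envelopingCounit.toLinearMap
  suffices h : f = g from LinearMap.congr_fun h u
  refine enveloping_linearMap_ext ?_ fun x u hu => ?_
  · simp [f, g, Algebra.TensorProduct.one_def, envelopingAntipode_one]
  -- Here x ends up on the two outer sides, so only a commutator with x remains; it vanishes
  -- because, by induction, the other factor is a scalar.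
  · have hz : ∀ t : 𝒰 ⊗[ℝ] 𝒰, LinearMap.mul' ℝ 𝒰 (envelopingAntipode.lTensor 𝒰
        ((UniversalEnvelopingAlgebra.ι ℝ x ⊗ₜ[ℝ] (1 : 𝒰) +
          (1 : 𝒰) ⊗ₜ[ℝ] UniversalEnvelopingAlgebra.ι ℝ x) * t)) =
        UniversalEnvelopingAlgebra.ι ℝ x *
            LinearMap.mul' ℝ 𝒰 (envelopingAntipode.lTensor 𝒰 t) -
          LinearMap.mul' ℝ 𝒰 (envelopingAntipode.lTensor 𝒰 t) *
            UniversalEnvelopingAlgebra.ι ℝ x := by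
      intro t
      induction t with
      | zero => simp
      | add a c ha hc =>
        simp only [mul_add, map_add, add_mul] at ha hc ⊢
        rw [ha, hc]
        abel
      | tmul a c =>
        simp only [add_mul, Algebra.TensorProduct.tmul_mul_tmul, one_mul, map_add,
          LinearMap.lTensor_tmul, LinearMap.mul'_apply, envelopingAntipode_mul,
          envelopingAntipode_ι]
        noncomm_ring
    simp only [f, g, LinearMap.comp_apply, AlgHom.toLinearMap_apply, map_mul,
      envelopingComul_ι, envelopingCounit_ι, zero_mul, map_zero, Algebra.linearMap_apply]
      at hu ⊢
    rw [hz, hu, Algebra.commutes, sub_self]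

end EnvelopingBialgebra

namespace RegParams

variable {d : ℕ} {𝔏 : Type*}

/-! ### Monomials in the image of a derivation -/

/-- A derivation replaces one variable c of z^γ by a monomial z^δ of its image. Writing this as an
equation between sums avoids truncated subtraction, so that additive functionals of multi-indices
can be applied to it directly. -/
theorem exists_of_coeff_mkDerivation_ne_zero {σ : Type*} (f : σ → MvPolynomial σ ℝ)
    {γ β : σ →₀ ℕ}
    (h : MvPolynomial.coeff β (MvPolynomial.mkDerivation ℝ f (MvPolynomial.monomial γ 1)) ≠ 0) :
    ∃ c δ, γ c ≠ 0 ∧ MvPolynomial.coeff δ (f c) ≠ 0 ∧ β + Finsupp.single c 1 = γ + δ := by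
  classical
  rw [MvPolynomial.mkDerivation_monomial, one_smul, Finsupp.sum, MvPolynomial.coeff_sum] at h
  obtain ⟨c, hc, hne⟩ := Finset.exists_ne_zero_of_sum_ne_zero h
  rw [smul_eq_mul, MvPolynomial.coeff_monomial_mul'] at hne
  split_ifs at hne with hle
  · refine ⟨c, _, Finsupp.mem_support_iff.mp hc, right_ne_zero_of_mul hne, ?_⟩
    have h1 : Finsupp.single c 1 ≤ γ :=
      Finsupp.single_le_iff.mpr (Nat.one_le_iff_ne_zero.mpr (Finsupp.mem_support_iff.mp hc))
    obtain ⟨ε, rfl⟩ := le_iff_exists_add.mp hle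
    rw [add_tsub_cancel_left, add_right_comm, tsub_add_cancel_of_le h1]
  · exact absurd rfl hne

theorem exists_of_coeff_finsum_ne_zero {σ ι : Type*} {f : ι → MvPolynomial σ ℝ} {β : σ →₀ ℕ}
    (h : MvPolynomial.coeff β (∑ᶠ i, f i) ≠ 0) : ∃ i, MvPolynomial.coeff β (f i) ≠ 0 := by
  by_contra! hc
  refine h (finsum_induction (fun q => MvPolynomial.coeff β q = 0) (by simp) ?_ hc)
  intro p q hp hq
  rw [MvPolynomial.coeff_add, hp, hq, add_zero]

theorem exists_of_coeff_map_ne_zero {σ : Type*} (T : MvPolynomial σ ℝ →ₗ[ℝ] MvPolynomial σ ℝ)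
    {q : MvPolynomial σ ℝ} {β : σ →₀ ℕ} (h : MvPolynomial.coeff β (T q) ≠ 0) :
    ∃ γ, MvPolynomial.coeff γ q ≠ 0 ∧
      MvPolynomial.coeff β (T (MvPolynomial.monomial γ 1)) ≠ 0 := by
  rw [q.as_sum, map_sum, MvPolynomial.coeff_sum] at h
  obtain ⟨γ, hγ, hne⟩ := Finset.exists_ne_zero_of_sum_ne_zero h
  refine ⟨γ, MvPolynomial.mem_support_iff.mp hγ, fun h0 => hne ?_⟩
  have : MvPolynomial.monomial γ (MvPolynomial.coeff γ q) =
      MvPolynomial.coeff γ q • MvPolynomial.monomial γ (1 : ℝ) := by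
    rw [MvPolynomial.smul_monomial, smul_eq_mul, mul_one]
  rw [this, map_smul, MvPolynomial.coeff_smul, h0, smul_zero]

/-! ### Additive functionals of multi-indices -/

theorem sum_weight_add {σ R : Type*} [CommSemiring R] (w : σ → R) (β γ : σ →₀ ℕ) :
    ((β + γ).sum fun c j => w c * (j : R)) =
      (β.sum fun c j => w c * (j : R)) + γ.sum fun c j => w c * (j : R) :=
  Finsupp.sum_add_index' (by simp) (by intro a m n; push_cast; ring)

theorem sum_weight_single {σ R : Type*} [CommSemiring R] (w : σ → R) (c : σ) :
    ((Finsupp.single c 1).sum fun c j => w c * ((j : ℕ) : R)) = w c := by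
  rw [Finsupp.sum_single_index] <;> simp

variable (P : RegParams d 𝔏)

theorem scaledDeg_add (n m : NVec d) : P.scaledDeg (n + m) = P.scaledDeg n + P.scaledDeg m := by
  simp only [scaledDeg, Finsupp.add_apply, Nat.cast_add, mul_add, Finset.sum_add_distrib]

theorem scaledDeg_single (i : Fin d) : P.scaledDeg (Finsupp.single i 1) = P.scal i := by
  classical
  simp only [scaledDeg, Finsupp.single_apply, Nat.cast_ite, Nat.cast_one, Nat.cast_zero, mul_ite,
    mul_one, mul_zero, Finset.sum_ite_eq, Finset.mem_univ, if_true]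

theorem scaledDeg_nonneg (hscal : ∀ i, 1 ≤ P.scal i) (n : NVec d) : 0 ≤ P.scaledDeg n :=
  Finset.sum_nonneg fun i _ => mul_nonneg (zero_le_one.trans (hscal i)) (Nat.cast_nonneg _)

theorem scal_le_scaledDeg_add_single (hscal : ∀ i, 1 ≤ P.scal i) (n : NVec d) (i : Fin d) :
    P.scal i ≤ P.scaledDeg (n + Finsupp.single i 1) := by
  rw [scaledDeg_add, scaledDeg_single]
  linarith [P.scaledDeg_nonneg hscal n]

theorem scaledDeg_tsub_le (hscal : ∀ i, 1 ≤ P.scal i) (n : NVec d) (i : Fin d) :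
    P.scaledDeg (n - Finsupp.single i 1) ≤ P.scaledDeg n := by
  refine Finset.sum_le_sum fun j _ => mul_le_mul_of_nonneg_left ?_ (zero_le_one.trans (hscal j))
  rw [Finsupp.tsub_apply]
  exact_mod_cast Nat.sub_le _ _

theorem finite_scaledDeg_lt (hscal : ∀ i, 1 ≤ P.scal i) (C : ℝ) :
    {n : NVec d | P.scaledDeg n < C}.Finite := by
  refine (Set.finite_Iic (Finsupp.equivFunOnFinite.symm fun _ : Fin d => ⌈C⌉₊)).subset ?_
  intro n hn i
  have h1 : (n i : ℝ) ≤ P.scaledDeg n := by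
    refine le_trans ?_ (Finset.single_le_sum (f := fun i => P.scal i * (n i : ℝ))
      (fun j _ => mul_nonneg (zero_le_one.trans (hscal j)) (Nat.cast_nonneg _))
      (Finset.mem_univ i))
    exact le_mul_of_one_le_left (Nat.cast_nonneg _) (hscal i)
  have h2 : (n i : ℝ) ≤ ⌈C⌉₊ := (h1.trans (le_of_lt hn)).trans (Nat.le_ceil C)
  exact_mod_cast h2

theorem bracket_add (β γ : CoordIdx d 𝔏) : bracket (β + γ) = bracket β + bracket γ :=
  sum_weight_add _ β γ

theorem noiseHom_add (β γ : CoordIdx d 𝔏) : noiseHom (β + γ) = noiseHom β + noiseHom γ :=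
  sum_weight_add (R := ℕ) _ β γ

theorem hom_add (β γ : CoordIdx d 𝔏) : P.hom (β + γ) = P.hom β + P.hom γ :=
  sum_weight_add _ β γ

/-- The total degree `∑_𝐧 (∑ᵢ 𝐧(i)) β(𝐧)` of the polynomial part. -/
noncomputable def polyDeg (β : CoordIdx d 𝔏) : ℕ :=
  β.sum fun c j => Sum.elim (fun _ => 0) (fun n => n.degree) c * j

theorem polyDeg_add (β γ : CoordIdx d 𝔏) : polyDeg (β + γ) = polyDeg β + polyDeg γ :=
  sum_weight_add (R := ℕ) _ β γ

theorem bracket_inr (n : NVec d) :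
    bracket (Finsupp.single (Sum.inr n) 1 : CoordIdx d 𝔏) = 1 :=
  sum_weight_single _ _

theorem noiseHom_inr (n : NVec d) :
    noiseHom (Finsupp.single (Sum.inr n) 1 : CoordIdx d 𝔏) = 0 :=
  sum_weight_single (R := ℕ) _ _

theorem hom_inr (n : NVec d) :
    P.hom (Finsupp.single (Sum.inr n) 1) = P.scaledDeg n - P.η :=
  sum_weight_single _ _

theorem polyDeg_inr (n : NVec d) :
    polyDeg (Finsupp.single (Sum.inr n) 1 : CoordIdx d 𝔏) = n.degree :=
  sum_weight_single (R := ℕ) _ _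

theorem polyDeg_inl (p : Option 𝔏 × (NVec d →₀ ℕ)) :
    polyDeg (Finsupp.single (Sum.inl p) 1 : CoordIdx d 𝔏) = 0 :=
  sum_weight_single (R := ℕ) _ _

theorem noiseHom_inl (l : Option 𝔏) (k : NVec d →₀ ℕ) :
    noiseHom (Finsupp.single (Sum.inl (l, k)) 1 : CoordIdx d 𝔏) = if l.isSome then 1 else 0 :=
  sum_weight_single (R := ℕ) _ _

theorem bracket_inl_add (l : Option 𝔏) (k : NVec d →₀ ℕ) (n : NVec d) :
    bracket (Finsupp.single (Sum.inl (l, k + Finsupp.single n 1)) 1 : CoordIdx d 𝔏) =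
      bracket (Finsupp.single (Sum.inl (l, k)) 1 : CoordIdx d 𝔏) - 1 := by
  have h : ∀ k' : NVec d →₀ ℕ,
      bracket (Finsupp.single (Sum.inl (l, k')) 1 : CoordIdx d 𝔏) =
        1 - (k'.sum fun _ i => (i : ℤ)) := fun k' => sum_weight_single _ _
  rw [h, h, Finsupp.sum_add_index' (by simp) (by intros; push_cast; rfl),
    Finsupp.sum_single_index (by simp)]
  push_cast
  ring

theorem hom_inl_add (l : Option 𝔏) (k : NVec d →₀ ℕ) (n : NVec d) :
    P.hom (Finsupp.single (Sum.inl (l, k + Finsupp.single n 1)) 1) =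
      P.hom (Finsupp.single (Sum.inl (l, k)) 1) + (P.η - P.scaledDeg n) := by
  have h : ∀ k' : NVec d →₀ ℕ, P.hom (Finsupp.single (Sum.inl (l, k')) 1) =
      P.alpha l + k'.sum (fun n i => (P.η - P.scaledDeg n) * (i : ℝ)) :=
    fun k' => sum_weight_single _ _
  rw [h, h, sum_weight_add, sum_weight_single]
  ring

/-! ### Subcriticality -/

variable {P}

theorem SubcritPair.mono {l : Option 𝔏} {k k' : NVec d →₀ ℕ} (h : P.SubcritPair l k)
    (hk : k' ≤ k) : P.SubcritPair l k' :=
  ⟨h.1, fun k'' h0 h1 => h.2 k'' h0 (h1.trans hk)⟩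

/-- The choice k' = e_𝐧 in the definition reads r < η + (r - |𝐧|). Hence only finitely many D^{(𝐧)}
act nontrivially on a given z_{(𝔩,k)}, and the sum defining ∂ᵢ is finite there. -/
theorem SubcritPair.scaledDeg_lt {l : Option 𝔏} {k : NVec d →₀ ℕ} {n : NVec d}
    (h : P.SubcritPair l (k + Finsupp.single n 1)) : P.scaledDeg n < P.η := by
  have h1 := (h.2 (Finsupp.single n 1) (by simp) le_add_self).1
  rw [sum_weight_single (fun n => P.regSol - P.scaledDeg n)] at h1
  linarith

variable (P)

/-! ### The derivations on variables and monomials -/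

open Classical in
theorem dN_X_inl (n : NVec d) (l : Option 𝔏) (k : NVec d →₀ ℕ) :
    P.dN n (MvPolynomial.X (Sum.inl (l, k))) =
      if P.SubcritPair l (k + Finsupp.single n 1) then
        ((k n : ℝ) + 1) • MvPolynomial.X (Sum.inl (l, k + Finsupp.single n 1))
      else 0 := by
  rw [dN, MvPolynomial.mkDerivation_X]
  rfl

open Classical in
theorem dN_X_inr (n m : NVec d) :
    P.dN n (MvPolynomial.X (Sum.inr m)) = if m = n then 1 else 0 := by
  rw [dN, MvPolynomial.mkDerivation_X]
  rfl

theorem coeff_dN_monomial {n : NVec d} {γ β : CoordIdx d 𝔏}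
    (h : MvPolynomial.coeff β (P.dN n (MvPolynomial.monomial γ 1)) ≠ 0) :
    (∃ l k, γ (Sum.inl (l, k)) ≠ 0 ∧ P.SubcritPair l (k + Finsupp.single n 1) ∧
      β + Finsupp.single (Sum.inl (l, k)) 1 =
        γ + Finsupp.single (Sum.inl (l, k + Finsupp.single n 1)) 1) ∨
    (γ (Sum.inr n) ≠ 0 ∧ β + Finsupp.single (Sum.inr n) 1 = γ) := by
  classical
  obtain ⟨c, δ, hc, hδ, he⟩ := exists_of_coeff_mkDerivation_ne_zero _ h
  rcases c with ⟨l, k⟩ | m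
  · left
    rw [Sum.elim_inl] at hδ
    split_ifs at hδ with hs
    · rw [MvPolynomial.coeff_smul, MvPolynomial.coeff_X] at hδ
      split_ifs at hδ with h1
      · exact ⟨l, k, hc, hs, by rw [he, ← h1]⟩
      · simp at hδ
    · simp at hδ
  · right
    rw [Sum.elim_inr] at hδ
    split_ifs at hδ with hs
    · subst hs
      rw [MvPolynomial.coeff_one] at hδ
      split_ifs at hδ with h1
      · exact ⟨hc, by rw [he, ← h1, add_zero]⟩
      · simp at hδ
    · simp at hδ

theorem coeff_dX_monomial {i : Fin d} {γ β : CoordIdx d 𝔏}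
    (h : MvPolynomial.coeff β (P.dX i (MvPolynomial.monomial γ 1)) ≠ 0) :
    (∃ n l k, γ (Sum.inl (l, k)) ≠ 0 ∧ P.SubcritPair l (k + Finsupp.single n 1) ∧
      β + Finsupp.single (Sum.inl (l, k)) 1 =
        γ + (Finsupp.single (Sum.inl (l, k + Finsupp.single n 1)) 1 +
          Finsupp.single (Sum.inr (n + Finsupp.single i 1)) 1)) ∨
    (∃ n, γ (Sum.inr n) ≠ 0 ∧ β + Finsupp.single (Sum.inr n) 1 =
      γ + Finsupp.single (Sum.inr (n + Finsupp.single i 1)) 1) := by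
  classical
  obtain ⟨c, δ, hc, hδ, he⟩ := exists_of_coeff_mkDerivation_ne_zero _ h
  obtain ⟨n, hn⟩ := exists_of_coeff_finsum_ne_zero hδ
  rw [MvPolynomial.coeff_smul, MvPolynomial.coeff_X_mul'] at hn
  split_ifs at hn with hm
  swap
  · simp at hn
  have hle : Finsupp.single (Sum.inr (n + Finsupp.single i 1)) 1 ≤ δ :=
    Finsupp.single_le_iff.mpr (Nat.one_le_iff_ne_zero.mpr (Finsupp.mem_support_iff.mp hm))
  obtain ⟨ε, rfl⟩ := le_iff_exists_add.mp hle
  rw [add_tsub_cancel_left] at hn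
  have hn' := right_ne_zero_of_smul hn
  rcases c with ⟨l, k⟩ | m
  · left
    rw [dN_X_inl] at hn'
    split_ifs at hn' with hs
    · rw [MvPolynomial.coeff_smul, MvPolynomial.coeff_X] at hn'
      split_ifs at hn' with h1
      · exact ⟨n, l, k, hc, hs, by rw [he, ← h1, add_comm (Finsupp.single (Sum.inr _) 1)]⟩
      · simp at hn'
    · simp at hn'
  · right
    rw [dN_X_inr] at hn'
    split_ifs at hn' with hs
    · subst hs
      rw [MvPolynomial.coeff_one] at hn'
      split_ifs at hn' with h1
      · exact ⟨m, hc, by rw [he, ← h1, add_zero]⟩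
      · simp at hn'
    · simp at hn'

section dNWeights

variable {n : NVec d} {γ β : CoordIdx d 𝔏}
  (h : MvPolynomial.coeff β (P.dN n (MvPolynomial.monomial γ 1)) ≠ 0)
include h

theorem bracket_of_coeff_dN : bracket β = bracket γ - 1 := by
  rcases P.coeff_dN_monomial h with ⟨l, k, -, -, he⟩ | ⟨-, he⟩
  · have := congrArg bracket he
    rw [bracket_add, bracket_add, bracket_inl_add] at this
    linarith
  · have := congrArg bracket he
    rw [bracket_add, bracket_inr] at this
    linarith

theorem noiseHom_of_coeff_dN : noiseHom β = noiseHom γ := by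
  rcases P.coeff_dN_monomial h with ⟨l, k, -, -, he⟩ | ⟨-, he⟩
  · have := congrArg noiseHom he
    rw [noiseHom_add, noiseHom_add, noiseHom_inl, noiseHom_inl] at this
    omega
  · have := congrArg noiseHom he
    rw [noiseHom_add, noiseHom_inr] at this
    omega

theorem hom_of_coeff_dN : P.hom β = P.hom γ + (P.η - P.scaledDeg n) := by
  rcases P.coeff_dN_monomial h with ⟨l, k, -, -, he⟩ | ⟨-, he⟩
  · have := congrArg P.hom he
    rw [hom_add, hom_add, hom_inl_add] at this
    linarith
  · have := congrArg P.hom he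
    rw [hom_add, hom_inr] at this
    linarith

theorem subcrit_of_coeff_dN (hγ : P.Subcrit γ) : P.Subcrit β := by
  classical
  intro l' k' hne
  rcases P.coeff_dN_monomial h with ⟨l, k, -, hs, he⟩ | ⟨-, he⟩
  · have := DFunLike.congr_fun he (Sum.inl (l', k'))
    simp only [Finsupp.add_apply] at this
    by_cases h0 : γ (Sum.inl (l', k')) = 0
    · rw [Finsupp.single_apply (a := Sum.inl (l, k + _))] at this
      split_ifs at this with h1
      · cases h1
        exact hs
      · omega
    · exact hγ _ _ h0
  · refine hγ _ _ fun h0 => hne ?_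
    have := DFunLike.congr_fun he (Sum.inl (l', k'))
    simp only [Finsupp.add_apply] at this
    omega

theorem inr_eq_zero_of_coeff_dN {m : NVec d} (hγ : γ (Sum.inr m) = 0) : β (Sum.inr m) = 0 := by
  classical
  rcases P.coeff_dN_monomial h with ⟨l, k, -, hs, he⟩ | ⟨-, he⟩ <;>
  · have := DFunLike.congr_fun he (Sum.inr m)
    simp [Finsupp.single_apply] at this
    omega

end dNWeights

section dXWeights

variable {i : Fin d} {γ β : CoordIdx d 𝔏}
  (h : MvPolynomial.coeff β (P.dX i (MvPolynomial.monomial γ 1)) ≠ 0)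
include h

theorem bracket_of_coeff_dX : bracket β = bracket γ := by
  rcases P.coeff_dX_monomial h with ⟨n, l, k, -, -, he⟩ | ⟨n, -, he⟩
  · have := congrArg bracket he
    rw [bracket_add, bracket_add, bracket_add, bracket_inl_add, bracket_inr] at this
    linarith
  · have := congrArg bracket he
    rw [bracket_add, bracket_add, bracket_inr, bracket_inr] at this
    linarith

theorem noiseHom_of_coeff_dX : noiseHom β = noiseHom γ := by
  rcases P.coeff_dX_monomial h with ⟨n, l, k, -, -, he⟩ | ⟨n, -, he⟩
  · have := congrArg noiseHom he
    rw [noiseHom_add, noiseHom_add, noiseHom_add, noiseHom_inl, noiseHom_inl,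
      noiseHom_inr] at this
    omega
  · have := congrArg noiseHom he
    rw [noiseHom_add, noiseHom_add, noiseHom_inr, noiseHom_inr] at this
    omega

theorem hom_of_coeff_dX : P.hom β = P.hom γ + P.scal i := by
  rcases P.coeff_dX_monomial h with ⟨n, l, k, -, -, he⟩ | ⟨n, -, he⟩
  · have := congrArg P.hom he
    rw [hom_add, hom_add, hom_add, hom_inl_add, hom_inr, scaledDeg_add, scaledDeg_single] at this
    linarith
  · have := congrArg P.hom he
    rw [hom_add, hom_add, hom_inr, hom_inr, scaledDeg_add, scaledDeg_single] at this
    linarith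

theorem polyDeg_of_coeff_dX : polyDeg γ + 1 ≤ polyDeg β := by
  rcases P.coeff_dX_monomial h with ⟨n, l, k, -, -, he⟩ | ⟨n, -, he⟩
  · have := congrArg polyDeg he
    rw [polyDeg_add, polyDeg_add, polyDeg_add, polyDeg_inl, polyDeg_inl, polyDeg_inr,
      map_add, Finsupp.degree_single] at this
    omega
  · have := congrArg polyDeg he
    rw [polyDeg_add, polyDeg_add, polyDeg_inr, polyDeg_inr, map_add,
      Finsupp.degree_single] at this
    omega

theorem subcrit_of_coeff_dX (hγ : P.Subcrit γ) : P.Subcrit β := by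
  classical
  intro l' k' hne
  rcases P.coeff_dX_monomial h with ⟨n, l, k, -, hs, he⟩ | ⟨n, -, he⟩
  · have := DFunLike.congr_fun he (Sum.inl (l', k'))
    simp only [Finsupp.add_apply] at this
    by_cases h0 : γ (Sum.inl (l', k')) = 0
    · rw [Finsupp.single_apply (a := Sum.inl (l, k + _)),
        Finsupp.single_eq_of_ne (a := Sum.inr _) (by simp)] at this
      split_ifs at this with h1
      · cases h1
        exact hs
      · omega
    · exact hγ _ _ h0
  · refine hγ _ _ fun h0 => hne ?_
    have := DFunLike.congr_fun he (Sum.inl (l', k'))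
    simp [h0] at this
    omega

theorem inr_eq_zero_of_coeff_dX {m : NVec d} (hγ : γ (Sum.inr m) = 0)
    (hm : ∀ n : NVec d, n + Finsupp.single i 1 ≠ m) : β (Sum.inr m) = 0 := by
  classical
  rcases P.coeff_dX_monomial h with ⟨n, l, k, -, hs, he⟩ | ⟨n, -, he⟩ <;>
  · have := DFunLike.congr_fun he (Sum.inr m)
    simp [Finsupp.single_apply, hm, hγ] at this
    omega

end dXWeights

/-! ### Stability of the index sets -/

/-- D^{(𝐧)} lowers the bracket by one and multiplication by z^γ restores it. The noise needed for
membership in `NSet` comes from γ, so γ' need only lie in `NMinus`. -/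
theorem dN_mul_mem_NSet {n : NVec d} {γ γ' β : CoordIdx d 𝔏} (hγ : γ ∈ P.NSet)
    (hγ' : γ' ∈ P.NMinus)
    (h : MvPolynomial.coeff β (P.dN n (MvPolynomial.monomial γ' 1)) ≠ 0) :
    γ + β ∈ P.NSet := by
  refine ⟨⟨?_, ?_, ?_⟩, ?_⟩
  · rw [bracket_add, P.bracket_of_coeff_dN h, hγ.1.1, hγ'.1]
    norm_num
  · intro l k hne
    by_cases h0 : γ (Sum.inl (l, k)) = 0
    · refine P.subcrit_of_coeff_dN h hγ'.2.1 l k ?_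
      simpa [h0] using hne
    · exact hγ.1.2.1 l k h0
  · intro m hm
    rw [Finsupp.add_apply, hγ.1.2.2 m hm, P.inr_eq_zero_of_coeff_dN h (hγ'.2.2 m hm)]
  · rw [noiseHom_add]
    exact Nat.add_pos_left hγ.2 _

/-- The only polynomial variable that ∂ᵢ creates is of the form z_{𝐧+eᵢ}, and |𝐧+eᵢ| ≥ 𝔰ᵢ ≥ r. It is
therefore never one of the excluded variables. -/
theorem dX_mem_NMinus (hscal : ∀ i, 1 ≤ P.scal i) (hsol : ∀ i, P.regSol ≤ P.scal i) {i : Fin d}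
    {γ β : CoordIdx d 𝔏} (hγ : γ ∈ P.NMinus)
    (h : MvPolynomial.coeff β (P.dX i (MvPolynomial.monomial γ 1)) ≠ 0) : β ∈ P.NMinus := by
  refine ⟨(P.bracket_of_coeff_dX h).trans hγ.1, P.subcrit_of_coeff_dX h hγ.2.1, fun m hm => ?_⟩
  refine P.inr_eq_zero_of_coeff_dX h (hγ.2.2 m hm) fun n hn => ?_
  have := P.scal_le_scaledDeg_add_single hscal n i
  rw [hn] at this
  linarith [hsol i]

theorem dX_mem_NSet (hscal : ∀ i, 1 ≤ P.scal i) (hsol : ∀ i, P.regSol ≤ P.scal i) {i : Fin d}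
    {γ β : CoordIdx d 𝔏} (hγ : γ ∈ P.NSet)
    (h : MvPolynomial.coeff β (P.dX i (MvPolynomial.monomial γ 1)) ≠ 0) : β ∈ P.NSet :=
  ⟨P.dX_mem_NMinus hscal hsol hγ.1 h, by rw [P.noiseHom_of_coeff_dX h]; exact hγ.2⟩

/-! ### Commutators of the derivations -/

/-- Subcriticality passes to smaller k. Hence the restriction met at the intermediate step is
implied by the one on k + e_𝐧 + e_𝐦, which is symmetric in 𝐧 and 𝐦. -/
theorem dN_comm (n m : NVec d) (q : CoordPoly d 𝔏) : P.dN n (P.dN m q) = P.dN m (P.dN n q) := by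
  classical
  have key : ∀ (n m : NVec d) (l : Option 𝔏) (k : NVec d →₀ ℕ), n ≠ m →
      P.dN n (P.dN m (MvPolynomial.X (Sum.inl (l, k)))) =
        if P.SubcritPair l (k + Finsupp.single n 1 + Finsupp.single m 1) then
          (((k n : ℝ) + 1) * ((k m : ℝ) + 1)) •
            MvPolynomial.X (Sum.inl (l, k + Finsupp.single n 1 + Finsupp.single m 1))
        else 0 := by
    intro n m l k hnm
    rw [dN_X_inl]
    by_cases h1 : P.SubcritPair l (k + Finsupp.single n 1 + Finsupp.single m 1)
    · have h2 : P.SubcritPair l (k + Finsupp.single m 1) :=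
        h1.mono (add_le_add le_self_add le_rfl)
      rw [if_pos h2, Derivation.map_smul, dN_X_inl, add_right_comm k, if_pos h1, if_pos h1,
        smul_smul, Finsupp.add_apply, Finsupp.single_eq_of_ne hnm, add_zero, mul_comm]
    · rw [if_neg h1]
      split_ifs with h2
      · rw [Derivation.map_smul, dN_X_inl, add_right_comm k, if_neg h1, smul_zero]
      · exact map_zero _
  have h : ⁅P.dN n, P.dN m⁆ = 0 := by
    refine MvPolynomial.derivation_ext fun c => ?_
    rw [Derivation.commutator_apply, Derivation.zero_apply, sub_eq_zero]
    by_cases hnm : n = m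
    · rw [hnm]
    rcases c with ⟨l, k⟩ | a
    · rw [key n m l k hnm, key m n l k (Ne.symm hnm), add_right_comm k, mul_comm ((k n : ℝ) + 1)]
    · simp only [dN_X_inr]
      split_ifs <;> simp
  have := DFunLike.congr_fun h q
  rwa [Derivation.commutator_apply, Derivation.zero_apply, sub_eq_zero] at this

theorem exists_finset_dN_X_eq_zero (hscal : ∀ i, 1 ≤ P.scal i) (c : Coord d 𝔏) :
    ∃ F : Finset (NVec d), ∀ n ∉ F, P.dN n (MvPolynomial.X c) = 0 := by
  classical
  rcases c with ⟨l, k⟩ | m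
  · refine ⟨(P.finite_scaledDeg_lt hscal P.η).toFinset, fun n hn => ?_⟩
    rw [dN_X_inl, if_neg]
    intro h
    exact hn ((Set.Finite.mem_toFinset _).mpr h.scaledDeg_lt)
  · refine ⟨{m}, fun n hn => ?_⟩
    rw [dN_X_inr, if_neg]
    rintro rfl
    exact hn (Finset.mem_singleton_self _)

theorem derivation_sum_apply {A ι : Type*} [CommRing A] [Algebra ℝ A] (F : Finset ι)
    (D : ι → Derivation ℝ A A) (a : A) : (∑ i ∈ F, D i) a = ∑ i ∈ F, D i a := by
  classical
  induction F using Finset.induction_on with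
  | empty => simp
  | insert i s hi ih => rw [Finset.sum_insert hi, Finset.sum_insert hi, Derivation.add_apply, ih]

/-- After enlarging `F` to include every index relevant for some variable of `q`, both sides are
derivations agreeing on these variables; the added terms vanish on `q`. This is how the formal
series for ∂ᵢ is used on arbitrary polynomials. -/
theorem dX_eq_sum (hscal : ∀ i, 1 ≤ P.scal i) (i : Fin d) (q : CoordPoly d 𝔏)
    (F : Finset (NVec d)) (hF : ∀ n ∉ F, P.dN n q = 0) :
    P.dX i q = ∑ n ∈ F, ((n i : ℝ) + 1) •
      (MvPolynomial.X (Sum.inr (n + Finsupp.single i 1)) * P.dN n q) := by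
  classical
  choose G hG using P.exists_finset_dN_X_eq_zero hscal
  let F' := F ∪ q.vars.biUnion G
  let D : Derivation ℝ (CoordPoly d 𝔏) (CoordPoly d 𝔏) := ∑ n ∈ F', ((n i : ℝ) + 1) •
      ((MvPolynomial.X (Sum.inr (n + Finsupp.single i 1)) : CoordPoly d 𝔏) • P.dN n)
  have hD : ∀ p, D p = ∑ n ∈ F', ((n i : ℝ) + 1) •
      (MvPolynomial.X (Sum.inr (n + Finsupp.single i 1)) * P.dN n p) := by
    intro p
    rw [derivation_sum_apply]
    rfl
  have hDq : P.dX i q = D q := by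
    refine MvPolynomial.derivation_eq_of_forall_mem_vars fun c hc => ?_
    rw [hD, dX, MvPolynomial.mkDerivation_X]
    refine finsum_eq_sum_of_support_subset _ fun n hn => ?_
    by_contra hnF
    refine hn ?_
    have : n ∉ G c := fun h => hnF (Finset.mem_coe.mpr (Finset.mem_union_right _
      (Finset.mem_biUnion.mpr ⟨c, hc, h⟩)))
    simp only [hG c n this, mul_zero, smul_zero]
  rw [hDq, hD]
  refine (Finset.sum_subset Finset.subset_union_left fun n _ hn => ?_).symm
  rw [hF n hn, mul_zero, smul_zero]

/-- As the D^{(𝐧)} commute, the commutator only sees D^{(𝐧)} acting on the coefficients z_{𝐦+eᵢ} of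
∂ᵢ, which picks out 𝐦 = 𝐧 - eᵢ with factor 𝐦(i) + 1 = 𝐧(i). -/
theorem dN_dX (hscal : ∀ i, 1 ≤ P.scal i) (n : NVec d) (i : Fin d) (q : CoordPoly d 𝔏) :
    P.dN n (P.dX i q) =
      P.dX i (P.dN n q) + (n i : ℝ) • P.dN (n - Finsupp.single i 1) q := by
  classical
  have h : ⁅P.dN n, P.dX i⁆ = (n i : ℝ) • P.dN (n - Finsupp.single i 1) := by
    refine MvPolynomial.derivation_ext fun c => ?_
    obtain ⟨F, hF⟩ := P.exists_finset_dN_X_eq_zero hscal c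
    have hF' : ∀ m ∉ insert (n - Finsupp.single i 1) F, P.dN m (MvPolynomial.X c) = 0 :=
      fun m hm => hF m fun h => hm (Finset.mem_insert_of_mem h)
    rw [Derivation.commutator_apply, P.dX_eq_sum hscal i _ _ hF',
      P.dX_eq_sum hscal i (P.dN n _) (insert (n - Finsupp.single i 1) F)
        (fun m hm => by rw [P.dN_comm, hF' m hm, map_zero]), map_sum, ← Finset.sum_sub_distrib]
    have : ∀ m ∈ insert (n - Finsupp.single i 1) F,
        P.dN n (((m i : ℝ) + 1) • (MvPolynomial.X (Sum.inr (m + Finsupp.single i 1)) *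
            P.dN m (MvPolynomial.X c))) -
          ((m i : ℝ) + 1) • (MvPolynomial.X (Sum.inr (m + Finsupp.single i 1)) *
            P.dN m (P.dN n (MvPolynomial.X c))) =
        if m = n - Finsupp.single i 1 then (n i : ℝ) • P.dN m (MvPolynomial.X c) else 0 := by
      intro m _
      rw [Derivation.map_smul, Derivation.leibniz, P.dN_comm m n, dN_X_inr, ← smul_sub,
        smul_eq_mul, add_sub_cancel_left]
      by_cases hmn : m + Finsupp.single i 1 = n
      · have h1 : m = n - Finsupp.single i 1 := by rw [← hmn, add_tsub_cancel_right]
        rw [if_pos hmn, if_pos h1, smul_eq_mul, mul_one, ← hmn]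
        simp
      · rw [if_neg hmn, smul_zero, smul_zero]
        split_ifs with h1
        -- The subtraction 𝐧 - eᵢ was truncated, which happens only for 𝐧(i) = 0; the factor 𝐧(i)
        -- then makes the spurious term vanish.
        · have : n i = 0 := by
            by_contra h0
            refine hmn ?_
            rw [h1, tsub_add_cancel_of_le]
            exact Finsupp.single_le_iff.mpr (Nat.one_le_iff_ne_zero.mpr h0)
          rw [this, Nat.cast_zero, zero_smul]
        · rfl
    rw [Finset.sum_congr rfl this, Finset.sum_ite_eq', if_pos (Finset.mem_insert_self _ _)]
    rfl
  have := DFunLike.congr_fun h q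
  rw [Derivation.commutator_apply, sub_eq_iff_eq_add'] at this
  exact this

theorem dX_X_inr (hscal : ∀ i, 1 ≤ P.scal i) (i : Fin d) (n : NVec d) :
    P.dX i (MvPolynomial.X (Sum.inr n)) =
      ((n i : ℝ) + 1) • MvPolynomial.X (Sum.inr (n + Finsupp.single i 1)) := by
  classical
  rw [P.dX_eq_sum hscal i _ {n} (fun m hm => by
    rw [dN_X_inr, if_neg (fun h => hm (Finset.mem_singleton.mpr h.symm))]),
    Finset.sum_singleton, dN_X_inr, if_pos rfl, mul_one]

theorem dX_comm (hscal : ∀ i, 1 ≤ P.scal i) (i j : Fin d) : ⁅P.dX i, P.dX j⁆ = 0 := by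
  classical
  refine MvPolynomial.derivation_ext fun c => ?_
  rw [Derivation.commutator_apply, Derivation.zero_apply, sub_eq_zero]
  obtain ⟨F, hF⟩ := P.exists_finset_dN_X_eq_zero hscal c
  -- By the Leibniz rule ∂ᵢ acts either on the coefficient z_{𝐧+eⱼ} or on D^{(𝐧)}z_c. Each of the
  -- resulting sums is symmetric in i and j.
  have key : ∀ i j : Fin d, P.dX i (P.dX j (MvPolynomial.X c)) =
      ∑ n ∈ F, ((((n j : ℝ) + 1) * (((n + Finsupp.single j 1 : NVec d) i : ℝ) + 1)) •
        (MvPolynomial.X (Sum.inr (n + Finsupp.single j 1 + Finsupp.single i 1)) *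
          P.dN n (MvPolynomial.X c))) +
      ∑ n ∈ F, ∑ m ∈ F, (((n j : ℝ) + 1) * ((m i : ℝ) + 1)) •
        (MvPolynomial.X (Sum.inr (n + Finsupp.single j 1)) *
          (MvPolynomial.X (Sum.inr (m + Finsupp.single i 1)) *
            P.dN m (P.dN n (MvPolynomial.X c)))) := by
    intro i j
    rw [P.dX_eq_sum hscal j _ F hF, map_sum, ← Finset.sum_add_distrib]
    refine Finset.sum_congr rfl fun n _ => ?_
    rw [Derivation.map_smul, Derivation.leibniz, P.dX_X_inr hscal,
      P.dX_eq_sum hscal i (P.dN n _) F (fun m hm => by rw [P.dN_comm, hF m hm, map_zero]),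
      smul_add]
    refine (add_comm _ _).trans (congrArg₂ (· + ·) ?_ ?_)
    · rw [smul_eq_mul, mul_smul_comm, smul_smul, mul_comm (P.dN n _)]
    · rw [smul_eq_mul, Finset.mul_sum, Finset.smul_sum]
      refine Finset.sum_congr rfl fun m _ => ?_
      rw [mul_smul_comm, smul_smul]
  rw [key i j, key j i, Finset.sum_comm (s := F) (t := F)]
  refine congrArg₂ (· + ·) (Finset.sum_congr rfl fun n _ => ?_)
    (Finset.sum_congr rfl fun n _ => Finset.sum_congr rfl fun m _ => ?_)
  · have h : ((n j : ℝ) + 1) * (((n + Finsupp.single j 1 : NVec d) i : ℝ) + 1) =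
        ((n i : ℝ) + 1) * (((n + Finsupp.single i 1 : NVec d) j : ℝ) + 1) := by
      by_cases hij : i = j
      · rw [hij]
      · rw [Finsupp.add_apply, Finsupp.add_apply, Finsupp.single_eq_of_ne hij,
          Finsupp.single_eq_of_ne (Ne.symm hij), add_zero, add_zero, mul_comm]
    rw [add_right_comm n, h]
  · rw [P.dN_comm n m, mul_comm ((m j : ℝ) + 1), mul_left_comm]

end RegParams

-- Induction in the enveloping algebra and primitive elements acting on tensors.

attribute [local instance] LieRing.ofAssociativeRing in
theorem enveloping_induction {L : Type*} [LieRing L] [LieAlgebra ℝ L]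
    {p : UniversalEnvelopingAlgebra ℝ L → Prop} (one : p 1)
    (add : ∀ u v, p u → p v → p (u + v)) (smul : ∀ (c : ℝ) u, p u → p (c • u))
    (ι_mul : ∀ (x : L) u, p u → p (UniversalEnvelopingAlgebra.ι ℝ x * u))
    (u : UniversalEnvelopingAlgebra ℝ L) : p u :=
  enveloping_left_induction
    { carrier := {u | p u}
      add_mem' := fun {a c} ha hc => add a c ha hc
      zero_mem' := by simpa using smul 0 1 one
      smul_mem' := smul } one ι_mul u

/-- The hypothesis abstracts the recursion for U ↦ π U D^{(𝐧)}, with `g` the same map for the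
coefficient aπ. The summand 1 ⊗ a acts on the other leg and commutes with `f`. -/
theorem rTensor_primitive_mul {A : Type*} [Ring A] [Algebra ℝ A] (f g : A →ₗ[ℝ] A) (a : A)
    (h : ∀ u, f (a * u) = a * f u - g u) (t : A ⊗[ℝ] A) :
    f.rTensor A ((a ⊗ₜ[ℝ] (1 : A) + (1 : A) ⊗ₜ[ℝ] a) * t) =
      (a ⊗ₜ[ℝ] (1 : A) + (1 : A) ⊗ₜ[ℝ] a) * f.rTensor A t - g.rTensor A t := by
  induction t with
  | zero => simp
  | add x y hx hy =>
    rw [mul_add, map_add, hx, hy, map_add, map_add, mul_add]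
    abel
  | tmul x y =>
    simp only [add_mul, Algebra.TensorProduct.tmul_mul_tmul, one_mul, map_add,
      LinearMap.rTensor_tmul, h, TensorProduct.sub_tmul]
    abel

theorem lTensor_primitive_mul {A : Type*} [Ring A] [Algebra ℝ A] (f g : A →ₗ[ℝ] A) (a : A)
    (h : ∀ u, f (a * u) = a * f u - g u) (t : A ⊗[ℝ] A) :
    f.lTensor A ((a ⊗ₜ[ℝ] (1 : A) + (1 : A) ⊗ₜ[ℝ] a) * t) =
      (a ⊗ₜ[ℝ] (1 : A) + (1 : A) ⊗ₜ[ℝ] a) * f.lTensor A t - g.lTensor A t := by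
  induction t with
  | zero => simp
  | add x y hx hy =>
    rw [mul_add, map_add, hx, hy, map_add, map_add, mul_add]
    abel
  | tmul x y =>
    simp only [add_mul, Algebra.TensorProduct.tmul_mul_tmul, one_mul, map_add,
      LinearMap.lTensor_tmul, h, TensorProduct.tmul_sub]
    abel

namespace RegParams

variable {d : ℕ} {𝔏 : Type*}

/-! ### Spaces spanned by monomials -/

/-- The span of the monomials with exponents in `S`. -/
noncomputable def monSpan (S : Set (CoordIdx d 𝔏)) : Submodule ℝ (CoordPoly d 𝔏) :=
  Submodule.span ℝ ((fun γ => MvPolynomial.monomial γ (1 : ℝ)) '' S)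

theorem monomial_mem_monSpan {S : Set (CoordIdx d 𝔏)} {γ : CoordIdx d 𝔏} (h : γ ∈ S) :
    MvPolynomial.monomial γ (1 : ℝ) ∈ monSpan S :=
  Submodule.subset_span (Set.mem_image_of_mem _ h)

theorem mem_monSpan_of_coeff {S : Set (CoordIdx d 𝔏)} {q : CoordPoly d 𝔏}
    (h : ∀ β, MvPolynomial.coeff β q ≠ 0 → β ∈ S) : q ∈ monSpan S := by
  rw [q.as_sum]
  refine Submodule.sum_mem _ fun β hβ => ?_
  have : MvPolynomial.monomial β (MvPolynomial.coeff β q) =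
      MvPolynomial.coeff β q • MvPolynomial.monomial β (1 : ℝ) := by
    rw [MvPolynomial.smul_monomial, smul_eq_mul, mul_one]
  rw [this]
  exact Submodule.smul_mem _ _ (monomial_mem_monSpan (h β (MvPolynomial.mem_support_iff.mp hβ)))

theorem map_mem_monSpan {S : Set (CoordIdx d 𝔏)} (T : CoordPoly d 𝔏 →ₗ[ℝ] CoordPoly d 𝔏)
    (h : ∀ γ ∈ S, ∀ β, MvPolynomial.coeff β (T (MvPolynomial.monomial γ 1)) ≠ 0 → β ∈ S)
    {q : CoordPoly d 𝔏} (hq : q ∈ monSpan S) : T q ∈ monSpan S := by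
  induction hq using Submodule.span_induction with
  | mem x hx =>
    obtain ⟨γ, hγ, rfl⟩ := hx
    exact mem_monSpan_of_coeff (h γ hγ)
  | zero => rw [map_zero]; exact Submodule.zero_mem _
  | add x y _ _ hx hy => rw [map_add]; exact Submodule.add_mem _ hx hy
  | smul c x _ hx => rw [map_smul]; exact Submodule.smul_mem _ _ hx

variable (P : RegParams d 𝔏)

theorem coeff_zD_monomial {γ γ' β : CoordIdx d 𝔏} {n : NVec d}
    (h : MvPolynomial.coeff β (P.zD γ n (MvPolynomial.monomial γ' 1)) ≠ 0) :
    ∃ β', β = γ + β' ∧ MvPolynomial.coeff β' (P.dN n (MvPolynomial.monomial γ' 1)) ≠ 0 := by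
  classical
  rw [zD, Derivation.smul_apply, smul_eq_mul, MvPolynomial.coeff_monomial_mul', one_mul] at h
  split_ifs at h with hle
  · exact ⟨β - γ, (add_tsub_cancel_of_le hle).symm, h⟩
  · exact absurd rfl h

/-- The derivations preserving a given subspace form a Lie algebra, so it suffices to inspect the
generators on monomials. -/
theorem LPlus_map_mem_monSpan {S : Set (CoordIdx d 𝔏)}
    (hS : ∀ g : P.PlusGen, ∀ γ ∈ S, ∀ β,
      MvPolynomial.coeff β (P.genDer g (MvPolynomial.monomial γ 1)) ≠ 0 → β ∈ S)
    (x : P.LPlus) : ∀ q ∈ monSpan S, x.1 q ∈ monSpan S := by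
  obtain ⟨x, hx⟩ := x
  change ∀ q ∈ monSpan S, x q ∈ monSpan S
  refine LieSubalgebra.lieSpan_induction ℝ (p := fun x _ => ∀ q ∈ monSpan S, x q ∈ monSpan S)
    ?_ ?_ ?_ ?_ ?_ hx
  · rintro _ ⟨g, rfl⟩ q hq
    exact map_mem_monSpan (P.genDer g : CoordPoly d 𝔏 →ₗ[ℝ] CoordPoly d 𝔏) (hS g) hq
  · intro q _
    exact Submodule.zero_mem _
  · intro x y _ _ hx hy q hq
    exact Submodule.add_mem _ (hx q hq) (hy q hq)
  · intro c x _ hx q hq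
    exact Submodule.smul_mem _ c (hx q hq)
  · intro x y _ _ hx hy q hq
    rw [Derivation.commutator_apply]
    exact Submodule.sub_mem _ (hx _ (hy q hq)) (hy _ (hx q hq))

/-- The span of the `z^γ` with `(γ,𝐧) ∈ ℳ⁺`. -/
noncomputable def coeffSpan (n : NVec d) : Submodule ℝ (CoordPoly d 𝔏) := monSpan {γ | (γ, n) ∈ P.MPlus}

theorem coeffSpan_anti {n m : NVec d} (h : P.scaledDeg n ≤ P.scaledDeg m) :
    P.coeffSpan m ≤ P.coeffSpan n :=
  Submodule.span_mono (Set.image_mono fun _ hγ => ⟨hγ.1, h.trans_lt hγ.2⟩)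

section Stability

variable (hscal : ∀ i, 1 ≤ P.scal i) (hsol : ∀ i, P.regSol ≤ P.scal i)
include hscal hsol

/-- A generator z^{γ'} D^{(𝐧')} raises the homogeneity by |γ'| + η - |𝐧'| > 0 and ∂ᵢ raises it by
𝔰ᵢ, so |𝐧| < η + |γ| is never lost. This keeps the terms z^β U D^{(𝐧)} of the recursion within `ℳ⁺`.
-/
theorem LPlus_map_mem_coeffSpan (x : P.LPlus) (n : NVec d) :
    ∀ q ∈ P.coeffSpan n, x.1 q ∈ P.coeffSpan n := by
  refine P.LPlus_map_mem_monSpan (fun g γ hγ β h => ?_) x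
  rcases g with ⟨⟨γ', n'⟩, hp⟩ | i
  · obtain ⟨β', rfl, h'⟩ := P.coeff_zD_monomial h
    refine ⟨P.dN_mul_mem_NSet hp.1 hγ.1.1 h', ?_⟩
    have h1 := hp.2
    have h2 := hγ.2
    simp only at h1 h2 ⊢
    rw [hom_add, P.hom_of_coeff_dN h']
    linarith
  · refine ⟨P.dX_mem_NSet hscal hsol hγ.1 h, ?_⟩
    have h2 := hγ.2
    simp only at h2 ⊢
    rw [P.hom_of_coeff_dX h]
    linarith [hscal i]

/-- The one case outside `NMinus` is a purely polynomial e_𝐦: z^γ D^{(𝐧)} sends it to z^γ or 0, and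
∂ᵢ sends it to a multiple of z_{𝐦+eᵢ}. -/
theorem LPlus_map_mem_modelSpan (x : P.LPlus) :
    ∀ q ∈ monSpan (P.Populated ∪ P.NMinus), x.1 q ∈ monSpan (P.Populated ∪ P.NMinus) := by
  classical
  refine P.LPlus_map_mem_monSpan (fun g γ hγ β h => ?_) x
  rcases g with ⟨⟨γ', n'⟩, hp⟩ | i
  · left; right
    obtain ⟨β', rfl, h'⟩ := P.coeff_zD_monomial h
    rcases hγ with (⟨m, rfl⟩ | hγ) | hγ
    · rcases P.coeff_dN_monomial h' with ⟨l, k, h0, -⟩ | ⟨h0, he⟩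
      · simp at h0
      · have hm : m = n' := by
          by_contra hne
          exact h0 (Finsupp.single_eq_of_ne (by simpa using Ne.symm hne))
        subst hm
        rw [add_eq_right.mp he, add_zero]
        exact hp.1
    · exact P.dN_mul_mem_NSet hp.1 hγ.1 h'
    · exact P.dN_mul_mem_NSet hp.1 hγ h'
  · rcases hγ with (⟨m, rfl⟩ | hγ) | hγ
    · rcases P.coeff_dX_monomial h with ⟨n, l, k, h0, -⟩ | ⟨n, h0, he⟩
      · simp at h0
      · have hm : m = n := by
          by_contra hne
          exact h0 (Finsupp.single_eq_of_ne (by simpa using Ne.symm hne))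
        subst hm
        rw [add_comm β, add_right_inj] at he
        left; left
        exact ⟨_, he.symm⟩
    · right; exact P.dX_mem_NMinus hscal hsol hγ.1 h
    · right; exact P.dX_mem_NMinus hscal hsol hγ h

end Stability

/-! ### The representation `ρ` -/

section Rho

attribute [local instance] LieRing.ofAssociativeRing

local notation "ιU" => UniversalEnvelopingAlgebra.ι ℝ (L := P.LPlus)

theorem rho_ι_apply (x : P.LPlus) (q : CoordPoly d 𝔏) : P.rho (ιU x) q = x.1 q := by
  rw [rho, UniversalEnvelopingAlgebra.lift_ι_apply]
  rfl

theorem rho_ι_mul_apply (x : P.LPlus) (u : P.UPlus) (q : CoordPoly d 𝔏) :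
    P.rho (ιU x * u) q = x.1 (P.rho u q) := by
  rw [map_mul, Module.End.mul_apply, rho_ι_apply]

/-- Derivations annihilate constants, so only the scalar part of `u` survives. -/
theorem rho_apply_one (u : P.UPlus) : P.rho u 1 = MvPolynomial.C (envelopingCounit u) := by
  induction u using enveloping_induction with
  | one => simp
  | add u v hu hv => rw [map_add, LinearMap.add_apply, hu, hv, map_add, map_add]
  | smul c u hu =>
    rw [map_smul, LinearMap.smul_apply, hu, map_smul, smul_eq_mul, map_mul,
      MvPolynomial.smul_eq_C_mul]
  | ι_mul x u hu =>
    rw [rho_ι_mul_apply, hu, map_mul, envelopingCounit_ι, zero_mul, map_zero]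
    exact Derivation.map_algebraMap _ _

theorem rho_mem_modelSpan (hscal : ∀ i, 1 ≤ P.scal i) (hsol : ∀ i, P.regSol ≤ P.scal i)
    (u : P.UPlus) : ∀ q ∈ monSpan (P.Populated ∪ P.NMinus),
      P.rho u q ∈ monSpan (P.Populated ∪ P.NMinus) := by
  induction u using enveloping_induction with
  | one => intro q hq; simpa using hq
  | add u v hu hv =>
    intro q hq
    rw [map_add]
    exact Submodule.add_mem _ (hu q hq) (hv q hq)
  | smul c u hu =>
    intro q hq
    rw [map_smul]
    exact Submodule.smul_mem _ _ (hu q hq)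
  | ι_mul x u hu =>
    intro q hq
    rw [rho_ι_mul_apply]
    exact P.LPlus_map_mem_modelSpan hscal hsol x _ (hu q hq)

/-! ### The maps `U ↦ π U D^{(𝐧)}` -/

/-- The map `U ↦ π U D^{(𝐧)}`, for a polynomial `π`. -/
noncomputable def sandwichLin (n : NVec d) (π : CoordPoly d 𝔏) : P.UPlus →ₗ[ℝ] P.UPlus where
  toFun U := P.homAction U (P.zDLinear n) π
  map_add' U V := by rw [map_add, LinearMap.add_apply, LinearMap.add_apply]
  map_smul' c U := by rw [map_smul, LinearMap.smul_apply, LinearMap.smul_apply, RingHom.id_apply]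

theorem sandwich_eq (p : P.MPlus) (U : P.UPlus) :
    P.sandwich p U = P.sandwichLin p.1.2 (MvPolynomial.monomial p.1.1 1) U := rfl

theorem sandwichLin_ι_mul (n : NVec d) (π : CoordPoly d 𝔏) (x : P.LPlus) (U : P.UPlus) :
    P.sandwichLin n π (ιU x * U) = ιU x * P.sandwichLin n π U - P.sandwichLin n (x.1 π) U := by
  change P.homAction (ιU x * U) (P.zDLinear n) π = _
  simp only [map_mul, homAction]
  rw [Module.End.mul_apply, UniversalEnvelopingAlgebra.lift_ι_apply]
  rfl

theorem sandwichLin_one (n : NVec d) (π : CoordPoly d 𝔏) :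
    P.sandwichLin n π 1 = P.zDLinear n π := by
  change P.homAction 1 (P.zDLinear n) π = _
  rw [map_one, Module.End.one_apply]

theorem sandwichLin_ι (n : NVec d) (π : CoordPoly d 𝔏) (x : P.LPlus) :
    P.sandwichLin n π (ιU x) = ιU x * P.zDLinear n π - P.zDLinear n (x.1 π) := by
  have := P.sandwichLin_ι_mul n π x 1
  rwa [mul_one, sandwichLin_one, sandwichLin_one] at this

/-- `zDLinear` has the default value 0 off `ℳ⁺`. On `coeffSpan` the default plays no role, and
`zDLinear n π` is the image of the genuine derivation π D^{(𝐧)}, so identities can be checked among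
derivations. -/
theorem exists_zDLinear_eq {n : NVec d} {π : CoordPoly d 𝔏} (hπ : π ∈ P.coeffSpan n) :
    ∃ x : P.LPlus, x.1 = π • P.dN n ∧ P.zDLinear n π = ιU x := by
  induction hπ using Submodule.span_induction with
  | mem q hq =>
    obtain ⟨γ, hγ, rfl⟩ := hq
    refine ⟨P.gen (Sum.inl ⟨(γ, n), hγ⟩), rfl, ?_⟩
    rw [← sandwichLin_one, ← P.sandwich_eq ⟨(γ, n), hγ⟩, sandwich_one]
    rfl
  | zero => exact ⟨0, (zero_smul _ _).symm, by rw [map_zero, map_zero]⟩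
  | add p q _ _ hp hq =>
    obtain ⟨x, hx, hx'⟩ := hp
    obtain ⟨y, hy, hy'⟩ := hq
    exact ⟨x + y, by rw [add_smul, ← hx, ← hy]; rfl, by rw [map_add, map_add, hx', hy']⟩
  | smul c p _ hp =>
    obtain ⟨x, hx, hx'⟩ := hp
    exact ⟨c • x, by rw [smul_assoc, ← hx]; rfl, by rw [map_smul, map_smul, hx']⟩

section Sandwich

variable (hscal : ∀ i, 1 ≤ P.scal i) (hsol : ∀ i, P.regSol ≤ P.scal i)
include hscal hsol

/-- This justifies the notation π U D^{(𝐧)}: the correction term of the recursion cancels the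
Leibniz term in which the derivation hits π. The induction needs all π at once, since the recursion
replaces π by xπ. -/
theorem rho_sandwichLin (U : P.UPlus) {n : NVec d} : ∀ π ∈ P.coeffSpan n, ∀ q,
    P.rho (P.sandwichLin n π U) q = π * P.rho U (P.dN n q) := by
  induction U using enveloping_induction with
  | one =>
    intro π hπ q
    obtain ⟨x, hx, hx'⟩ := P.exists_zDLinear_eq hπ
    rw [sandwichLin_one, hx', rho_ι_apply, hx, map_one, Module.End.one_apply]
    rfl
  | add u v hu hv =>
    intro π hπ q
    rw [map_add, map_add, LinearMap.add_apply, hu π hπ, hv π hπ, map_add, LinearMap.add_apply,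
      mul_add]
  | smul c u hu =>
    intro π hπ q
    rw [map_smul, map_smul, LinearMap.smul_apply, hu π hπ, map_smul, LinearMap.smul_apply,
      mul_smul_comm]
  | ι_mul x u hu =>
    intro π hπ q
    rw [sandwichLin_ι_mul, map_sub, LinearMap.sub_apply, rho_ι_mul_apply, hu π hπ,
      hu _ (P.LPlus_map_mem_coeffSpan hscal hsol x n π hπ), rho_ι_mul_apply, Derivation.leibniz,
      smul_eq_mul, smul_eq_mul, mul_comm (x.1 π), add_sub_cancel_right]

/-- For U = 1, with x = πD^{(𝐧)} and x' = π'D^{(𝐧')}, the two orders give xx' - (xπ')D^{(𝐧')} and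
x'x - (x'π)D^{(𝐧)}. They agree because [x,x'] = (xπ')D^{(𝐧')} - (x'π)D^{(𝐧)}, the D's commuting. In
the inductive step both orders produce the same correction terms. -/
theorem sandwichLin_comm (U : P.UPlus) {n n' : NVec d} :
    ∀ π ∈ P.coeffSpan n, ∀ π' ∈ P.coeffSpan n',
      P.sandwichLin n' π' (P.sandwichLin n π U) = P.sandwichLin n π (P.sandwichLin n' π' U) := by
  induction U using enveloping_induction with
  | one =>
    intro π hπ π' hπ'
    obtain ⟨x, hx, hxι⟩ := P.exists_zDLinear_eq hπ
    obtain ⟨x', hx', hxι'⟩ := P.exists_zDLinear_eq hπ'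
    obtain ⟨y, hy, hyι⟩ := P.exists_zDLinear_eq (P.LPlus_map_mem_coeffSpan hscal hsol x n' π' hπ')
    obtain ⟨y', hy', hyι'⟩ := P.exists_zDLinear_eq (P.LPlus_map_mem_coeffSpan hscal hsol x' n π hπ)
    have hxy : ⁅x, x'⁆ = y - y' := by
      refine Subtype.ext (Derivation.ext fun q => ?_)
      rw [LieSubalgebra.coe_bracket, AddSubgroupClass.coe_sub, Derivation.commutator_apply,
        Derivation.sub_apply, hy, hy', hx, hx']
      simp only [Derivation.smul_apply, Derivation.leibniz, smul_eq_mul]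
      rw [P.dN_comm n' n]
      ring
    rw [sandwichLin_one, sandwichLin_one, hxι, hxι', sandwichLin_ι, sandwichLin_ι, hxι, hxι',
      hyι, hyι', sub_eq_sub_iff_sub_eq_sub, ← LieRing.of_associative_ring_bracket,
      ← LieHom.map_lie, hxy, map_sub]
  | add u v hu hv =>
    intro π hπ π' hπ'
    simp only [map_add, hu π hπ π' hπ', hv π hπ π' hπ']
  | smul c u hu =>
    intro π hπ π' hπ'
    simp only [map_smul, hu π hπ π' hπ']
  | ι_mul x u hu =>
    intro π hπ π' hπ'
    simp only [sandwichLin_ι_mul, map_sub]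
    rw [hu π hπ π' hπ', hu π hπ _ (P.LPlus_map_mem_coeffSpan hscal hsol x n' π' hπ'),
      hu _ (P.LPlus_map_mem_coeffSpan hscal hsol x n π hπ) π' hπ']
    abel

/-- The map is a coderivation: at U = 1 this is primitivity of πD^{(𝐧)}, and the recursion is
compatible with multiplication by a primitive element on each leg. -/
theorem comul_sandwichLin (U : P.UPlus) {n : NVec d} : ∀ π ∈ P.coeffSpan n,
    envelopingComul (P.sandwichLin n π U) =
      (P.sandwichLin n π).rTensor P.UPlus (envelopingComul U) +
        (P.sandwichLin n π).lTensor P.UPlus (envelopingComul U) := by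
  induction U using enveloping_induction with
  | one =>
    intro π hπ
    obtain ⟨x, hx, hxι⟩ := P.exists_zDLinear_eq hπ
    rw [map_one envelopingComul, Algebra.TensorProduct.one_def, LinearMap.rTensor_tmul, LinearMap.lTensor_tmul,
      sandwichLin_one, hxι, envelopingComul_ι]
  | add u v hu hv =>
    intro π hπ
    simp only [map_add, hu π hπ, hv π hπ]
    abel
  | smul c u hu =>
    intro π hπ
    simp only [map_smul, hu π hπ, smul_add]
  | ι_mul x u hu =>
    intro π hπ
    rw [sandwichLin_ι_mul, map_sub, map_mul, map_mul, envelopingComul_ι,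
      rTensor_primitive_mul _ _ _ (P.sandwichLin_ι_mul n π x),
      lTensor_primitive_mul _ _ _ (P.sandwichLin_ι_mul n π x), hu π hπ, hu _ (P.LPlus_map_mem_coeffSpan hscal hsol x n π hπ), mul_add]
    abel

theorem sandwich_comm (p p' : P.MPlus) (U : P.UPlus) :
    P.sandwich p (P.sandwich p' U) = P.sandwich p' (P.sandwich p U) := by
  have hp : MvPolynomial.monomial p.1.1 (1 : ℝ) ∈ P.coeffSpan p.1.2 :=
    monomial_mem_monSpan (S := {γ | (γ, p.1.2) ∈ P.MPlus}) p.2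
  have hp' : MvPolynomial.monomial p'.1.1 (1 : ℝ) ∈ P.coeffSpan p'.1.2 :=
    monomial_mem_monSpan (S := {γ | (γ, p'.1.2) ∈ P.MPlus}) p'.2
  rw [sandwich_eq, sandwich_eq, sandwich_eq, sandwich_eq]
  exact P.sandwichLin_comm hscal hsol U _ hp' _ hp

-- This moves a generator past ∂ᵢ when the family is shown to span. The index 𝐧 - eᵢ is admissible
-- because its scaled degree is no larger than that of 𝐧.
omit hsol in
theorem zDLinear_mul_uGen_inr (i : Fin d) {n : NVec d} {π : CoordPoly d 𝔏}
    (hπ : π ∈ P.coeffSpan n) (hi : P.dX i π ∈ P.coeffSpan n) :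
    P.zDLinear n π * P.uGen (Sum.inr i) = P.uGen (Sum.inr i) * P.zDLinear n π -
      P.zDLinear n (P.dX i π) + (n i : ℝ) • P.zDLinear (n - Finsupp.single i 1) π := by
  have hle := P.scaledDeg_tsub_le hscal n i
  obtain ⟨x, hx, hxι⟩ := P.exists_zDLinear_eq hπ
  obtain ⟨y, hy, hyι⟩ := P.exists_zDLinear_eq hi
  obtain ⟨w, hw, hwι⟩ := P.exists_zDLinear_eq (P.coeffSpan_anti hle hπ)
  have hxy : ⁅x, P.gen (Sum.inr i)⁆ = (n i : ℝ) • w - y := by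
    refine Subtype.ext (Derivation.ext fun q => ?_)
    rw [LieSubalgebra.coe_bracket, AddSubgroupClass.coe_sub, Derivation.commutator_apply,
      Derivation.sub_apply, SetLike.val_smul, Derivation.smul_apply, hy, hw, hx]
    change π * P.dN n (P.dX i q) - P.dX i (π * P.dN n q) =
      (n i : ℝ) • (π * P.dN (n - Finsupp.single i 1) q) - P.dX i π * P.dN n q
    rw [P.dN_dX hscal, Derivation.leibniz, smul_eq_mul, smul_eq_mul, mul_add, mul_smul_comm]
    ring
  have h := congrArg ιU hxy
  rw [LieHom.map_lie, LieRing.of_associative_ring_bracket, map_sub, map_smul, ← hxι, ← hyι,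
    ← hwι] at h
  change P.zDLinear n π * P.uGen (Sum.inr i) - P.uGen (Sum.inr i) * P.zDLinear n π = _ at h
  rw [sub_eq_iff_eq_add] at h
  rw [h]
  abel

omit hsol in
theorem uGen_inr_commute (i j : Fin d) :
    Commute (P.uGen (Sum.inr i)) (P.uGen (Sum.inr j)) := by
  have hxy : ⁅P.gen (Sum.inr i), P.gen (Sum.inr j)⁆ = 0 :=
    Subtype.ext (P.dX_comm hscal i j)
  have h := congrArg ιU hxy
  rw [LieHom.map_lie, LieRing.of_associative_ring_bracket, map_zero, sub_eq_zero] at h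
  exact h

end Sandwich

end Rho

end RegParams

/-! ### Products of powers and the coproduct of divided powers. -/

theorem List.prod_ofFn_pow_add_single {M : Type*} [Monoid M] {d : ℕ} (x : Fin d → M)
    (hx : ∀ i j, Commute (x i) (x j)) (k k' : Fin d → ℕ) (i : Fin d) (hi : k' i = k i + 1)
    (hne : ∀ j, j ≠ i → k' j = k j) :
    (List.ofFn fun j => x j ^ k' j).prod = x i * (List.ofFn fun j => x j ^ k j).prod := by
  induction d with
  | zero => exact i.elim0
  | succ d ih =>
    rw [List.ofFn_succ, List.ofFn_succ, List.prod_cons, List.prod_cons]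
    induction i using Fin.cases with
    | zero =>
      rw [hi, pow_succ', mul_assoc]
      congr 4
      funext j
      rw [hne _ (Fin.succ_ne_zero j)]
    | succ i =>
      rw [ih (fun j => x j.succ) (fun a b => hx _ _) (fun j => k j.succ) (fun j => k' j.succ) i hi
        (fun j hj => hne _ (fun h => hj (Fin.succ_injective _ h))),
        hne 0 (Fin.succ_ne_zero i).symm, ← mul_assoc, ((hx 0 i.succ).pow_left _).eq, mul_assoc]

theorem Finsupp.sum_antidiagonal_add_single {σ V : Type*} [DecidableEq σ] [AddCommGroup V] [Module ℝ V]
    (K : σ →₀ ℕ) (g : σ) (F : (σ →₀ ℕ) → (σ →₀ ℕ) → V) :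
    ∑ q ∈ Finset.HasAntidiagonal.antidiagonal (K + Finsupp.single g 1), ((q.1 : σ →₀ ℕ) g : ℝ) • F q.1 q.2 =
      ∑ q ∈ Finset.HasAntidiagonal.antidiagonal K, ((q.1 g : ℝ) + 1) • F (q.1 + Finsupp.single g 1) q.2 := by
  let e : (σ →₀ ℕ) × (σ →₀ ℕ) ↪ (σ →₀ ℕ) × (σ →₀ ℕ) :=
    ⟨fun q => (q.1 + Finsupp.single g 1, q.2), fun a b h => by
      simp only [Prod.mk.injEq, add_left_inj] at h
      exact Prod.ext h.1 h.2⟩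
  have h1 : ∑ q ∈ (Finset.HasAntidiagonal.antidiagonal K).map e, (q.1 g : ℝ) • F q.1 q.2 =
      ∑ q ∈ Finset.HasAntidiagonal.antidiagonal K, ((q.1 g : ℝ) + 1) • F (q.1 + Finsupp.single g 1) q.2 := by
    rw [Finset.sum_map]
    refine Finset.sum_congr rfl fun q _ => ?_
    change ((q.1 + Finsupp.single g 1 : σ →₀ ℕ) g : ℝ) • F (q.1 + Finsupp.single g 1) q.2 = _
    rw [Finsupp.add_apply, Finsupp.single_eq_same, Nat.cast_succ]
  rw [← h1]
  -- Pairs whose first entry does not contain g carry the factor 0; all others come from a unique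
  -- pair summing to K.
  refine (Finset.sum_subset ?_ ?_).symm
  · intro q hq
    obtain ⟨p, hp, rfl⟩ := Finset.mem_map.mp hq
    rw [Finset.HasAntidiagonal.mem_antidiagonal] at hp ⊢
    rw [← hp]
    exact add_right_comm _ _ _
  · rintro ⟨A, B⟩ hq hn
    rw [Finset.HasAntidiagonal.mem_antidiagonal] at hq
    by_cases h0 : A g = 0
    · simp [h0]
    · exfalso
      refine hn (Finset.mem_map.mpr ⟨(A - Finsupp.single g 1, B), ?_, ?_⟩)
      all_goals
        have hle : Finsupp.single g 1 ≤ A :=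
          Finsupp.single_le_iff.mpr (Nat.one_le_iff_ne_zero.mpr h0)
      · rw [Finset.HasAntidiagonal.mem_antidiagonal]
        refine add_right_cancel (b := Finsupp.single g 1) ?_
        rw [← hq, add_right_comm, tsub_add_cancel_of_le hle]
      · exact Prod.ext (tsub_add_cancel_of_le hle) rfl

theorem Finsupp.sum_antidiagonal_comm {σ V : Type*} [DecidableEq σ] [AddCommMonoid V] (K : σ →₀ ℕ)
    (F : (σ →₀ ℕ) × (σ →₀ ℕ) → V) :
    ∑ q ∈ Finset.HasAntidiagonal.antidiagonal K, F q =
      ∑ q ∈ Finset.HasAntidiagonal.antidiagonal K, F (q.2, q.1) := by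
  refine Finset.sum_equiv (Equiv.prodComm _ _) (fun q => ?_) fun q _ => rfl
  rw [Finset.HasAntidiagonal.mem_antidiagonal, Finset.HasAntidiagonal.mem_antidiagonal, add_comm]
  rfl

theorem LinearMap.rTensor_mulLeft_apply {A : Type*} [Ring A] [Algebra ℝ A] (a : A)
    (t : A ⊗[ℝ] A) : (LinearMap.mulLeft ℝ a).rTensor A t = (a ⊗ₜ[ℝ] (1 : A)) * t := by
  induction t with
  | zero => simp
  | add x y hx hy => rw [mul_add, map_add, hx, hy]
  | tmul x y => simp

theorem LinearMap.lTensor_mulLeft_apply {A : Type*} [Ring A] [Algebra ℝ A] (a : A)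
    (t : A ⊗[ℝ] A) : (LinearMap.mulLeft ℝ a).lTensor A t = ((1 : A) ⊗ₜ[ℝ] a) * t := by
  induction t with
  | zero => simp
  | add x y hx hy => rw [mul_add, map_add, hx, hy]
  | tmul x y => simp

/-- If `T` is a coderivation with `T b_A = (A(g)+1) b_{A+e_g}`, the formula for the coproduct of
divided powers passes from `b_K` to `b_{K+e_g}`. -/
theorem comul_dividedPower_step {σ A : Type*} [DecidableEq σ] [Ring A] [Algebra ℝ A] (Δ : A →ₗ[ℝ] A ⊗[ℝ] A)
    (b : (σ →₀ ℕ) → A) (T : A →ₗ[ℝ] A) (g : σ) (K : σ →₀ ℕ)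
    (hT : Δ (T (b K)) = T.rTensor A (Δ (b K)) + T.lTensor A (Δ (b K)))
    (hb : ∀ k ≤ K, ((k g : ℝ) + 1) • b (k + Finsupp.single g 1) = T (b k))
    (hK : Δ (b K) = ∑ q ∈ Finset.HasAntidiagonal.antidiagonal K, b q.1 ⊗ₜ[ℝ] b q.2) :
    Δ (b (K + Finsupp.single g 1)) =
      ∑ q ∈ Finset.HasAntidiagonal.antidiagonal (K + Finsupp.single g 1), b q.1 ⊗ₜ[ℝ] b q.2 := by
  have hne : (K g : ℝ) + 1 ≠ 0 := by positivity
  have hinj : Function.Injective (fun t : A ⊗[ℝ] A => ((K g : ℝ) + 1) • t) :=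
    smul_right_injective _ hne
  refine hinj ?_
  simp only
  rw [← map_smul, hb K le_rfl, hT, hK, map_sum, map_sum, Finset.smul_sum]
  -- K(g) + 1 is split as q₁(g) + q₂(g). The first share matches `T` acting on the left leg, the
  -- second `T` acting on the right leg.
  have h1 : ∀ q ∈ Finset.HasAntidiagonal.antidiagonal (K + Finsupp.single g 1),
      ((K g : ℝ) + 1) • (b q.1 ⊗ₜ[ℝ] b q.2) =
        (q.1 g : ℝ) • (b q.1 ⊗ₜ[ℝ] b q.2) + (q.2 g : ℝ) • (b q.1 ⊗ₜ[ℝ] b q.2) := by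
    intro q hq
    have h := DFunLike.congr_fun (Finset.HasAntidiagonal.mem_antidiagonal.mp hq) g
    rw [Finsupp.add_apply, Finsupp.add_apply, Finsupp.single_eq_same] at h
    rw [← add_smul]
    congr 1
    exact_mod_cast h.symm
  rw [Finset.sum_congr rfl h1, Finset.sum_add_distrib]
  refine congrArg₂ (· + ·) ?_ ?_
  · rw [Finsupp.sum_antidiagonal_add_single K g (fun a c => b a ⊗ₜ[ℝ] b c)]
    refine Finset.sum_congr rfl fun q hq => ?_
    have hle : q.1 ≤ K := le_iff_exists_add.mpr ⟨q.2, (Finset.HasAntidiagonal.mem_antidiagonal.mp hq).symm⟩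
    rw [LinearMap.rTensor_tmul, ← hb _ hle, TensorProduct.smul_tmul']
  · have hs := Finsupp.sum_antidiagonal_add_single K g (fun a c => b c ⊗ₜ[ℝ] b a)
    rw [Finsupp.sum_antidiagonal_comm K, Finsupp.sum_antidiagonal_comm (K + Finsupp.single g 1)]
    refine Eq.trans ?_ hs.symm
    refine Finset.sum_congr rfl fun q hq => ?_
    have hle : q.1 ≤ K := le_iff_exists_add.mpr ⟨q.2, (Finset.HasAntidiagonal.mem_antidiagonal.mp hq).symm⟩
    rw [LinearMap.lTensor_tmul, ← hb _ hle, TensorProduct.tmul_smul]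

namespace RegParams

variable {d : ℕ} {𝔏 : Type*} (P : RegParams d 𝔏)

/-! ### The family `𝖣_{(J,𝐦)}` -/

/-- The elements `𝖣_{(J,𝐦)}` of `U(L⁺)`. -/
noncomputable def dividedD (K : P.PlusIdx) : P.UPlus := P.sfD K (P.jPart K).toList

variable {P} in
-- The order mirrors the construction of 𝖣_K: first ∂^𝐦 is built while J = 0, and then the maps z^γ
-- ⋯ D^{(𝐧)} are applied around it.
theorem plusIdx_induction {motive : P.PlusIdx → Prop} (zero : motive 0)
    (inr : ∀ K i, (∀ p, K (Sum.inl p) = 0) → motive K →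
      motive (K + Finsupp.single (Sum.inr i) 1))
    (inl : ∀ K p, motive K → motive (K + Finsupp.single (Sum.inl p) 1)) (K : P.PlusIdx) :
    motive K := by
  have hsub : ∀ (K : P.PlusIdx) g, K g ≠ 0 → ∃ K', K = K' + Finsupp.single g 1 := by
    intro K g hg
    exact ⟨K - Finsupp.single g 1, (tsub_add_cancel_of_le
      (Finsupp.single_le_iff.mpr (Nat.one_le_iff_ne_zero.mpr hg))).symm⟩
  induction hN : K.degree using Nat.strong_induction_on generalizing K with
  | _ N ih =>
    by_cases h : ∃ p, K (Sum.inl p) ≠ 0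
    · obtain ⟨p, hp⟩ := h
      obtain ⟨K', rfl⟩ := hsub K _ hp
      rw [map_add, Finsupp.degree_single] at hN
      exact inl K' p (ih _ (by omega) K' rfl)
    · push Not at h
      by_cases h' : ∃ i, K (Sum.inr i) ≠ 0
      · obtain ⟨i, hi⟩ := h'
        obtain ⟨K', rfl⟩ := hsub K _ hi
        rw [map_add, Finsupp.degree_single] at hN
        exact inr K' i (fun p => by simpa using h p) (ih _ (by omega) K' rfl)
      · push Not at h'
        have : K = 0 := Finsupp.ext fun g => by
          rcases g with p | i
          · exact h p
          · exact h' i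
        rw [this]
        exact zero

theorem jPart_add_inl (K : P.PlusIdx) (p : P.MPlus) :
    P.jPart (K + Finsupp.single (Sum.inl p) 1) = p ::ₘ P.jPart K := by
  rw [jPart, Finsupp.comapDomain_add_of_injective Sum.inl_injective, map_add,
    Finsupp.comapDomain_single, Finsupp.toMultiset_single, one_smul, add_comm,
    Multiset.singleton_add]
  rfl

theorem jPart_eq_zero {K : P.PlusIdx} (hK : ∀ p, K (Sum.inl p) = 0) : P.jPart K = 0 := by
  have : K.comapDomain Sum.inl Sum.inl_injective.injOn = 0 := Finsupp.ext hK
  rw [jPart, this, map_zero]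

theorem prod_factorial_add_single {σ : Type*} (K : σ →₀ ℕ) (g : σ) :
    ((K + Finsupp.single g 1).prod fun _ j => (j.factorial : ℝ)) =
      ((K g : ℝ) + 1) * K.prod fun _ j => (j.factorial : ℝ) := by
  classical
  rw [← Finsupp.mul_prod_erase' (K + Finsupp.single g 1) g _ (fun _ => by simp),
    ← Finsupp.mul_prod_erase' K g _ (fun _ => by simp), Finsupp.erase_add,
    Finsupp.erase_single, add_zero, Finsupp.add_apply, Finsupp.single_eq_same,
    Nat.factorial_succ, Nat.cast_mul, mul_assoc, Nat.cast_succ]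

theorem dividedD_zero : P.dividedD 0 = 1 := by
  have h1 : P.jPart 0 = 0 := P.jPart_eq_zero fun _ => rfl
  rw [dividedD, h1, Multiset.toList_zero, sfD, List.foldr_nil, dXPow, Finsupp.prod_zero_index,
    inv_one, one_smul]
  simp

section Family

variable (hscal : ∀ i, 1 ≤ P.scal i) (hsol : ∀ i, P.regSol ≤ P.scal i)
include hscal hsol

theorem foldr_sandwich_perm {l l' : List P.MPlus} (h : l.Perm l') (U : P.UPlus) :
    l.foldr P.sandwich U = l'.foldr P.sandwich U :=
  haveI : LeftCommutative P.sandwich := ⟨P.sandwich_comm hscal hsol⟩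
  h.foldr_eq U

theorem dividedD_eq_sfD {K : P.PlusIdx} {l : List P.MPlus}
    (h : (l : Multiset P.MPlus) = P.jPart K) : P.dividedD K = P.sfD K l := by
  rw [dividedD, sfD, sfD, P.foldr_sandwich_perm hscal hsol (l' := l)]
  rw [← Multiset.coe_eq_coe, Multiset.coe_toList, h]

/-- Order independence allows `p` to be applied last, and the ratio of the factorials supplies the
factor. -/
theorem dividedD_add_inl (K : P.PlusIdx) (p : P.MPlus) :
    ((K (Sum.inl p) : ℝ) + 1) • P.dividedD (K + Finsupp.single (Sum.inl p) 1) =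
      P.sandwichLin p.1.2 (MvPolynomial.monomial p.1.1 1) (P.dividedD K) := by
  have hne : (K (Sum.inl p) : ℝ) + 1 ≠ 0 := by positivity
  have hX : P.dXPow (K + Finsupp.single (Sum.inl p) 1) = P.dXPow K := by
    simp [dXPow]
  rw [P.dividedD_eq_sfD hscal hsol (l := p :: (P.jPart K).toList)
    (by rw [jPart_add_inl, ← Multiset.cons_coe, Multiset.coe_toList]), dividedD, sfD, sfD,
    List.foldr_cons, prod_factorial_add_single, hX, smul_smul, map_smul, mul_inv,
    mul_inv_cancel_left₀ hne]
  rfl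

-- The condition J = 0 is essential: the ∂ᵢ stand innermost in 𝖣_K, and moving one there through a
-- map z^γ ⋯ D^{(𝐧)} would produce corrections.
omit hsol in
theorem dividedD_add_inr {K : P.PlusIdx} (hK : ∀ p, K (Sum.inl p) = 0) (i : Fin d) :
    ((K (Sum.inr i) : ℝ) + 1) • P.dividedD (K + Finsupp.single (Sum.inr i) 1) =
      P.uGen (Sum.inr i) * P.dividedD K := by
  have hne : (K (Sum.inr i) : ℝ) + 1 ≠ 0 := by positivity
  have hX : P.dXPow (K + Finsupp.single (Sum.inr i) 1) = P.uGen (Sum.inr i) * P.dXPow K := by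
    refine List.prod_ofFn_pow_add_single (fun j => P.uGen (Sum.inr j))
      (P.uGen_inr_commute hscal) (fun j => K (Sum.inr j)) _ i (by simp) fun j hj => ?_
    rw [Finsupp.add_apply, Finsupp.single_eq_of_ne (by simpa using hj), add_zero]
  rw [dividedD, dividedD, sfD, sfD, P.jPart_eq_zero hK, P.jPart_eq_zero (by simpa using hK),
    Multiset.toList_zero, List.foldr_nil, List.foldr_nil, prod_factorial_add_single, hX,
    smul_smul, mul_inv, mul_inv_cancel_left₀ hne, mul_smul_comm]

omit hsol in
theorem exists_dividedD_add_inr {K : P.PlusIdx} (hK : ∀ p, K (Sum.inl p) = 0) (i : Fin d) :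
    ∃ c : ℝ, P.dividedD (K + Finsupp.single (Sum.inr i) 1) =
      c • (P.uGen (Sum.inr i) * P.dividedD K) := by
  have hne : (K (Sum.inr i) : ℝ) + 1 ≠ 0 := by positivity
  exact ⟨_, by rw [← P.dividedD_add_inr hscal hK, smul_smul, inv_mul_cancel₀ hne, one_smul]⟩

theorem exists_dividedD_add_inl (K : P.PlusIdx) (p : P.MPlus) :
    ∃ c : ℝ, P.dividedD (K + Finsupp.single (Sum.inl p) 1) =
      c • P.sandwichLin p.1.2 (MvPolynomial.monomial p.1.1 1) (P.dividedD K) := by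
  have hne : (K (Sum.inl p) : ℝ) + 1 ≠ 0 := by positivity
  exact ⟨_, by rw [← P.dividedD_add_inl hscal hsol, smul_smul, inv_mul_cancel₀ hne, one_smul]⟩

omit hscal hsol in
theorem monomial_mem_coeffSpan (p : P.MPlus) :
    MvPolynomial.monomial p.1.1 (1 : ℝ) ∈ P.coeffSpan p.1.2 :=
  monomial_mem_monSpan (S := {γ | (γ, p.1.2) ∈ P.MPlus}) p.2

/-! ### The coproduct of `𝖣_{(J,𝐦)}` -/

theorem comul_dividedD [DecidableEq P.PlusGen] (K : P.PlusIdx) :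
    envelopingComul (P.dividedD K) =
      ∑ q ∈ Finset.HasAntidiagonal.antidiagonal K, P.dividedD q.1 ⊗ₜ[ℝ] P.dividedD q.2 := by
  induction K using plusIdx_induction with
  | zero =>
    rw [dividedD_zero, map_one envelopingComul, Finsupp.antidiagonal_zero, Finset.sum_singleton,
      dividedD_zero, Algebra.TensorProduct.one_def]
  | inr K i hK ih =>
    refine comul_dividedPower_step envelopingComul.toLinearMap P.dividedD
      (LinearMap.mulLeft ℝ (P.uGen (Sum.inr i))) _ K ?_ ?_ ih
    · rw [LinearMap.mulLeft_apply, AlgHom.toLinearMap_apply, AlgHom.toLinearMap_apply, map_mul,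
        uGen, envelopingComul_ι, add_mul, LinearMap.rTensor_mulLeft_apply,
        LinearMap.lTensor_mulLeft_apply]
    -- Every k ≤ K again has J = 0, which is why the step lemma asks for the rule only below K.
    · intro k hk
      exact P.dividedD_add_inr hscal (fun p => Nat.le_zero.mp ((hk _).trans (hK p).le)) i
  | inl K p ih =>
    exact comul_dividedPower_step envelopingComul.toLinearMap P.dividedD
      (P.sandwichLin p.1.2 (MvPolynomial.monomial p.1.1 1)) _ K
      (P.comul_sandwichLin hscal hsol _ _ (P.monomial_mem_coeffSpan p))
      (fun k _ => P.dividedD_add_inl hscal hsol k p) ih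

end Family

end RegParams

namespace RegParams

variable {d : ℕ} {𝔏 : Type*} (P : RegParams d 𝔏)

section Basis

variable (hscal : ∀ i, 1 ≤ P.scal i) (hsol : ∀ i, P.regSol ≤ P.scal i)
include hscal hsol

/-! ### The family spans `U(L⁺)` -/

theorem sandwichLin_mem_span {n : NVec d} {u : P.UPlus}
    (hu : u ∈ Submodule.span ℝ (Set.range P.dividedD)) :
    ∀ π ∈ P.coeffSpan n, P.sandwichLin n π u ∈ Submodule.span ℝ (Set.range P.dividedD) := by
  intro π hπ
  induction hu using Submodule.span_induction with
  | mem u hu =>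
    obtain ⟨K, rfl⟩ := hu
    induction hπ using Submodule.span_induction with
    | mem q hq =>
      obtain ⟨γ, hγ, rfl⟩ := hq
      rw [← P.dividedD_add_inl hscal hsol K ⟨(γ, n), hγ⟩]
      exact Submodule.smul_mem _ _ (Submodule.subset_span (Set.mem_range_self _))
    | zero =>
      have : P.sandwichLin n 0 (P.dividedD K) = 0 := map_zero (P.homAction _ (P.zDLinear n))
      rw [this]
      exact Submodule.zero_mem _
    | add p q _ _ hp hq =>
      have : P.sandwichLin n (p + q) (P.dividedD K) = P.sandwichLin n p (P.dividedD K) +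
        P.sandwichLin n q (P.dividedD K) := map_add (P.homAction _ (P.zDLinear n)) p q
      rw [this]
      exact Submodule.add_mem _ hp hq
    | smul c p _ hp =>
      have : P.sandwichLin n (c • p) (P.dividedD K) = c • P.sandwichLin n p (P.dividedD K) :=
        map_smul (P.homAction _ (P.zDLinear n)) c p
      rw [this]
      exact Submodule.smul_mem _ _ hp
  | zero => rw [map_zero]; exact Submodule.zero_mem _
  | add u v _ _ hu hv => rw [map_add]; exact Submodule.add_mem _ hu hv
  | smul c u _ hu => rw [map_smul]; exact Submodule.smul_mem _ _ hu

/-- The recursion is read backwards: ∂ᵢ(z^γ U D^{(𝐧)}) = z^γ(∂ᵢU)D^{(𝐧)} + (∂ᵢz^γ)UD^{(𝐧)}, where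
both terms on the right are under control. -/
theorem uGen_inr_mul_dividedD_mem_span (i : Fin d) (K : P.PlusIdx) :
    P.uGen (Sum.inr i) * P.dividedD K ∈ Submodule.span ℝ (Set.range P.dividedD) := by
  have hpure : ∀ K : P.PlusIdx, (∀ p, K (Sum.inl p) = 0) →
      P.uGen (Sum.inr i) * P.dividedD K ∈ Submodule.span ℝ (Set.range P.dividedD) := by
    intro K hK
    rw [← P.dividedD_add_inr hscal hK]
    exact Submodule.smul_mem _ _ (Submodule.subset_span (Set.mem_range_self _))
  induction K using plusIdx_induction with
  | zero => exact hpure 0 fun _ => rfl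
  | inr K j hK _ => exact hpure _ (by simpa using hK)
  | inl K p ih =>
    obtain ⟨c, hc⟩ := P.exists_dividedD_add_inl hscal hsol K p
    have hπ := P.monomial_mem_coeffSpan p
    have h := P.sandwichLin_ι_mul p.1.2 (MvPolynomial.monomial p.1.1 1) (P.gen (Sum.inr i))
      (P.dividedD K)
    rw [eq_sub_iff_add_eq] at h
    change _ = P.uGen (Sum.inr i) * _ at h
    rw [hc, mul_smul_comm, ← h]
    refine Submodule.smul_mem _ _ (Submodule.add_mem _ ?_ ?_)
    · exact P.sandwichLin_mem_span hscal hsol ih _ hπ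
    · exact P.sandwichLin_mem_span hscal hsol (Submodule.subset_span (Set.mem_range_self K)) _
        (P.LPlus_map_mem_coeffSpan hscal hsol _ _ _ hπ)

theorem uGen_inr_mul_mem_span (i : Fin d) {u : P.UPlus}
    (hu : u ∈ Submodule.span ℝ (Set.range P.dividedD)) :
    P.uGen (Sum.inr i) * u ∈ Submodule.span ℝ (Set.range P.dividedD) := by
  induction hu using Submodule.span_induction with
  | mem u hu =>
    obtain ⟨K, rfl⟩ := hu
    exact P.uGen_inr_mul_dividedD_mem_span hscal hsol i K
  | zero => rw [mul_zero]; exact Submodule.zero_mem _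
  | add u v _ _ hu hv => rw [mul_add]; exact Submodule.add_mem _ hu hv
  | smul c u _ hu => rw [mul_smul_comm]; exact Submodule.smul_mem _ _ hu

/-- The induction runs over all 𝐧 and π simultaneously because passing ∂ᵢ replaces π by ∂ᵢπ and 𝐧 by
𝐧 - eᵢ. -/
theorem zDLinear_mul_dividedD_mem_span (K : P.PlusIdx) : ∀ (n : NVec d), ∀ π ∈ P.coeffSpan n,
    P.zDLinear n π * P.dividedD K ∈ Submodule.span ℝ (Set.range P.dividedD) := by
  induction K using plusIdx_induction with
  | zero =>
    intro n π hπ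
    rw [dividedD_zero, mul_one, ← sandwichLin_one, ← dividedD_zero]
    exact P.sandwichLin_mem_span hscal hsol (Submodule.subset_span (Set.mem_range_self _)) _ hπ
  | inr K i hK ih =>
    intro n π hπ
    obtain ⟨c, hc⟩ := P.exists_dividedD_add_inr hscal hK i
    have hi : P.dX i π ∈ P.coeffSpan n :=
      P.LPlus_map_mem_coeffSpan hscal hsol (P.gen (Sum.inr i)) n π hπ
    have hle := P.scaledDeg_tsub_le hscal n i
    rw [hc, mul_smul_comm, ← mul_assoc, P.zDLinear_mul_uGen_inr hscal i hπ hi, add_mul, sub_mul,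
      mul_assoc, smul_mul_assoc]
    refine Submodule.smul_mem _ _ (Submodule.add_mem _ (Submodule.sub_mem _ ?_ ?_) ?_)
    · exact P.uGen_inr_mul_mem_span hscal hsol i (ih n π hπ)
    · exact ih n _ hi
    · exact Submodule.smul_mem _ _ (ih _ π (P.coeffSpan_anti hle hπ))
  | inl K p ih =>
    intro n π hπ
    obtain ⟨c, hc⟩ := P.exists_dividedD_add_inl hscal hsol K p
    obtain ⟨x, hx, hxι⟩ := P.exists_zDLinear_eq hπ
    have hγ := P.monomial_mem_coeffSpan p
    have h := P.sandwichLin_ι_mul p.1.2 (MvPolynomial.monomial p.1.1 1) x (P.dividedD K)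
    rw [eq_sub_iff_add_eq] at h
    rw [hc, mul_smul_comm, hxι, ← h, ← hxι]
    refine Submodule.smul_mem _ _ (Submodule.add_mem _ ?_ ?_)
    · exact P.sandwichLin_mem_span hscal hsol (ih n π hπ) _ hγ
    · exact P.sandwichLin_mem_span hscal hsol (Submodule.subset_span (Set.mem_range_self K)) _
        (P.LPlus_map_mem_coeffSpan hscal hsol _ _ _ hγ)

theorem ι_mul_mem_span (x : P.LPlus) : ∀ u ∈ Submodule.span ℝ (Set.range P.dividedD),
    UniversalEnvelopingAlgebra.ι ℝ x * u ∈ Submodule.span ℝ (Set.range P.dividedD) := by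
  let B := Submodule.span ℝ (Set.range P.dividedD)
  obtain ⟨x, hx⟩ := x
  refine LieSubalgebra.lieSpan_induction ℝ (p := fun x hx => ∀ u ∈ B,
    UniversalEnvelopingAlgebra.ι ℝ (⟨x, hx⟩ : P.LPlus) * u ∈ B) ?_ ?_ ?_ ?_ ?_ hx
  · rintro _ ⟨g, rfl⟩ u hu
    change P.uGen g * u ∈ B
    rcases g with p | i
    · rw [← sandwich_one, sandwich_eq, sandwichLin_one]
      induction hu using Submodule.span_induction with
      | mem u hu =>
        obtain ⟨K, rfl⟩ := hu
        exact P.zDLinear_mul_dividedD_mem_span hscal hsol K _ _ (P.monomial_mem_coeffSpan p)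
      | zero => rw [mul_zero]; exact Submodule.zero_mem _
      | add u v _ _ hu hv => rw [mul_add]; exact Submodule.add_mem _ hu hv
      | smul c u _ hu => rw [mul_smul_comm]; exact Submodule.smul_mem _ _ hu
    · exact P.uGen_inr_mul_mem_span hscal hsol i hu
  · intro u _
    have : (⟨0, P.LPlus.zero_mem⟩ : P.LPlus) = 0 := rfl
    rw [this, map_zero, zero_mul]
    exact B.zero_mem
  · intro x y hx hy hx' hy' u hu
    have : (⟨x + y, P.LPlus.add_mem hx hy⟩ : P.LPlus) = ⟨x, hx⟩ + ⟨y, hy⟩ := rfl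
    rw [this, map_add, add_mul]
    exact B.add_mem (hx' u hu) (hy' u hu)
  · intro c x hx hx' u hu
    have : (⟨c • x, P.LPlus.smul_mem c hx⟩ : P.LPlus) = c • ⟨x, hx⟩ := rfl
    rw [this, map_smul, smul_mul_assoc]
    exact B.smul_mem _ (hx' u hu)
  · intro x y hx hy hx' hy' u hu
    have : (⟨⁅x, y⁆, P.LPlus.lie_mem hx hy⟩ : P.LPlus) = ⁅(⟨x, hx⟩ : P.LPlus), ⟨y, hy⟩⁆ := rfl
    rw [this, enveloping_ι_lie, sub_mul, mul_assoc, mul_assoc]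
    exact B.sub_mem (hx' _ (hy' u hu)) (hy' _ (hx' u hu))

theorem span_dividedD : ⊤ ≤ Submodule.span ℝ (Set.range P.dividedD) := fun u _ =>
  enveloping_left_induction (Submodule.span ℝ (Set.range P.dividedD))
    (Submodule.subset_span ⟨0, P.dividedD_zero⟩)
    (P.ι_mul_mem_span hscal hsol) u

/-! ### Dual functionals -/

-- When J ≠ 0 the counit is read off from ρ(𝖣_K)1, which vanishes since the operator D^{(𝐧)} applied
-- first kills 1.
open Classical in
theorem counit_dividedD (K : P.PlusIdx) :
    envelopingCounit (P.dividedD K) = if K = 0 then 1 else 0 := by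
  classical
  induction K using plusIdx_induction with
  | zero => rw [dividedD_zero, map_one, if_pos rfl]
  | inr K i hK _ =>
    obtain ⟨c, hc⟩ := P.exists_dividedD_add_inr hscal hK i
    rw [hc, map_smul, map_mul, uGen, envelopingCounit_ι, zero_mul, smul_zero, if_neg (by simp)]
  | inl K p _ =>
    obtain ⟨c, hc⟩ := P.exists_dividedD_add_inl hscal hsol K p
    have h : P.rho (P.dividedD (K + Finsupp.single (Sum.inl p) 1)) 1 = 0 := by
      rw [hc, map_smul, LinearMap.smul_apply,
        P.rho_sandwichLin hscal hsol _ _ (P.monomial_mem_coeffSpan p), Derivation.map_one_eq_zero,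
        map_zero, mul_zero, smul_zero]
    rw [rho_apply_one, MvPolynomial.C_eq_zero] at h
    rw [h, if_neg (by simp)]

/-- The part `𝐦` of `(J,𝐦)`. -/
noncomputable def polyPart (K : P.PlusIdx) : NVec d :=
  K.comapDomain Sum.inr Sum.inr_injective.injOn

omit hsol in
theorem rho_dividedD_X_pure {K : P.PlusIdx} (hK : ∀ p, K (Sum.inl p) = 0) (n : NVec d) :
    ∃ c : ℝ, P.rho (P.dividedD K) (MvPolynomial.X (Sum.inr n)) =
      c • MvPolynomial.X (Sum.inr (n + P.polyPart K)) := by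
  induction K using plusIdx_induction with
  | zero =>
    refine ⟨1, ?_⟩
    have : P.polyPart 0 = 0 := Finsupp.ext fun _ => rfl
    rw [dividedD_zero, map_one, this, add_zero, one_smul]
    rfl
  | inr K i hK' ih =>
    obtain ⟨c, hc⟩ := P.exists_dividedD_add_inr hscal hK' i
    obtain ⟨c', hc'⟩ := ih hK'
    have hm : P.polyPart (K + Finsupp.single (Sum.inr i) 1) =
        P.polyPart K + Finsupp.single i 1 := by
      rw [polyPart, Finsupp.comapDomain_add_of_injective Sum.inr_injective,
        Finsupp.comapDomain_single]
      rfl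
    refine ⟨c * (c' * (((n + P.polyPart K : NVec d) i : ℝ) + 1)), ?_⟩
    rw [hc, map_smul, LinearMap.smul_apply, uGen, rho_ι_mul_apply, hc']
    change c • P.dX i (c' • _) = _
    rw [Derivation.map_smul, P.dX_X_inr hscal, hm, smul_smul, smul_smul, add_assoc, mul_assoc]
  | inl K p _ => exact absurd (hK p) (by simp)

-- D^{(𝐧')} reduces z_𝐧 to 1 or 0, and what remains inside acts on 1 through the counit. Thus all K
-- containing (γ,𝐧'), except this single generator, kill z_𝐧.
open Classical in
theorem rho_dividedD_X_add_inl (K : P.PlusIdx) (p : P.MPlus) (n : NVec d) :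
    P.rho (P.dividedD (K + Finsupp.single (Sum.inl p) 1)) (MvPolynomial.X (Sum.inr n)) =
      if K = 0 ∧ n = p.1.2 then MvPolynomial.monomial p.1.1 1 else 0 := by
  have hne : (K (Sum.inl p) : ℝ) + 1 ≠ 0 := by positivity
  have h := congrArg (fun u => P.rho u (MvPolynomial.X (Sum.inr n)))
    (P.dividedD_add_inl hscal hsol K p)
  simp only [map_smul, LinearMap.smul_apply] at h
  rw [P.rho_sandwichLin hscal hsol _ _ (P.monomial_mem_coeffSpan p), dN_X_inr] at h
  rw [← inv_smul_smul₀ hne (P.rho (P.dividedD (K + Finsupp.single (Sum.inl p) 1)) _), h]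
  by_cases hn : n = p.1.2
  · rw [if_pos hn, rho_apply_one, P.counit_dividedD hscal hsol]
    by_cases hK : K = 0
    · rw [if_pos hK, if_pos ⟨hK, hn⟩, hK]
      simp
    · rw [if_neg hK, if_neg (fun h => hK h.1), map_zero, mul_zero, smul_zero]
  · rw [if_neg hn, if_neg (fun h => hn h.2), map_zero, mul_zero, smul_zero]

omit hscal hsol in
/-- The exponent read off by the functional `genCoeff`. -/
noncomputable def genTarget : P.PlusGen → CoordIdx d 𝔏 :=
  Sum.elim (fun p => p.1.1) fun i => Finsupp.single (Sum.inr (Finsupp.single i 1)) 1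

omit hscal hsol in
/-- The polynomial variable on which the functional `genCoeff` is evaluated. -/
noncomputable def genSource : P.PlusGen → NVec d := Sum.elim (fun p => p.1.2) fun _ => 0

omit hscal hsol in
/-- The functional on `U(L⁺)` reading off the coefficient of a generator. -/
noncomputable def genCoeff (g : P.PlusGen) : P.UPlus →ₗ[ℝ] ℝ where
  toFun u := MvPolynomial.coeff (P.genTarget g)
    (P.rho u (MvPolynomial.X (Sum.inr (P.genSource g))))
  map_add' u v := by rw [map_add, LinearMap.add_apply, MvPolynomial.coeff_add]
  map_smul' c u := by rw [map_smul, LinearMap.smul_apply, MvPolynomial.coeff_smul]; rfl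

omit hscal hsol in
theorem ne_single_inr_of_mem_MPlus (p : P.MPlus) (m : NVec d) :
    p.1.1 ≠ Finsupp.single (Sum.inr m) 1 := by
  intro h
  have h1 := p.2.1.2
  rw [h, noiseHom_inr] at h1
  exact lt_irrefl _ h1

-- Pure ∂^𝐦 sends z_𝐧 to a multiple of z_{𝐧+𝐦}, while K with J ≠ 0 sends it to z^γ or 0. As γ
-- carries noise, the two kinds of targets cannot coincide.
open Classical in
theorem genCoeff_dividedD (g : P.PlusGen) (K : P.PlusIdx) :
    P.genCoeff g (P.dividedD K) = if K = Finsupp.single g 1 then 1 else 0 := by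
  classical
  change MvPolynomial.coeff (P.genTarget g) (P.rho (P.dividedD K)
    (MvPolynomial.X (Sum.inr (P.genSource g)))) = _
  by_cases hK : ∀ p, K (Sum.inl p) = 0
  · obtain ⟨c, hc⟩ := P.rho_dividedD_X_pure hscal hK (P.genSource g)
    rcases g with p | i
    · rw [hc, MvPolynomial.coeff_smul, MvPolynomial.coeff_X, if_neg, smul_zero, if_neg]
      · rintro rfl
        simpa using hK p
      · exact (P.ne_single_inr_of_mem_MPlus p _).symm
    · by_cases hi : K = Finsupp.single (Sum.inr i) 1
      · have h1 : P.dividedD K = P.uGen (Sum.inr i) := by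
          have := P.dividedD_add_inr hscal (K := 0) (fun _ => rfl) i
          rw [dividedD_zero, mul_one] at this
          simpa [hi] using this
        rw [if_pos hi, h1, uGen, rho_ι_apply]
        change MvPolynomial.coeff _ (P.dX i _) = 1
        rw [P.dX_X_inr hscal, MvPolynomial.coeff_smul, MvPolynomial.coeff_X]
        simp [genTarget, genSource]
      · rw [if_neg hi, hc, MvPolynomial.coeff_smul, MvPolynomial.coeff_X, if_neg, smul_zero]
        intro h
        refine hi (Finsupp.ext fun g => ?_)
        simp only [genSource, genTarget, Sum.elim_inr, zero_add] at h
        have h2 := Sum.inr_injective (Finsupp.single_left_injective one_ne_zero h)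
        rcases g with p | j
        · rw [hK p, Finsupp.single_eq_of_ne (by simp)]
        · have h3 := DFunLike.congr_fun h2 j
          rw [polyPart, Finsupp.comapDomain_apply] at h3
          rw [h3]
          simp [Finsupp.single_apply]
  · push Not at hK
    obtain ⟨p, hp⟩ := hK
    obtain ⟨K', rfl⟩ : ∃ K', K = K' + Finsupp.single (Sum.inl p) 1 :=
      ⟨K - Finsupp.single (Sum.inl p) 1, (tsub_add_cancel_of_le
        (Finsupp.single_le_iff.mpr (Nat.one_le_iff_ne_zero.mpr hp))).symm⟩
    rw [P.rho_dividedD_X_add_inl hscal hsol]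
    rcases g with p' | i
    · by_cases h : K' + Finsupp.single (Sum.inl p) 1 = Finsupp.single (Sum.inl p') 1
      · have hpp : p = p' := by
          by_contra hne
          have := DFunLike.congr_fun h (Sum.inl p)
          rw [Finsupp.single_eq_of_ne (a := Sum.inl p') (by simpa using hne)] at this
          simp at this
        subst hpp
        rw [if_pos h, if_pos ⟨add_eq_right.mp h, rfl⟩, MvPolynomial.coeff_monomial]
        exact if_pos rfl
      · rw [if_neg h]
        split_ifs with h1
        · rw [MvPolynomial.coeff_monomial, if_neg]
          intro h2
          refine h ?_
          rw [h1.1, zero_add, Subtype.ext (Prod.ext h2 h1.2.symm)]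
        · exact MvPolynomial.coeff_zero _
    · rw [if_neg (c := K' + _ = _)]
      · split_ifs
        · rw [MvPolynomial.coeff_monomial, if_neg]
          exact P.ne_single_inr_of_mem_MPlus p _
        · exact MvPolynomial.coeff_zero _
      · intro h
        have := DFunLike.congr_fun h (Sum.inl p)
        simp at this

-- By the coproduct formula, the convolution product of functionals dual to 𝖣_{K₀} and 𝖣_{e_g} is
-- dual to 𝖣_{K₀+e_g}; the counit starts the induction.
open Classical in
theorem exists_dual_functional (K₀ : P.PlusIdx) :
    ∃ ψ : P.UPlus →ₗ[ℝ] ℝ, ∀ K, ψ (P.dividedD K) = if K = K₀ then 1 else 0 := by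
  classical
  have hstep : ∀ (K₀ : P.PlusIdx) (g : P.PlusGen),
      (∃ ψ : P.UPlus →ₗ[ℝ] ℝ, ∀ K, ψ (P.dividedD K) = if K = K₀ then 1 else 0) →
      ∃ ψ : P.UPlus →ₗ[ℝ] ℝ, ∀ K, ψ (P.dividedD K) =
        if K = K₀ + Finsupp.single g 1 then 1 else 0 := by
    rintro K₀ g ⟨ψ, hψ⟩
    refine ⟨LinearMap.mul' ℝ ℝ ∘ₗ TensorProduct.map ψ (P.genCoeff g) ∘ₗ
      envelopingComul.toLinearMap, fun K => ?_⟩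
    rw [LinearMap.comp_apply, LinearMap.comp_apply, AlgHom.toLinearMap_apply,
      P.comul_dividedD hscal hsol, map_sum, map_sum]
    have : ∀ q ∈ Finset.HasAntidiagonal.antidiagonal K, LinearMap.mul' ℝ ℝ
        (TensorProduct.map ψ (P.genCoeff g) (P.dividedD q.1 ⊗ₜ[ℝ] P.dividedD q.2)) =
        if q = (K₀, Finsupp.single g 1) then 1 else 0 := by
      rintro ⟨A, B⟩ -
      rw [TensorProduct.map_tmul, LinearMap.mul'_apply, hψ, P.genCoeff_dividedD hscal hsol]
      by_cases h1 : A = K₀ <;> by_cases h2 : B = Finsupp.single g 1 <;> simp [h1, h2]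
    rw [Finset.sum_congr rfl this, Finset.sum_ite_eq']
    simp only [Finset.HasAntidiagonal.mem_antidiagonal, eq_comm]
  induction K₀ using plusIdx_induction with
  | zero => exact ⟨envelopingCounit.toLinearMap, P.counit_dividedD hscal hsol⟩
  | inr K₀ i _ ih => exact hstep K₀ _ ih
  | inl K₀ p ih => exact hstep K₀ _ ih

theorem linearIndependent_dividedD : LinearIndependent ℝ P.dividedD := by
  classical
  rw [linearIndependent_iff]
  intro c hc
  ext K₀
  obtain ⟨ψ, hψ⟩ := P.exists_dual_functional hscal hsol K₀
  have h := congrArg ψ hc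
  rw [map_zero, Finsupp.linearCombination_apply, Finsupp.sum, map_sum] at h
  simp only [map_smul, hψ, smul_eq_mul, mul_ite, mul_one, mul_zero] at h
  rw [Finset.sum_ite_eq'] at h
  split_ifs at h with hs
  · exact h
  · exact Finsupp.notMem_support_iff.mp hs

/-- The basis `𝖣_{(J,𝐦)}` of `U(L⁺)`. -/
noncomputable def dBasis : Module.Basis P.PlusIdx ℝ P.UPlus :=
  Module.Basis.mk (P.linearIndependent_dividedD hscal hsol) (P.span_dividedD hscal hsol)

theorem dBasis_apply (K : P.PlusIdx) : P.dBasis hscal hsol K = P.dividedD K :=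
  Module.Basis.mk_apply _ _ K

end Basis

end RegParams

namespace RegParams

variable {d : ℕ} {𝔏 : Type*}

/-! ### Row-finite operators -/

/-- Every monomial occurs in the images of only finitely many monomials. -/
def RowFinite (T : CoordPoly d 𝔏 →ₗ[ℝ] CoordPoly d 𝔏) : Prop :=
  ∀ β, {γ | MvPolynomial.coeff β (T (MvPolynomial.monomial γ 1)) ≠ 0}.Finite

theorem RowFinite.comp {T S : CoordPoly d 𝔏 →ₗ[ℝ] CoordPoly d 𝔏} (hT : RowFinite T)
    (hS : RowFinite S) : RowFinite (T ∘ₗ S) := by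
  intro β
  refine ((hT β).biUnion fun γ' _ => hS γ').subset fun γ hγ => ?_
  obtain ⟨γ', h1, h2⟩ := exists_of_coeff_map_ne_zero T hγ
  exact Set.mem_biUnion h2 h1

theorem RowFinite.smul {T : CoordPoly d 𝔏 →ₗ[ℝ] CoordPoly d 𝔏} (hT : RowFinite T) (c : ℝ) :
    RowFinite (c • T) := fun β => (hT β).subset fun γ hγ h0 => hγ (by
  rw [LinearMap.smul_apply, MvPolynomial.coeff_smul, h0, smul_zero])

theorem rowFinite_mulLeft_monomial (γ₀ : CoordIdx d 𝔏) :
    RowFinite (LinearMap.mulLeft ℝ (MvPolynomial.monomial γ₀ (1 : ℝ))) := by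
  classical
  intro β
  refine (Set.finite_singleton (β - γ₀)).subset fun γ hγ => ?_
  rw [Set.mem_ofPred_eq, LinearMap.mulLeft_apply, MvPolynomial.monomial_mul,
    MvPolynomial.coeff_monomial] at hγ
  split_ifs at hγ with h
  · rw [Set.mem_singleton_iff, ← h, add_tsub_cancel_left]
  · exact absurd rfl hγ

variable (P : RegParams d 𝔏)

theorem ne_zero_of_add_single_eq {σ : Type*} {β γ : σ →₀ ℕ} {c c' : σ} (hc : c ≠ c')
    (h : β + Finsupp.single c 1 = γ + Finsupp.single c' 1) : β c' ≠ 0 := by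
  have := DFunLike.congr_fun h c'
  rw [Finsupp.add_apply, Finsupp.add_apply, Finsupp.single_eq_same,
    Finsupp.single_eq_of_ne (Ne.symm hc)] at this
  omega

/-- The preimage γ is determined by β and the variable that was created, which must be one of the
finitely many variables of β; if a z_𝐧 was removed, γ is determined outright. -/
theorem rowFinite_dN (n : NVec d) :
    RowFinite (P.dN n : CoordPoly d 𝔏 →ₗ[ℝ] CoordPoly d 𝔏) := by
  classical
  intro β
  let f : Coord d 𝔏 → CoordIdx d 𝔏 := Sum.elim
    (fun p => β + Finsupp.single (Sum.inl (p.1, p.2 - Finsupp.single n 1)) 1 -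
      Finsupp.single (Sum.inl p) 1) fun _ => 0
  refine ((β.support.finite_toSet.image f).union
    (Set.finite_singleton (β + Finsupp.single (Sum.inr n) 1))).subset fun γ hγ => ?_
  rcases P.coeff_dN_monomial hγ with ⟨l, k, -, -, he⟩ | ⟨-, he⟩
  · left
    refine ⟨Sum.inl (l, k + Finsupp.single n 1), ?_, ?_⟩
    · refine Finset.mem_coe.mpr (Finsupp.mem_support_iff.mpr (ne_zero_of_add_single_eq ?_ he))
      simp
    · simp only [f, Sum.elim_inl, add_tsub_cancel_right, he]
  · right
    exact he.symm

theorem rowFinite_dX (i : Fin d) :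
    RowFinite (P.dX i : CoordPoly d 𝔏 →ₗ[ℝ] CoordPoly d 𝔏) := by
  classical
  intro β
  let f : Coord d 𝔏 × Coord d 𝔏 → CoordIdx d 𝔏 := fun q => Sum.elim
    (fun p => Sum.elim (fun _ => 0) (fun m => β + Finsupp.single
      (Sum.inl (p.1, p.2 - Finsupp.single (m - Finsupp.single i 1) 1)) 1 -
      (Finsupp.single (Sum.inl p) 1 + Finsupp.single (Sum.inr m) 1)) q.2)
    (fun m => β + Finsupp.single (Sum.inr (m - Finsupp.single i 1)) 1 -
      Finsupp.single (Sum.inr m) 1) q.1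
  refine (((β.support ×ˢ β.support).finite_toSet).image f).subset fun γ hγ => ?_
  rcases P.coeff_dX_monomial hγ with ⟨n, l, k, -, -, he⟩ | ⟨n, -, he⟩
  · have h1 : β (Sum.inl (l, k + Finsupp.single n 1)) ≠ 0 := by
      refine ne_zero_of_add_single_eq (c := Sum.inl (l, k)) ?_ (he.trans ?_) (γ :=
        γ + Finsupp.single (Sum.inr (n + Finsupp.single i 1)) 1)
      · simp
      · rw [add_assoc, add_comm (Finsupp.single (Sum.inr _) 1)]
    have h2 : β (Sum.inr (n + Finsupp.single i 1)) ≠ 0 := by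
      refine ne_zero_of_add_single_eq (c := Sum.inl (l, k)) (by simp) (he.trans ?_) (γ :=
        γ + Finsupp.single (Sum.inl (l, k + Finsupp.single n 1)) 1)
      rw [add_assoc]
    refine ⟨(Sum.inl (l, k + Finsupp.single n 1), Sum.inr (n + Finsupp.single i 1)), ?_, ?_⟩
    · simp [h1, h2]
    · simp only [f, Sum.elim_inl, Sum.elim_inr, add_tsub_cancel_right, he]
  · have h1 : β (Sum.inr (n + Finsupp.single i 1)) ≠ 0 := by
      refine ne_zero_of_add_single_eq ?_ he
      simp
    refine ⟨(Sum.inr (n + Finsupp.single i 1), Sum.inr (n + Finsupp.single i 1)), ?_, ?_⟩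
    · simp [h1]
    · simp only [f, Sum.elim_inr, add_tsub_cancel_right, he]

/-! ### Weights -/

/-- The homogeneity, shifted by a multiple of the noise homogeneity. -/
noncomputable def coordWt (t : ℝ) (β : CoordIdx d 𝔏) : ℝ := P.hom β + t * noiseHom β

/-- The degree of a generator, shifted by a multiple of the noise homogeneity. -/
noncomputable def genWt (t : ℝ) : P.PlusGen → ℝ :=
  Sum.elim (fun p => P.coordWt t p.1.1 + P.η - P.scaledDeg p.1.2) P.scal

theorem genWt_zero : P.genWt 0 = P.genDeg := by
  funext g
  rcases g with p | i
  · simp [genWt, genDeg, coordWt]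
  · rfl

theorem coordWt_add (t : ℝ) (β γ : CoordIdx d 𝔏) :
    P.coordWt t (β + γ) = P.coordWt t β + P.coordWt t γ := by
  rw [coordWt, coordWt, coordWt, hom_add, noiseHom_add]
  push_cast
  ring

section Action

variable (hscal : ∀ i, 1 ≤ P.scal i) (hsol : ∀ i, P.regSol ≤ P.scal i)
include hscal hsol

theorem exists_of_coeff_rho_add_inl {K : P.PlusIdx} {p : P.MPlus} {β : CoordIdx d 𝔏}
    {q : CoordPoly d 𝔏} (h : MvPolynomial.coeff β
      (P.rho (P.dividedD (K + Finsupp.single (Sum.inl p) 1)) q) ≠ 0) :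
    ∃ β', β = p.1.1 + β' ∧
      MvPolynomial.coeff β' (P.rho (P.dividedD K) (P.dN p.1.2 q)) ≠ 0 := by
  obtain ⟨c, hc⟩ := P.exists_dividedD_add_inl hscal hsol K p
  classical
  rw [hc, map_smul, LinearMap.smul_apply, MvPolynomial.coeff_smul,
    P.rho_sandwichLin hscal hsol _ _ (P.monomial_mem_coeffSpan p),
    MvPolynomial.coeff_monomial_mul', one_mul] at h
  split_ifs at h with hle
  · exact ⟨β - p.1.1, (add_tsub_cancel_of_le hle).symm, right_ne_zero_of_smul h⟩
  · exact absurd (smul_zero c) h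

omit hsol in
theorem coeff_rho_add_inr {K : P.PlusIdx} {i : Fin d} (hK : ∀ p, K (Sum.inl p) = 0)
    {β : CoordIdx d 𝔏} {q : CoordPoly d 𝔏} (h : MvPolynomial.coeff β
      (P.rho (P.dividedD (K + Finsupp.single (Sum.inr i) 1)) q) ≠ 0) :
    MvPolynomial.coeff β (P.dX i (P.rho (P.dividedD K) q)) ≠ 0 := by
  obtain ⟨c, hc⟩ := P.exists_dividedD_add_inr hscal hK i
  rw [hc, map_smul, LinearMap.smul_apply, MvPolynomial.coeff_smul, uGen, rho_ι_mul_apply] at h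
  exact right_ne_zero_of_smul h

/-- Each factor z^γ, with γ of positive noise homogeneity, is multiplied on from outside, and each
∂ᵢ raises the polynomial degree. The D^{(𝐧)} act first; allowing arbitrary q absorbs them. -/
theorem bounds_of_coeff_rho (K : P.PlusIdx) : ∀ (β : CoordIdx d 𝔏) (q : CoordPoly d 𝔏),
    MvPolynomial.coeff β (P.rho (P.dividedD K) q) ≠ 0 →
    (∀ p : P.MPlus, K (Sum.inl p) ≠ 0 → p.1.1 ≤ β) ∧
    (∀ p : P.MPlus, K (Sum.inl p) ≤ noiseHom β) ∧ ∀ i, K (Sum.inr i) ≤ polyDeg β := by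
  classical
  induction K using plusIdx_induction with
  | zero => simp
  | inr K i hK ih =>
    intro β q h
    obtain ⟨γ, h1, h2⟩ := exists_of_coeff_map_ne_zero
      (P.dX i : CoordPoly d 𝔏 →ₗ[ℝ] CoordPoly d 𝔏) (P.coeff_rho_add_inr hscal hK h)
    obtain ⟨-, -, h3⟩ := ih γ q h1
    have h4 := P.polyDeg_of_coeff_dX h2
    refine ⟨by simp [hK], by simp [hK], fun j => ?_⟩
    have h5 := h3 j
    rw [Finsupp.add_apply, Finsupp.single_apply]
    split_ifs <;> omega
  | inl K p ih =>
    intro β q h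
    obtain ⟨β', rfl, h1⟩ := P.exists_of_coeff_rho_add_inl hscal hsol h
    obtain ⟨h2, h3, h4⟩ := ih β' _ h1
    have hp := p.2.1.2
    refine ⟨fun p' hp' => ?_, fun p' => ?_, fun j => ?_⟩
    · by_cases hpp : p' = p
      · rw [hpp]
        exact le_self_add
      · refine (h2 p' fun h0 => hp' ?_).trans le_add_self
        rw [Finsupp.add_apply, h0, Finsupp.single_eq_of_ne (by simpa using hpp), add_zero]
    · have h5 := h3 p'
      rw [Finsupp.add_apply, Finsupp.single_apply, noiseHom_add]
      split_ifs <;> omega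
    · have h5 := h4 j
      rw [polyDeg_add, Finsupp.add_apply, Finsupp.single_eq_of_ne (by simp)]
      omega

theorem rowFinite_rho (K : P.PlusIdx) : RowFinite (P.rho (P.dividedD K)) := by
  induction K using plusIdx_induction with
  | zero =>
    classical
    rw [dividedD_zero, map_one]
    intro β
    refine (Set.finite_singleton β).subset fun γ hγ => ?_
    rw [Set.mem_ofPred_eq, Module.End.one_apply, MvPolynomial.coeff_monomial] at hγ
    by_contra hne
    exact hγ (if_neg hne)
  | inr K i hK ih =>
    intro β
    exact ((P.rowFinite_dX i).comp ih β).subset fun γ hγ => P.coeff_rho_add_inr hscal hK hγ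
  | inl K p ih =>
    obtain ⟨c, hc⟩ := P.exists_dividedD_add_inl hscal hsol K p
    have : P.rho (P.dividedD (K + Finsupp.single (Sum.inl p) 1)) =
        c • (LinearMap.mulLeft ℝ (MvPolynomial.monomial p.1.1 (1 : ℝ)) ∘ₗ
          P.rho (P.dividedD K) ∘ₗ (P.dN p.1.2 : CoordPoly d 𝔏 →ₗ[ℝ] CoordPoly d 𝔏)) := by
      refine LinearMap.ext fun q => ?_
      rw [hc, map_smul, LinearMap.smul_apply, LinearMap.smul_apply,
        P.rho_sandwichLin hscal hsol _ _ (P.monomial_mem_coeffSpan p)]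
      rfl
    rw [this]
    exact ((rowFinite_mulLeft_monomial _).comp (ih.comp (P.rowFinite_dN _))).smul c

-- Only finitely many γ lie below β, and for each of them |𝐧| < η + |γ| leaves finitely many 𝐧.
omit hsol in
theorem finite_plusIdx_bounds (β : CoordIdx d 𝔏) :
    {K : P.PlusIdx | (∀ p : P.MPlus, K (Sum.inl p) ≠ 0 → p.1.1 ≤ β) ∧
      (∀ p : P.MPlus, K (Sum.inl p) ≤ noiseHom β) ∧
      ∀ i, K (Sum.inr i) ≤ polyDeg β}.Finite := by
  classical
  have h1 : {p : P.MPlus | p.1.1 ≤ β}.Finite := by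
    have : {q : CoordIdx d 𝔏 × NVec d | q.1 ≤ β ∧ P.scaledDeg q.2 < P.η + P.hom q.1}.Finite := by
      refine ((Set.finite_Iic β).biUnion fun γ _ =>
        (P.finite_scaledDeg_lt hscal (P.η + P.hom γ)).image fun n => (γ, n)).subset ?_
      rintro ⟨γ, n⟩ ⟨hγ, hn⟩
      exact Set.mem_biUnion hγ ⟨n, hn, rfl⟩
    exact (this.preimage Subtype.val_injective.injOn).subset fun p hp => ⟨hp, p.2.2⟩
  let G : Finset P.PlusGen := h1.toFinset.disjSum Finset.univ
  -- One bound for all entries: the first summand serves J, the second 𝐦.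
  refine (Set.finite_Iic (Finsupp.indicator G fun _ _ => noiseHom β + polyDeg β)).subset ?_
  rintro K ⟨hK1, hK2, hK3⟩ g
  rcases g with p | i
  · by_cases h0 : K (Sum.inl p) = 0
    · rw [h0]
      exact Nat.zero_le _
    · rw [Finsupp.indicator_of_mem (by simpa [G] using hK1 p h0)]
      exact (hK2 p).trans (Nat.le_add_right _ _)
  · rw [Finsupp.indicator_of_mem (by simp [G])]
    exact (hK3 i).trans (Nat.le_add_left _ _)

theorem finite_coeff_rho (β : CoordIdx d 𝔏) :
    {q : P.PlusIdx × CoordIdx d 𝔏 | MvPolynomial.coeff β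
      (P.rho (P.dividedD q.1) (MvPolynomial.monomial q.2 1)) ≠ 0}.Finite := by
  refine ((P.finite_plusIdx_bounds hscal β).biUnion fun K _ =>
    (P.rowFinite_rho hscal hsol K β).image fun γ => (K, γ)).subset ?_
  rintro ⟨K, γ⟩ h
  exact Set.mem_biUnion (P.bounds_of_coeff_rho hscal hsol K β _ h) ⟨γ, h, rfl⟩

/-- D^{(𝐧)} and ∂ᵢ leave the noise homogeneity unchanged, so it changes only through the factors
z^γ; adding any multiple of it to the homogeneity gives another conserved weight. -/
theorem coordWt_of_coeff_rho (t : ℝ) (K : P.PlusIdx) : ∀ β γ : CoordIdx d 𝔏,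
    MvPolynomial.coeff β (P.rho (P.dividedD K) (MvPolynomial.monomial γ 1)) ≠ 0 →
    P.coordWt t β = P.coordWt t γ + Finsupp.weight (P.genWt t) K := by
  classical
  induction K using plusIdx_induction with
  | zero =>
    intro β γ h
    rw [dividedD_zero, map_one, Module.End.one_apply, MvPolynomial.coeff_monomial] at h
    split_ifs at h with h1
    · rw [h1, map_zero, add_zero]
    · exact absurd rfl h
  | inr K i hK ih =>
    intro β γ h
    obtain ⟨γ', h1, h2⟩ := exists_of_coeff_map_ne_zero
      (P.dX i : CoordPoly d 𝔏 →ₗ[ℝ] CoordPoly d 𝔏) (P.coeff_rho_add_inr hscal hK h)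
    have h3 := ih γ' γ h1
    rw [map_add, Finsupp.weight_single, one_smul, ← add_assoc, ← h3, coordWt, coordWt,
      P.noiseHom_of_coeff_dX h2, P.hom_of_coeff_dX h2]
    change _ = _ + P.scal i
    ring
  | inl K p ih =>
    intro β γ h
    obtain ⟨β', rfl, h1⟩ := P.exists_of_coeff_rho_add_inl hscal hsol h
    obtain ⟨γ', h2, h3⟩ := exists_of_coeff_map_ne_zero (P.rho (P.dividedD K)) h1
    have h4 := ih β' γ' h3
    have h5 : P.coordWt t γ' = P.coordWt t γ + (P.η - P.scaledDeg p.1.2) := by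
      rw [coordWt, coordWt, P.noiseHom_of_coeff_dN h2, P.hom_of_coeff_dN h2]
      ring
    rw [map_add, Finsupp.weight_single, one_smul, coordWt_add, h4, h5]
    change _ = _ + (_ + (P.coordWt t p.1.1 + P.η - P.scaledDeg p.1.2))
    ring

/-! ### Structure constants of the product -/

local notation "𝒃" => dBasis P hscal hsol

open Classical in
theorem coord_zero : (𝒃).coord 0 = envelopingCounit.toLinearMap := by
  refine (𝒃).ext fun K => ?_
  rw [Module.Basis.coord_apply, Module.Basis.repr_self, dBasis_apply, AlgHom.toLinearMap_apply,
    P.counit_dividedD hscal hsol, Finsupp.single_apply]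

open Classical in
theorem coord_single (g : P.PlusGen) : (𝒃).coord (Finsupp.single g 1) = P.genCoeff g := by
  refine (𝒃).ext fun K => ?_
  rw [Module.Basis.coord_apply, Module.Basis.repr_self, dBasis_apply,
    P.genCoeff_dividedD hscal hsol, Finsupp.single_apply]

theorem coord_add (K₁ K₂ : P.PlusIdx) :
    (𝒃).coord (K₁ + K₂) = LinearMap.mul' ℝ ℝ ∘ₗ
      TensorProduct.map ((𝒃).coord K₁) ((𝒃).coord K₂) ∘ₗ envelopingComul.toLinearMap := by
  classical
  refine (𝒃).ext fun K => ?_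
  rw [Module.Basis.coord_apply, Module.Basis.repr_self, LinearMap.comp_apply,
    LinearMap.comp_apply, AlgHom.toLinearMap_apply, dBasis_apply, P.comul_dividedD hscal hsol,
    map_sum, map_sum]
  have : ∀ q ∈ Finset.HasAntidiagonal.antidiagonal K, LinearMap.mul' ℝ ℝ
      (TensorProduct.map ((𝒃).coord K₁) ((𝒃).coord K₂)
        (P.dividedD q.1 ⊗ₜ[ℝ] P.dividedD q.2)) = if q = (K₁, K₂) then 1 else 0 := by
    rintro ⟨A, B⟩ -
    rw [TensorProduct.map_tmul, LinearMap.mul'_apply, ← P.dBasis_apply hscal hsol,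
      ← P.dBasis_apply hscal hsol, Module.Basis.coord_apply, Module.Basis.coord_apply,
      Module.Basis.repr_self, Module.Basis.repr_self, Finsupp.single_apply, Finsupp.single_apply]
    by_cases h1 : A = K₁ <;> by_cases h2 : B = K₂ <;> simp [h1, h2]
  rw [Finset.sum_congr rfl this, Finset.sum_ite_eq', Finsupp.single_apply]
  simp only [Finset.HasAntidiagonal.mem_antidiagonal, eq_comm]

theorem prodCoeff_eq_coord (K' K'' K : P.PlusIdx) :
    prodCoeff 𝒃 K' K'' K = (𝒃).coord K (P.dividedD K' * P.dividedD K'') := by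
  rw [prodCoeff, dBasis_apply, dBasis_apply, Module.Basis.coord_apply]

theorem prodCoeff_zero_ne {K' K'' : P.PlusIdx} (h : prodCoeff 𝒃 K' K'' 0 ≠ 0) :
    K' = 0 ∧ K'' = 0 := by
  classical
  rw [prodCoeff_eq_coord, coord_zero, AlgHom.toLinearMap_apply, map_mul,
    P.counit_dividedD hscal hsol, P.counit_dividedD hscal hsol] at h
  by_contra hc
  rw [not_and_or] at hc
  rcases hc with hc | hc <;> simp [hc] at h

/-- The coordinate functional at K₁ + K₂ is a convolution product and the coproduct is
multiplicative. Structure constants at a sum therefore come from those at the summands, reducing all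
questions to single generators. -/
theorem prodCoeff_add_ne {K₁ K₂ K' K'' : P.PlusIdx} (h : prodCoeff 𝒃 K' K'' (K₁ + K₂) ≠ 0) :
    ∃ A A' B B' : P.PlusIdx, K' = A + B ∧ K'' = A' + B' ∧ prodCoeff 𝒃 A A' K₁ ≠ 0 ∧
      prodCoeff 𝒃 B B' K₂ ≠ 0 := by
  classical
  rw [prodCoeff_eq_coord, coord_add, LinearMap.comp_apply, LinearMap.comp_apply,
    AlgHom.toLinearMap_apply, map_mul, P.comul_dividedD hscal hsol, P.comul_dividedD hscal hsol,
    Finset.sum_mul_sum, map_sum, map_sum] at h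
  obtain ⟨⟨A, B⟩, hq, h⟩ := Finset.exists_ne_zero_of_sum_ne_zero h
  rw [map_sum, map_sum] at h
  obtain ⟨⟨A', B'⟩, hr, h⟩ := Finset.exists_ne_zero_of_sum_ne_zero h
  rw [Algebra.TensorProduct.tmul_mul_tmul, TensorProduct.map_tmul, LinearMap.mul'_apply] at h
  refine ⟨A, A', B, B', (Finset.HasAntidiagonal.mem_antidiagonal.mp hq).symm,
    (Finset.HasAntidiagonal.mem_antidiagonal.mp hr).symm, ?_, ?_⟩
  · rw [prodCoeff_eq_coord]
    exact left_ne_zero_of_mul h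
  · rw [prodCoeff_eq_coord]
    exact right_ne_zero_of_mul h

/-- The coordinate at a generator is a matrix coefficient of ρ, and ρ is multiplicative; γ is an
intermediate monomial. -/
theorem prodCoeff_single_ne {g : P.PlusGen} {K' K'' : P.PlusIdx}
    (h : prodCoeff 𝒃 K' K'' (Finsupp.single g 1) ≠ 0) :
    ∃ γ : CoordIdx d 𝔏,
      MvPolynomial.coeff γ (P.rho (P.dividedD K'') (MvPolynomial.monomial
        (Finsupp.single (Sum.inr (P.genSource g)) 1) 1)) ≠ 0 ∧
      MvPolynomial.coeff (P.genTarget g)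
        (P.rho (P.dividedD K') (MvPolynomial.monomial γ 1)) ≠ 0 := by
  rw [prodCoeff_eq_coord, coord_single] at h
  change MvPolynomial.coeff (P.genTarget g) (P.rho (P.dividedD K' * P.dividedD K'')
    (MvPolynomial.X (Sum.inr (P.genSource g)))) ≠ 0 at h
  rw [map_mul, Module.End.mul_apply] at h
  exact exists_of_coeff_map_ne_zero _ h

theorem finite_prodCoeff (K : P.PlusIdx) :
    {q : P.PlusIdx × P.PlusIdx | prodCoeff 𝒃 q.1 q.2 K ≠ 0}.Finite := by
  have hstep : ∀ (K₀ : P.PlusIdx) (g : P.PlusGen),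
      {q : P.PlusIdx × P.PlusIdx | prodCoeff 𝒃 q.1 q.2 K₀ ≠ 0}.Finite →
      {q : P.PlusIdx × P.PlusIdx |
        prodCoeff 𝒃 q.1 q.2 (K₀ + Finsupp.single g 1) ≠ 0}.Finite := by
    intro K₀ g h0
    -- Finiteness of the action is applied twice: backwards from the target to the pairs (K', γ),
    -- then from each γ to K''.
    have hg : {q : P.PlusIdx × P.PlusIdx |
        prodCoeff 𝒃 q.1 q.2 (Finsupp.single g 1) ≠ 0}.Finite := by
      refine ((P.finite_coeff_rho hscal hsol (P.genTarget g)).biUnion fun q _ =>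
        (P.finite_coeff_rho hscal hsol q.2).image fun r => (q.1, r.1)).subset ?_
      rintro ⟨K', K''⟩ h
      obtain ⟨γ, h1, h2⟩ := P.prodCoeff_single_ne hscal hsol h
      exact Set.mem_biUnion (x := (K', γ)) h2 ⟨(K'', _), h1, rfl⟩
    refine (h0.image2 (fun q r => q + r) hg).subset ?_
    rintro ⟨K', K''⟩ h
    obtain ⟨A, A', B, B', rfl, rfl, h1, h2⟩ := P.prodCoeff_add_ne hscal hsol h
    exact ⟨(A, A'), h1, (B, B'), h2, rfl⟩
  induction K using plusIdx_induction with
  | zero =>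
    refine (Set.finite_singleton (0, 0)).subset fun q hq => ?_
    obtain ⟨h1, h2⟩ := P.prodCoeff_zero_ne hscal hsol hq
    exact Prod.ext h1 h2
  | inr K i _ ih => exact hstep K _ ih
  | inl K p ih => exact hstep K _ ih

theorem weight_of_prodCoeff (t : ℝ) (K : P.PlusIdx) : ∀ K' K'' : P.PlusIdx,
    prodCoeff 𝒃 K' K'' K ≠ 0 →
    Finsupp.weight (P.genWt t) K' + Finsupp.weight (P.genWt t) K'' =
      Finsupp.weight (P.genWt t) K := by
  have hg : ∀ (g : P.PlusGen) (K' K'' : P.PlusIdx),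
      prodCoeff 𝒃 K' K'' (Finsupp.single g 1) ≠ 0 →
      Finsupp.weight (P.genWt t) K' + Finsupp.weight (P.genWt t) K'' = P.genWt t g := by
    intro g K' K'' h
    obtain ⟨γ, h1, h2⟩ := P.prodCoeff_single_ne hscal hsol h
    have e1 := P.coordWt_of_coeff_rho hscal hsol t K'' _ _ h1
    have e2 := P.coordWt_of_coeff_rho hscal hsol t K' _ _ h2
    -- Source and target of `genCoeff g` differ in weight exactly by the weight of g, the shift -η
    -- of z_𝐧 accounting for the η in that weight.
    have e3 : ∀ n : NVec d, P.coordWt t (Finsupp.single (Sum.inr n) 1 : CoordIdx d 𝔏) =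
        P.scaledDeg n - P.η := by
      intro n
      rw [coordWt, hom_inr, noiseHom_inr, Nat.cast_zero, mul_zero, add_zero]
    rw [e3] at e1
    rcases g with p | i
    · simp only [genTarget, genSource, genWt, Sum.elim_inl] at e1 e2 ⊢
      linarith
    · simp only [genTarget, genSource, genWt, Sum.elim_inr] at e1 e2 ⊢
      rw [e3, scaledDeg_single] at e2
      have : P.scaledDeg 0 = 0 := by simp [scaledDeg]
      linarith
  have hstep : ∀ (K₀ : P.PlusIdx) (g : P.PlusGen),
      (∀ K' K'' : P.PlusIdx, prodCoeff 𝒃 K' K'' K₀ ≠ 0 → Finsupp.weight (P.genWt t) K' +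
        Finsupp.weight (P.genWt t) K'' = Finsupp.weight (P.genWt t) K₀) →
      ∀ K' K'' : P.PlusIdx, prodCoeff 𝒃 K' K'' (K₀ + Finsupp.single g 1) ≠ 0 →
        Finsupp.weight (P.genWt t) K' + Finsupp.weight (P.genWt t) K'' =
          Finsupp.weight (P.genWt t) (K₀ + Finsupp.single g 1) := by
    intro K₀ g h0 K' K'' h
    obtain ⟨A, A', B, B', rfl, rfl, h1, h2⟩ := P.prodCoeff_add_ne hscal hsol h
    have e1 := h0 _ _ h1
    have e2 := hg _ _ _ h2
    rw [map_add, map_add, map_add, Finsupp.weight_single, one_smul]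
    linarith
  induction K using plusIdx_induction with
  | zero =>
    intro K' K'' h
    obtain ⟨rfl, rfl⟩ := P.prodCoeff_zero_ne hscal hsol h
    rw [map_zero, add_zero]
  | inr K i _ ih => exact hstep K _ ih
  | inl K p ih => exact hstep K _ ih

end Action

end RegParams

/-! ### Pairings of tensor products -/

section TensorPairing

variable {U U' U'' T T' T'' : Type*} [AddCommGroup U] [Module ℝ U] [AddCommGroup U'] [Module ℝ U']
  [AddCommGroup T] [Module ℝ T] [AddCommGroup T'] [Module ℝ T']
  [AddCommGroup U''] [Module ℝ U''] [AddCommGroup T''] [Module ℝ T'']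

/-- The tensor product of two pairings. -/
noncomputable def tensorPairing (p : U →ₗ[ℝ] T →ₗ[ℝ] ℝ) (p' : U' →ₗ[ℝ] T' →ₗ[ℝ] ℝ) :
    U ⊗[ℝ] U' →ₗ[ℝ] T ⊗[ℝ] T' →ₗ[ℝ] ℝ :=
  TensorProduct.dualDistrib ℝ T T' ∘ₗ TensorProduct.map p p'

variable (p : U →ₗ[ℝ] T →ₗ[ℝ] ℝ) (p' : U' →ₗ[ℝ] T' →ₗ[ℝ] ℝ) (p'' : U'' →ₗ[ℝ] T'' →ₗ[ℝ] ℝ)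

@[simp]
theorem tensorPairing_tmul (u : U) (u' : U') (x : T) (x' : T') :
    tensorPairing p p' (u ⊗ₜ[ℝ] u') (x ⊗ₜ[ℝ] x') = p u x * p' u' x' := by
  simp [tensorPairing]

/-- The family `b` is dual to the basis `c`. -/
def IsDualFamily {ι : Type*} (b : ι → U) (c : Module.Basis ι ℝ T) : Prop :=
  ∀ i, p (b i) = c.coord i

variable {p p'}

theorem IsDualFamily.tensor {ι ι' : Type*} {b : ι → U} {c : Module.Basis ι ℝ T} {b' : ι' → U'}
    {c' : Module.Basis ι' ℝ T'} (h : IsDualFamily p b c) (h' : IsDualFamily p' b' c') :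
    IsDualFamily (tensorPairing p p') (fun i : ι × ι' => b i.1 ⊗ₜ[ℝ] b' i.2)
      (c.tensorProduct c') := by
  rintro ⟨i, i'⟩
  refine TensorProduct.ext' fun x x' => ?_
  rw [tensorPairing_tmul, h i, h' i', Module.Basis.coord_apply, Module.Basis.coord_apply,
    Module.Basis.coord_apply, Module.Basis.tensorProduct_repr_tmul_apply, smul_eq_mul, mul_comm]

theorem IsDualFamily.ext {ι : Type*} {b : ι → U} {c : Module.Basis ι ℝ T}
    (h : IsDualFamily p b c) {x y : T} (hxy : ∀ i, p (b i) x = p (b i) y) : x = y := by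
  refine c.ext_elem fun i => ?_
  have := hxy i
  rwa [h i] at this

variable (p p')

theorem tensorPairing_assoc (u : U) (u' : U') (u'' : U'') (z : (T ⊗[ℝ] T') ⊗[ℝ] T'') :
    tensorPairing p (tensorPairing p' p'') (u ⊗ₜ[ℝ] (u' ⊗ₜ[ℝ] u''))
        (TensorProduct.assoc ℝ T T' T'' z) =
      tensorPairing (tensorPairing p p') p'' ((u ⊗ₜ[ℝ] u') ⊗ₜ[ℝ] u'') z := by
  induction z with
  | zero => simp only [map_zero]
  | add z z' h h' => simp only [map_add, h, h']
  | tmul z x'' =>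
    induction z with
    | zero => simp only [TensorProduct.zero_tmul, map_zero]
    | add z z' h h' => simp only [TensorProduct.add_tmul, map_add, h, h']
    | tmul x x' =>
      rw [TensorProduct.assoc_tmul, tensorPairing_tmul, tensorPairing_tmul, tensorPairing_tmul,
        tensorPairing_tmul, mul_assoc]

variable {p p'}

theorem tensorPairing_lTensor {V V' : Type*} [AddCommGroup V] [Module ℝ V] [AddCommGroup V']
    [Module ℝ V'] {r : V →ₗ[ℝ] V' →ₗ[ℝ] ℝ} {f : T' →ₗ[ℝ] V'} {v : V} {u' : U'}
    (h : ∀ x, r v (f x) = p' u' x) (u : U) (z : T ⊗[ℝ] T') :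
    tensorPairing p r (u ⊗ₜ[ℝ] v) (f.lTensor T z) = tensorPairing p p' (u ⊗ₜ[ℝ] u') z := by
  induction z with
  | zero => simp only [map_zero]
  | add z z' h h' => simp only [map_add, h, h']
  | tmul x x' => rw [LinearMap.lTensor_tmul, tensorPairing_tmul, tensorPairing_tmul, h]

theorem tensorPairing_rTensor {V V' : Type*} [AddCommGroup V] [Module ℝ V] [AddCommGroup V']
    [Module ℝ V'] {r : V →ₗ[ℝ] V' →ₗ[ℝ] ℝ} {f : T →ₗ[ℝ] V'} {v : V} {u : U}
    (h : ∀ x, r v (f x) = p u x) (u' : U') (z : T ⊗[ℝ] T') :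
    tensorPairing r p' (v ⊗ₜ[ℝ] u') (f.rTensor T' z) = tensorPairing p p' (u ⊗ₜ[ℝ] u') z := by
  induction z with
  | zero => simp only [map_zero]
  | add z z' h h' => simp only [map_add, h, h']
  | tmul x x' => rw [LinearMap.rTensor_tmul, tensorPairing_tmul, tensorPairing_tmul, h]

end TensorPairing

/-! ### The Hopf algebra dual to an algebra with a basis of divided powers -/

section DividedPowers

variable {σ U : Type*} [Ring U] [Algebra ℝ U]

/-- `b` is a basis of divided powers for the coproduct `δ` and the counit `ε`, with row-finite
structure constants of the product. -/
structure IsDividedPowerBasis (b : Module.Basis (σ →₀ ℕ) ℝ U) (δ : U →ₐ[ℝ] U ⊗[ℝ] U)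
    (ε : U →ₐ[ℝ] ℝ) : Prop where
  one : b 0 = 1
  coord_zero : b.coord 0 = ε.toLinearMap
  coord_add : ∀ K K', b.coord (K + K') =
    LinearMap.mul' ℝ ℝ ∘ₗ TensorProduct.map (b.coord K) (b.coord K') ∘ₗ δ.toLinearMap
  finite : ∀ K, {q : (σ →₀ ℕ) × (σ →₀ ℕ) | b.repr (b q.1 * b q.2) K ≠ 0}.Finite

/-- The pairing for which the basis `b` is dual to the monomials. -/
noncomputable def monomialPairing (b : Module.Basis (σ →₀ ℕ) ℝ U) :
    U →ₗ[ℝ] MvPolynomial σ ℝ →ₗ[ℝ] ℝ :=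
  b.constr ℝ fun K => MvPolynomial.lcoeff ℝ K

/-- The transposed product. -/
noncomputable def transposeMul (b : Module.Basis (σ →₀ ℕ) ℝ U) :
    MvPolynomial σ ℝ →ₗ[ℝ] MvPolynomial σ ℝ ⊗[ℝ] MvPolynomial σ ℝ :=
  (MvPolynomial.basisMonomials σ ℝ).constr ℝ fun K =>
    ∑ᶠ q : (σ →₀ ℕ) × (σ →₀ ℕ), b.repr (b q.1 * b q.2) K •
      (MvPolynomial.monomial q.1 (1 : ℝ) ⊗ₜ[ℝ] MvPolynomial.monomial q.2 (1 : ℝ))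

variable {b : Module.Basis (σ →₀ ℕ) ℝ U} {δ : U →ₐ[ℝ] U ⊗[ℝ] U} {ε : U →ₐ[ℝ] ℝ}

theorem isDualFamily_monomialPairing :
    IsDualFamily (monomialPairing b) b (MvPolynomial.basisMonomials σ ℝ) := by
  intro K
  rw [monomialPairing, Module.Basis.constr_basis]
  rfl

theorem monomialPairing_monomial (u : U) (K : σ →₀ ℕ) :
    monomialPairing b u (MvPolynomial.monomial K 1) = b.coord K u := by
  classical
  have : (monomialPairing b).flip (MvPolynomial.monomial K 1) = b.coord K := by
    refine b.ext fun K' => ?_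
    rw [LinearMap.flip_apply, monomialPairing, Module.Basis.constr_basis,
      MvPolynomial.lcoeff_apply, MvPolynomial.coeff_monomial, Module.Basis.coord_apply,
      Module.Basis.repr_self, Finsupp.single_apply]
    simp only [eq_comm]
  exact LinearMap.congr_fun this u

theorem MvPolynomial.linearMap_ext_monomial {V : Type*} [AddCommGroup V] [Module ℝ V]
    {f g : MvPolynomial σ ℝ →ₗ[ℝ] V}
    (h : ∀ K, f (MvPolynomial.monomial K 1) = g (MvPolynomial.monomial K 1)) : f = g := by
  refine (MvPolynomial.basisMonomials σ ℝ).ext fun K => ?_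
  rw [MvPolynomial.coe_basisMonomials]
  exact h K

namespace IsDividedPowerBasis

variable (hb : IsDividedPowerBasis b δ ε)
include hb

theorem transposeMul_monomial (K : σ →₀ ℕ) :
    transposeMul b (MvPolynomial.monomial K 1) = ∑ q ∈ (hb.finite K).toFinset,
      b.repr (b q.1 * b q.2) K •
        (MvPolynomial.monomial q.1 (1 : ℝ) ⊗ₜ[ℝ] MvPolynomial.monomial q.2 (1 : ℝ)) := by
  rw [transposeMul, ← congrFun (MvPolynomial.coe_basisMonomials σ ℝ) K,
    Module.Basis.constr_basis]
  refine finsum_eq_sum_of_support_subset _ fun q hq => ?_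
  rw [Set.Finite.coe_toFinset]
  intro h0
  refine hq ?_
  simp only [h0, zero_smul]

theorem pairing_one_left (x : MvPolynomial σ ℝ) :
    monomialPairing b 1 x = MvPolynomial.coeff 0 x := by
  rw [← hb.one, monomialPairing, Module.Basis.constr_basis, MvPolynomial.lcoeff_apply]

theorem pairing_one_right (u : U) : monomialPairing b u 1 = ε u := by
  have h : (1 : MvPolynomial σ ℝ) = MvPolynomial.monomial 0 1 := rfl
  rw [h, monomialPairing_monomial, hb.coord_zero, AlgHom.toLinearMap_apply]

/-- Row-finiteness makes the transposed product a finite sum, and pairing with b_A ⊗ b_B selects one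
term, which is zero if it is missing from the sum. -/
theorem pairing_transposeMul (t : U ⊗[ℝ] U) (x : MvPolynomial σ ℝ) :
    tensorPairing (monomialPairing b) (monomialPairing b) t (transposeMul b x) =
      monomialPairing b (LinearMap.mul' ℝ U t) x := by
  classical
  have h : tensorPairing (monomialPairing b) (monomialPairing b) t ∘ₗ transposeMul b =
      monomialPairing b (LinearMap.mul' ℝ U t) := by
    refine MvPolynomial.linearMap_ext_monomial fun K => ?_
    rw [LinearMap.comp_apply, hb.transposeMul_monomial, monomialPairing_monomial]
    suffices hs : (tensorPairing (monomialPairing b) (monomialPairing b)).flip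
        (∑ q ∈ (hb.finite K).toFinset, b.repr (b q.1 * b q.2) K •
          (MvPolynomial.monomial q.1 (1 : ℝ) ⊗ₜ[ℝ] MvPolynomial.monomial q.2 (1 : ℝ))) =
        b.coord K ∘ₗ LinearMap.mul' ℝ U from LinearMap.congr_fun hs t
    refine (b.tensorProduct b).ext fun ⟨A, B⟩ => ?_
    rw [Module.Basis.tensorProduct_apply, LinearMap.flip_apply, LinearMap.comp_apply,
      LinearMap.mul'_apply, map_sum, Module.Basis.coord_apply]
    have : ∀ q ∈ (hb.finite K).toFinset,
        tensorPairing (monomialPairing b) (monomialPairing b) (b A ⊗ₜ[ℝ] b B)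
          (b.repr (b q.1 * b q.2) K • (MvPolynomial.monomial q.1 (1 : ℝ) ⊗ₜ[ℝ]
            MvPolynomial.monomial q.2 (1 : ℝ))) =
        if q = (A, B) then b.repr (b A * b B) K else 0 := by
      rintro ⟨A', B'⟩ -
      rw [map_smul, tensorPairing_tmul, monomialPairing_monomial, monomialPairing_monomial,
        Module.Basis.coord_apply, Module.Basis.coord_apply, Module.Basis.repr_self,
        Module.Basis.repr_self, Finsupp.single_apply, Finsupp.single_apply]
      by_cases h1 : A = A' <;> by_cases h2 : B = B'
      · subst h1 h2; simp
      · simp [h2, Ne.symm h2]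
      · simp [h1, Ne.symm h1]
      · simp [h1, Ne.symm h1]
    rw [Finset.sum_congr rfl this, Finset.sum_ite_eq']
    split_ifs with h
    · rfl
    · rw [Set.Finite.mem_toFinset] at h
      exact (not_not.mp h).symm
  exact LinearMap.congr_fun h x

theorem pairing_mul' (u : U) (z : MvPolynomial σ ℝ ⊗[ℝ] MvPolynomial σ ℝ) :
    monomialPairing b u (LinearMap.mul' ℝ _ z) =
      tensorPairing (monomialPairing b) (monomialPairing b) (δ u) z := by
  have h : monomialPairing b u ∘ₗ LinearMap.mul' ℝ _ =
      tensorPairing (monomialPairing b) (monomialPairing b) (δ u) := by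
    refine ((MvPolynomial.basisMonomials σ ℝ).tensorProduct
      (MvPolynomial.basisMonomials σ ℝ)).ext fun ⟨A, B⟩ => ?_
    rw [Module.Basis.tensorProduct_apply, MvPolynomial.coe_basisMonomials, LinearMap.comp_apply,
      LinearMap.mul'_apply, MvPolynomial.monomial_mul, one_mul, monomialPairing_monomial,
      hb.coord_add, LinearMap.comp_apply, LinearMap.comp_apply, AlgHom.toLinearMap_apply]
    induction δ u with
    | zero => simp only [map_zero, LinearMap.zero_apply]
    | add s t hs ht => simp only [map_add, LinearMap.add_apply, hs, ht]
    | tmul v w =>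
      rw [TensorProduct.map_tmul, LinearMap.mul'_apply, tensorPairing_tmul,
        monomialPairing_monomial, monomialPairing_monomial]
  exact LinearMap.congr_fun h z

theorem pairing_mul (u : U) (x y : MvPolynomial σ ℝ) :
    monomialPairing b u (x * y) =
      tensorPairing (monomialPairing b) (monomialPairing b) (δ u) (x ⊗ₜ[ℝ] y) := by
  rw [← hb.pairing_mul', LinearMap.mul'_apply]

omit hb in
theorem pairing_ext {x y : MvPolynomial σ ℝ}
    (h : ∀ u, monomialPairing b u x = monomialPairing b u y) : x = y :=
  (isDualFamily_monomialPairing (b := b)).ext fun K => h (b K)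

omit hb in
theorem tensorPairing_ext {x y : MvPolynomial σ ℝ ⊗[ℝ] MvPolynomial σ ℝ}
    (h : ∀ u v, tensorPairing (monomialPairing b) (monomialPairing b) (u ⊗ₜ[ℝ] v) x =
      tensorPairing (monomialPairing b) (monomialPairing b) (u ⊗ₜ[ℝ] v) y) : x = y :=
  ((isDualFamily_monomialPairing (b := b)).tensor isDualFamily_monomialPairing).ext
    fun K => h (b K.1) (b K.2)

theorem transposeMul_coassoc :
    TensorProduct.assoc ℝ (MvPolynomial σ ℝ) (MvPolynomial σ ℝ) (MvPolynomial σ ℝ) ∘ₗ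
        (transposeMul b).rTensor (MvPolynomial σ ℝ) ∘ₗ transposeMul b =
      (transposeMul b).lTensor (MvPolynomial σ ℝ) ∘ₗ transposeMul b := by
  have hd := isDualFamily_monomialPairing (b := b)
  refine LinearMap.ext fun x => (hd.tensor (hd.tensor hd)).ext fun ⟨A, B, C⟩ => ?_
  simp only [LinearMap.comp_apply, LinearEquiv.coe_coe]
  rw [tensorPairing_assoc,
    tensorPairing_rTensor (fun x => hb.pairing_transposeMul (b A ⊗ₜ[ℝ] b B) x),
    tensorPairing_lTensor (fun x => hb.pairing_transposeMul (b B ⊗ₜ[ℝ] b C) x),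
    hb.pairing_transposeMul, hb.pairing_transposeMul, LinearMap.mul'_apply,
    LinearMap.mul'_apply, LinearMap.mul'_apply, LinearMap.mul'_apply, mul_assoc]

theorem pairing_lid_rTensor {V V' : Type*} [AddCommGroup V] [Module ℝ V] [AddCommGroup V']
    [Module ℝ V'] (p : V →ₗ[ℝ] V' →ₗ[ℝ] ℝ) (v : V) (z : MvPolynomial σ ℝ ⊗[ℝ] V') :
    p v (TensorProduct.lid ℝ V' ((MvPolynomial.lcoeff ℝ (0 : σ →₀ ℕ)).rTensor V' z)) =
      tensorPairing (monomialPairing b) p ((1 : U) ⊗ₜ[ℝ] v) z := by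
  induction z with
  | zero => simp only [map_zero]
  | add z z' h h' => simp only [map_add, h, h']
  | tmul x y =>
    rw [LinearMap.rTensor_tmul, TensorProduct.lid_tmul, map_smul, tensorPairing_tmul,
      hb.pairing_one_left, smul_eq_mul, MvPolynomial.lcoeff_apply]

theorem rTensor_counit_transposeMul :
    (MvPolynomial.lcoeff ℝ (0 : σ →₀ ℕ)).rTensor (MvPolynomial σ ℝ) ∘ₗ transposeMul b =
      TensorProduct.mk ℝ ℝ _ 1 := by
  refine LinearMap.ext fun x => (TensorProduct.lid ℝ (MvPolynomial σ ℝ)).injective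
    (pairing_ext (b := b) fun u => ?_)
  rw [LinearMap.comp_apply, hb.pairing_lid_rTensor, hb.pairing_transposeMul,
    LinearMap.mul'_apply, one_mul, TensorProduct.mk_apply, TensorProduct.lid_tmul, one_smul]

theorem lTensor_counit_transposeMul :
    (MvPolynomial.lcoeff ℝ (0 : σ →₀ ℕ)).lTensor (MvPolynomial σ ℝ) ∘ₗ transposeMul b =
      (TensorProduct.mk ℝ _ ℝ).flip 1 := by
  have h : ∀ (u : U) (z : MvPolynomial σ ℝ ⊗[ℝ] MvPolynomial σ ℝ),
      monomialPairing b u (TensorProduct.rid ℝ (MvPolynomial σ ℝ)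
        ((MvPolynomial.lcoeff ℝ (0 : σ →₀ ℕ)).lTensor _ z)) =
      tensorPairing (monomialPairing b) (monomialPairing b) (u ⊗ₜ[ℝ] (1 : U)) z := by
    intro u z
    induction z with
    | zero => simp only [map_zero]
    | add z z' h h' => simp only [map_add, h, h']
    | tmul x y =>
      rw [LinearMap.lTensor_tmul, TensorProduct.rid_tmul, map_smul, tensorPairing_tmul,
        hb.pairing_one_left, smul_eq_mul, MvPolynomial.lcoeff_apply, mul_comm]
  refine LinearMap.ext fun x => (TensorProduct.rid ℝ (MvPolynomial σ ℝ)).injective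
    (pairing_ext (b := b) fun u => ?_)
  rw [LinearMap.comp_apply, h, hb.pairing_transposeMul, LinearMap.mul'_apply, mul_one,
    LinearMap.flip_apply, TensorProduct.mk_apply, TensorProduct.rid_tmul, one_smul]

theorem transposeMul_one : transposeMul b 1 = 1 := by
  refine tensorPairing_ext (b := b) fun u v => ?_
  rw [hb.pairing_transposeMul, LinearMap.mul'_apply, hb.pairing_one_right, map_mul,
    Algebra.TensorProduct.one_def, tensorPairing_tmul, hb.pairing_one_right,
    hb.pairing_one_right]

/-- Transposing multiplication in the tensor square requires both coproducts and an exchange of the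
middle legs; this is what reduces multiplicativity of the transposed product to that of δ. -/
theorem tensorPairing_mul (u v : U) (z z' : MvPolynomial σ ℝ ⊗[ℝ] MvPolynomial σ ℝ) :
    tensorPairing (monomialPairing b) (monomialPairing b) (u ⊗ₜ[ℝ] v) (z * z') =
      tensorPairing (tensorPairing (monomialPairing b) (monomialPairing b))
        (tensorPairing (monomialPairing b) (monomialPairing b))
        (TensorProduct.tensorTensorTensorComm ℝ U U U U (δ u ⊗ₜ[ℝ] δ v)) (z ⊗ₜ[ℝ] z') := by
  have key : ∀ (s t : U ⊗[ℝ] U) (x₁ x₂ y₁ y₂ : MvPolynomial σ ℝ),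
      tensorPairing (tensorPairing (monomialPairing b) (monomialPairing b))
        (tensorPairing (monomialPairing b) (monomialPairing b))
        (TensorProduct.tensorTensorTensorComm ℝ U U U U (s ⊗ₜ[ℝ] t))
        ((x₁ ⊗ₜ[ℝ] x₂) ⊗ₜ[ℝ] (y₁ ⊗ₜ[ℝ] y₂)) =
      tensorPairing (monomialPairing b) (monomialPairing b) s (x₁ ⊗ₜ[ℝ] y₁) *
        tensorPairing (monomialPairing b) (monomialPairing b) t (x₂ ⊗ₜ[ℝ] y₂) := by
    intro s t x₁ x₂ y₁ y₂
    induction s with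
    | zero => simp only [TensorProduct.zero_tmul, map_zero, LinearMap.zero_apply, zero_mul]
    | add s s' h h' =>
      simp only [TensorProduct.add_tmul, map_add, LinearMap.add_apply, h, h', add_mul]
    | tmul a a' =>
      induction t with
      | zero => simp only [TensorProduct.tmul_zero, map_zero, LinearMap.zero_apply, mul_zero]
      | add t t' h h' =>
        simp only [TensorProduct.tmul_add, map_add, LinearMap.add_apply, h, h', mul_add]
      | tmul c c' =>
        rw [TensorProduct.tensorTensorTensorComm_tmul]
        simp only [tensorPairing_tmul]
        ring
  induction z with
  | zero => simp only [TensorProduct.zero_tmul, map_zero, zero_mul]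
  | add z w h h' => simp only [TensorProduct.add_tmul, map_add, add_mul, h, h']
  | tmul x₁ x₂ =>
    induction z' with
    | zero => simp only [TensorProduct.tmul_zero, map_zero, mul_zero]
    | add z w h h' => simp only [TensorProduct.tmul_add, map_add, mul_add, h, h']
    | tmul y₁ y₂ =>
      rw [key, Algebra.TensorProduct.tmul_mul_tmul, tensorPairing_tmul, hb.pairing_mul,
        hb.pairing_mul]

theorem transposeMul_mul (x y : MvPolynomial σ ℝ) :
    transposeMul b (x * y) = transposeMul b x * transposeMul b y := by
  refine tensorPairing_ext (b := b) fun u v => ?_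
  rw [hb.tensorPairing_mul, hb.pairing_transposeMul, LinearMap.mul'_apply, hb.pairing_mul,
    map_mul]
  induction δ u with
  | zero => simp only [zero_mul, TensorProduct.zero_tmul, map_zero, LinearMap.zero_apply]
  | add s s' h h' => simp only [add_mul, TensorProduct.add_tmul, map_add, LinearMap.add_apply,
      h, h']
  | tmul a a' =>
    induction δ v with
    | zero => simp only [mul_zero, TensorProduct.tmul_zero, map_zero, LinearMap.zero_apply]
    | add t t' h h' => simp only [mul_add, TensorProduct.tmul_add, map_add, LinearMap.add_apply,
        h, h']
    | tmul c c' =>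
      rw [TensorProduct.tensorTensorTensorComm_tmul, Algebra.TensorProduct.tmul_mul_tmul,
        tensorPairing_tmul, tensorPairing_tmul, hb.pairing_transposeMul, hb.pairing_transposeMul,
        LinearMap.mul'_apply, LinearMap.mul'_apply]

/-! ### The antipode -/

omit hb in
theorem tensorPairing_map_left {S : U →ₗ[ℝ] U} {x a : MvPolynomial σ ℝ}
    (h : ∀ u, monomialPairing b u a = monomialPairing b (S u) x) (t : U ⊗[ℝ] U)
    (y : MvPolynomial σ ℝ) :
    tensorPairing (monomialPairing b) (monomialPairing b) (S.rTensor U t) (x ⊗ₜ[ℝ] y) =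
      tensorPairing (monomialPairing b) (monomialPairing b) t (a ⊗ₜ[ℝ] y) := by
  induction t with
  | zero => simp only [map_zero, LinearMap.zero_apply]
  | add s t h h' => simp only [map_add, LinearMap.add_apply, h, h']
  | tmul u v => rw [LinearMap.rTensor_tmul, tensorPairing_tmul, tensorPairing_tmul, h]

theorem tensorPairing_tmul_one (S : U →ₗ[ℝ] U) (u : U) (x : MvPolynomial σ ℝ) :
    tensorPairing (monomialPairing b) (monomialPairing b) (S.rTensor U (δ u)) (x ⊗ₜ[ℝ] 1) =
      monomialPairing b (S u) x := by
  have h1 : ∀ t : U ⊗[ℝ] U, tensorPairing (monomialPairing b) (monomialPairing b)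
      (S.rTensor U t) (x ⊗ₜ[ℝ] 1) =
      monomialPairing b (S (TensorProduct.rid ℝ U (ε.toLinearMap.lTensor U t))) x := by
    intro t
    induction t with
    | zero => simp only [map_zero, LinearMap.zero_apply]
    | add s t h h' => simp only [map_add, LinearMap.add_apply, h, h']
    | tmul v w =>
      rw [LinearMap.rTensor_tmul, tensorPairing_tmul, LinearMap.lTensor_tmul,
        TensorProduct.rid_tmul, map_smul, map_smul, LinearMap.smul_apply, smul_eq_mul,
        hb.pairing_one_right, mul_comm, AlgHom.toLinearMap_apply]
  -- The right counit law of δ is already contained in `coord_add` with second index 0, where the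
  -- coordinate is ε.
  have h2 : TensorProduct.rid ℝ U (ε.toLinearMap.lTensor U (δ u)) = u := by
    refine b.ext_elem fun K => ?_
    have h := LinearMap.congr_fun (hb.coord_add K 0) u
    rw [add_zero, LinearMap.comp_apply, LinearMap.comp_apply, AlgHom.toLinearMap_apply,
      hb.coord_zero] at h
    rw [← Module.Basis.coord_apply, ← Module.Basis.coord_apply, h]
    clear h
    induction δ u with
    | zero => simp only [map_zero]
    | add s t h h' => simp only [map_add, h, h']
    | tmul v w =>
      rw [LinearMap.lTensor_tmul, TensorProduct.rid_tmul, map_smul, TensorProduct.map_tmul,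
        LinearMap.mul'_apply, smul_eq_mul, mul_comm]
  rw [h1, h2]

/-- The transpose of S is a priori only a functional on U. The left antipode identity, paired with
Z^K, expresses it through transposes at indices of smaller w-weight, so it is a polynomial. The
second weight w₀ only records homogeneity. -/
theorem exists_transpose_antipode_monomial {S : U →ₗ[ℝ] U}
    (hS : ∀ u, LinearMap.mul' ℝ U (S.rTensor U (δ u)) = algebraMap ℝ U (ε u))
    (w w₀ : σ → ℝ) (hw1 : ∀ g, 1 ≤ w g)
    (hw : ∀ K K' K'', b.repr (b K' * b K'') K ≠ 0 →
      Finsupp.weight w K' + Finsupp.weight w K'' = Finsupp.weight w K)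
    (hw₀ : ∀ K K' K'', b.repr (b K' * b K'') K ≠ 0 →
      Finsupp.weight w₀ K' + Finsupp.weight w₀ K'' = Finsupp.weight w₀ K) (K : σ →₀ ℕ) :
    ∃ a ∈ MvPolynomial.weightedHomogeneousSubmodule ℝ w₀ (Finsupp.weight w₀ K),
      ∀ u, monomialPairing b u a = monomialPairing b (S u) (MvPolynomial.monomial K 1) := by
  classical
  have hpos : ∀ K : σ →₀ ℕ, K ≠ 0 → 1 ≤ Finsupp.weight w K := by
    intro K hK
    obtain ⟨g, hg⟩ := Finsupp.ne_iff.mp hK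
    obtain ⟨K', rfl⟩ : ∃ K', K = K' + Finsupp.single g 1 :=
      ⟨K - Finsupp.single g 1, (tsub_add_cancel_of_le
        (Finsupp.single_le_iff.mpr (Nat.one_le_iff_ne_zero.mpr hg))).symm⟩
    have : 0 ≤ Finsupp.weight w K' := by
      rw [Finsupp.weight_apply]
      exact Finset.sum_nonneg fun i _ => nsmul_nonneg (zero_le_one.trans (hw1 i)) _
    rw [map_add, Finsupp.weight_single, one_smul]
    linarith [hw1 g]
  have main : ∀ (N : ℕ) (K : σ →₀ ℕ), Finsupp.weight w K < N →
      ∃ a ∈ MvPolynomial.weightedHomogeneousSubmodule ℝ w₀ (Finsupp.weight w₀ K),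
        ∀ u, monomialPairing b u a =
          monomialPairing b (S u) (MvPolynomial.monomial K 1) := by
    intro N
    induction N with
    | zero =>
      intro K hK
      exfalso
      by_cases h0 : K = 0
      · simp [h0] at hK
      · have := hpos K h0
        rw [Nat.cast_zero] at hK
        linarith
    | succ N ih =>
      intro K hK
      -- If q₂ = 0 then b_{q₂} = 1 forces q = (K, 0). All other pairs have w(q₂) ≥ 1, so w(q₁) ≤
      -- w(K) - 1 and an induction over natural numbers suffices.
      have hlt : ∀ q ∈ (hb.finite K).toFinset.erase (K, 0), Finsupp.weight w q.1 < N := by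
        intro q hq
        obtain ⟨hne, hq⟩ := Finset.mem_erase.mp hq
        have hq' : b.repr (b q.1 * b q.2) K ≠ 0 := (Set.Finite.mem_toFinset _).mp hq
        have h2 : q.2 ≠ 0 := by
          intro h0
          rw [h0, hb.one, mul_one, Module.Basis.repr_self, Finsupp.single_apply] at hq'
          split_ifs at hq' with h1
          · exact hne (Prod.ext h1 h0)
          · exact hq' rfl
        have h3 := hw _ _ _ hq'
        have h4 := hpos _ h2
        push_cast at hK
        linarith
      choose! a ha ha' using fun q (hq : q ∈ (hb.finite K).toFinset.erase (K, 0)) =>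
        ih q.1 (hlt q hq)
      -- This solves mul ∘ (S ⊗ id) ∘ δ = ε, transposed, for its (K, 0) term.
      refine ⟨(if K = 0 then 1 else 0) - ∑ q ∈ (hb.finite K).toFinset.erase (K, 0),
        b.repr (b q.1 * b q.2) K • (a q * MvPolynomial.monomial q.2 1), ?_, fun u => ?_⟩
      · refine Submodule.sub_mem _ ?_ (Submodule.sum_mem _ fun q hq =>
          Submodule.smul_mem _ _ ?_)
        · split_ifs with h0
          · rw [h0, map_zero]
            exact MvPolynomial.isWeightedHomogeneous_one ℝ w₀
          · exact Submodule.zero_mem _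
        · have hq' : b.repr (b q.1 * b q.2) K ≠ 0 :=
            (Set.Finite.mem_toFinset _).mp (Finset.mem_erase.mp hq).2
          rw [← hw₀ _ _ _ hq']
          exact MvPolynomial.IsWeightedHomogeneous.mul (ha q hq)
            (MvPolynomial.isWeightedHomogeneous_monomial _ _ _ rfl)
      · have hmem : (K, 0) ∈ (hb.finite K).toFinset := by
          rw [Set.Finite.mem_toFinset]
          change b.repr (b K * b 0) K ≠ 0
          rw [hb.one, mul_one, Module.Basis.repr_self, Finsupp.single_eq_same]
          exact one_ne_zero
        have h := hb.pairing_transposeMul (S.rTensor U (δ u)) (MvPolynomial.monomial K 1)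
        rw [hb.transposeMul_monomial, hS, map_sum, ← Finset.add_sum_erase _ _ hmem, map_smul,
          hb.one, mul_one, Module.Basis.repr_self, Finsupp.single_eq_same, one_smul] at h
        have h1 : (MvPolynomial.monomial (0 : σ →₀ ℕ) (1 : ℝ)) = 1 := rfl
        simp only [h1] at h
        rw [hb.tensorPairing_tmul_one] at h
        have h2 : monomialPairing b (algebraMap ℝ U (ε u)) (MvPolynomial.monomial K 1) =
            monomialPairing b u (if K = 0 then 1 else 0) := by
          rw [Algebra.algebraMap_eq_smul_one, map_smul, LinearMap.smul_apply,
            hb.pairing_one_left, MvPolynomial.coeff_monomial]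
          split_ifs
          · rw [hb.pairing_one_right, smul_eq_mul, mul_one]
          · rw [map_zero, smul_zero]
        rw [map_sub, map_sum, ← h2, ← h, sub_eq_iff_eq_add]
        refine congrArg₂ (· + ·) rfl (Finset.sum_congr rfl fun q hq => ?_)
        rw [map_smul, map_smul, hb.pairing_mul, tensorPairing_map_left (ha' q hq)]
  obtain ⟨N, hN⟩ := exists_nat_gt (Finsupp.weight w K)
  exact main N K hN

theorem isHopfAlgebraWith {S : U →ₗ[ℝ] U}
    (hSl : ∀ u, LinearMap.mul' ℝ U (S.rTensor U (δ u)) = algebraMap ℝ U (ε u))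
    (hSr : ∀ u, LinearMap.mul' ℝ U (S.lTensor U (δ u)) = algebraMap ℝ U (ε u))
    {A : MvPolynomial σ ℝ →ₗ[ℝ] MvPolynomial σ ℝ}
    (hA : ∀ u x, monomialPairing b u (A x) = monomialPairing b (S u) x) :
    IsHopfAlgebraWith (transposeMul b) (MvPolynomial.lcoeff ℝ 0) A where
  coassoc := hb.transposeMul_coassoc
  rTensor_counit := hb.rTensor_counit_transposeMul
  lTensor_counit := hb.lTensor_counit_transposeMul
  comul_one := hb.transposeMul_one
  comul_mul := hb.transposeMul_mul
  counit_one := by simp [MvPolynomial.lcoeff_apply]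
  counit_mul x y := by
    simp only [MvPolynomial.lcoeff_apply, ← MvPolynomial.constantCoeff_eq, map_mul]
  antipode_left := by
    refine LinearMap.ext fun x => pairing_ext (b := b) fun u => ?_
    have h : ∀ (t : U ⊗[ℝ] U) z, tensorPairing (monomialPairing b) (monomialPairing b) t
        (A.rTensor _ z) =
        tensorPairing (monomialPairing b) (monomialPairing b) (S.rTensor U t) z := by
      intro t z
      induction z with
      | zero => simp only [map_zero]
      | add z z' h h' => simp only [map_add, h, h']
      | tmul x y =>
        rw [LinearMap.rTensor_tmul, tensorPairing_map_left (fun u => hA u x)]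
    simp only [LinearMap.comp_apply]
    rw [hb.pairing_mul', h, hb.pairing_transposeMul, hSl, Algebra.linearMap_apply,
      Algebra.algebraMap_eq_smul_one, Algebra.algebraMap_eq_smul_one, map_smul, map_smul,
      LinearMap.smul_apply, hb.pairing_one_left, hb.pairing_one_right, smul_eq_mul, smul_eq_mul,
      mul_comm, MvPolynomial.lcoeff_apply]
  antipode_right := by
    refine LinearMap.ext fun x => pairing_ext (b := b) fun u => ?_
    have h : ∀ (t : U ⊗[ℝ] U) z, tensorPairing (monomialPairing b) (monomialPairing b) t
        (A.lTensor _ z) =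
        tensorPairing (monomialPairing b) (monomialPairing b) (S.lTensor U t) z := by
      intro t z
      induction z with
      | zero => simp only [map_zero]
      | add z z' h h' => simp only [map_add, h, h']
      | tmul x y =>
        induction t with
        | zero => simp only [map_zero, LinearMap.zero_apply]
        | add s t h h' => simp only [map_add, LinearMap.add_apply, h, h']
        | tmul u v =>
          rw [LinearMap.lTensor_tmul, LinearMap.lTensor_tmul, tensorPairing_tmul,
            tensorPairing_tmul, hA]
    simp only [LinearMap.comp_apply]
    rw [hb.pairing_mul', h, hb.pairing_transposeMul, hSr, Algebra.linearMap_apply,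
      Algebra.algebraMap_eq_smul_one, Algebra.algebraMap_eq_smul_one, map_smul, map_smul,
      LinearMap.smul_apply, hb.pairing_one_left, hb.pairing_one_right, smul_eq_mul, smul_eq_mul,
      mul_comm, MvPolynomial.lcoeff_apply]

theorem transposeMul_mem_grading (w₀ : σ → ℝ)
    (hw₀ : ∀ K K' K'', b.repr (b K' * b K'') K ≠ 0 →
      Finsupp.weight w₀ K' + Finsupp.weight w₀ K'' = Finsupp.weight w₀ K)
    (ν : ℝ) {x : MvPolynomial σ ℝ} (hx : x ∈ MvPolynomial.weightedHomogeneousSubmodule ℝ w₀ ν) :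
    transposeMul b x ∈ ⨆ p : {p : ℝ × ℝ // p.1 + p.2 = ν}, LinearMap.range (TensorProduct.map
      (MvPolynomial.weightedHomogeneousSubmodule ℝ w₀ p.1.1).subtype
      (MvPolynomial.weightedHomogeneousSubmodule ℝ w₀ p.1.2).subtype) := by
  rw [x.as_sum, map_sum]
  refine Submodule.sum_mem _ fun K hK => ?_
  have hν : Finsupp.weight w₀ K = ν := hx (MvPolynomial.mem_support_iff.mp hK)
  have : MvPolynomial.monomial K (MvPolynomial.coeff K x) =
      MvPolynomial.coeff K x • MvPolynomial.monomial K (1 : ℝ) := by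
    rw [MvPolynomial.smul_monomial, smul_eq_mul, mul_one]
  rw [this, map_smul, hb.transposeMul_monomial]
  refine Submodule.smul_mem _ _ (Submodule.sum_mem _ fun q hq => Submodule.smul_mem _ _ ?_)
  have hq' : b.repr (b q.1 * b q.2) K ≠ 0 := (Set.Finite.mem_toFinset _).mp hq
  refine Submodule.mem_iSup_of_mem
    ⟨(Finsupp.weight w₀ q.1, Finsupp.weight w₀ q.2), (hw₀ _ _ _ hq').trans hν⟩ ?_
  exact ⟨⟨MvPolynomial.monomial q.1 1, MvPolynomial.isWeightedHomogeneous_monomial _ _ _ rfl⟩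
    ⊗ₜ[ℝ] ⟨MvPolynomial.monomial q.2 1, MvPolynomial.isWeightedHomogeneous_monomial _ _ _ rfl⟩,
    rfl⟩

/-- Two conserved weights are used: w, bounded below by 1 on generators, makes the recursion for the
antipode terminate, while w₀ gives the grading, for which positivity suffices. -/
theorem exists_isConnectedGradedHopfAlgebra {S : U →ₗ[ℝ] U}
    (hSl : ∀ u, LinearMap.mul' ℝ U (S.rTensor U (δ u)) = algebraMap ℝ U (ε u))
    (hSr : ∀ u, LinearMap.mul' ℝ U (S.lTensor U (δ u)) = algebraMap ℝ U (ε u))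
    (w w₀ : σ → ℝ) (hw1 : ∀ g, 1 ≤ w g) (hw0 : ∀ g, 0 < w₀ g)
    (hw : ∀ K K' K'', b.repr (b K' * b K'') K ≠ 0 →
      Finsupp.weight w K' + Finsupp.weight w K'' = Finsupp.weight w K)
    (hw₀ : ∀ K K' K'', b.repr (b K' * b K'') K ≠ 0 →
      Finsupp.weight w₀ K' + Finsupp.weight w₀ K'' = Finsupp.weight w₀ K) :
    ∃ A : MvPolynomial σ ℝ →ₗ[ℝ] MvPolynomial σ ℝ,
      IsConnectedGradedHopfAlgebra (transposeMul b) (MvPolynomial.lcoeff ℝ (0 : σ →₀ ℕ)) A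
        (MvPolynomial.weightedHomogeneousSubmodule ℝ w₀) ∧
      ∀ u x, monomialPairing b u (A x) = monomialPairing b (S u) x := by
  classical
  choose a ha ha' using hb.exists_transpose_antipode_monomial hSl w w₀ hw1 hw hw₀
  let A : MvPolynomial σ ℝ →ₗ[ℝ] MvPolynomial σ ℝ :=
    (MvPolynomial.basisMonomials σ ℝ).constr ℝ a
  have hAm : ∀ K, A (MvPolynomial.monomial K 1) = a K := by
    intro K
    rw [← congrFun (MvPolynomial.coe_basisMonomials σ ℝ) K]
    exact Module.Basis.constr_basis _ _ _ _
  have hA : ∀ u x, monomialPairing b u (A x) = monomialPairing b (S u) x := by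
    intro u x
    have : monomialPairing b u ∘ₗ A = monomialPairing b (S u) :=
      MvPolynomial.linearMap_ext_monomial fun K => by rw [LinearMap.comp_apply, hAm, ha']
    exact LinearMap.congr_fun this x
  have hpos : ∀ K : σ →₀ ℕ, K ≠ 0 → 0 < Finsupp.weight w₀ K := by
    intro K hK
    rw [Finsupp.weight_apply]
    exact Finset.sum_pos (fun i hi => nsmul_pos (hw0 i) (Finsupp.mem_support_iff.mp hi))
      (Finsupp.support_nonempty_iff.mpr hK)
  let _ := MvPolynomial.weightedGradedAlgebra ℝ w₀
  refine ⟨A, ⟨hb.isHopfAlgebraWith hSl hSr hA, DirectSum.Decomposition.isInternal _,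
    MvPolynomial.isWeightedHomogeneous_one ℝ w₀,
    fun μ ν x hx y hy => MvPolynomial.IsWeightedHomogeneous.mul hx hy,
    fun ν x hx => hb.transposeMul_mem_grading w₀ hw₀ ν hx, ?_, ?_, ?_, ?_⟩, hA⟩
  · intro ν hν x hx
    by_contra h
    refine hν ?_
    rw [← hx h, map_zero]
  · intro ν x hx
    rw [x.as_sum, map_sum]
    refine Submodule.sum_mem _ fun K hK => ?_
    have hKν : Finsupp.weight w₀ K = ν := hx (MvPolynomial.mem_support_iff.mp hK)
    have : MvPolynomial.monomial K (MvPolynomial.coeff K x) =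
        MvPolynomial.coeff K x • MvPolynomial.monomial K (1 : ℝ) := by
      rw [MvPolynomial.smul_monomial, smul_eq_mul, mul_one]
    rw [this, map_smul, hAm, ← hKν]
    exact Submodule.smul_mem _ _ (ha K)
  · intro ν hν
    refine (Submodule.eq_bot_iff _).mpr fun x hx => MvPolynomial.ext _ _ fun K => ?_
    by_contra h
    have h1 : Finsupp.weight w₀ K = ν := hx h
    by_cases hK : K = 0
    · rw [hK, map_zero] at h1
      linarith
    · linarith [hpos K hK]
  · refine le_antisymm (fun x hx => ?_) ?_
    · rw [Submodule.mem_span_singleton]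
      refine ⟨MvPolynomial.coeff 0 x, MvPolynomial.ext _ _ fun K => ?_⟩
      rw [MvPolynomial.coeff_smul, MvPolynomial.coeff_one]
      split_ifs with h
      · rw [← h, smul_eq_mul, mul_one]
      · rw [smul_zero]
        by_contra hne
        exact (hpos K (Ne.symm h)).ne' (hx (Ne.symm hne))
    · rw [Submodule.span_singleton_le_iff_mem]
      exact MvPolynomial.isWeightedHomogeneous_one ℝ w₀

/-! ### Transposed modules -/

/-- Coassociativity is the transpose of ρ(uv) = ρ(u)ρ(v). The duality `hf` is available only on `M`,
hence the need for `M` to be invariant: it is used a second time at ρ(b_B)n_i. -/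
theorem isLeftComodule {N V ι : Type*} [AddCommGroup N] [Module ℝ N] [AddCommGroup V]
    [Module ℝ V] (ρ : U →ₐ[ℝ] Module.End ℝ N) (M : Submodule ℝ N) (hM : ∀ u, ∀ q ∈ M, ρ u q ∈ M)
    {p : N →ₗ[ℝ] V →ₗ[ℝ] ℝ} {n : ι → N} (hn : ∀ i, n i ∈ M) {c : Module.Basis ι ℝ V}
    (hp : IsDualFamily p n c) {f : V →ₗ[ℝ] MvPolynomial σ ℝ ⊗[ℝ] V}
    (hf : ∀ u, ∀ q ∈ M, ∀ z,
      tensorPairing (monomialPairing b) p (u ⊗ₜ[ℝ] q) (f z) = p (ρ u q) z) :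
    IsLeftComodule (transposeMul b) (MvPolynomial.lcoeff ℝ 0) f where
  coassoc := by
    have hd := isDualFamily_monomialPairing (b := b)
    refine LinearMap.ext fun x => (hd.tensor (hd.tensor hp)).ext fun ⟨A, B, i⟩ => ?_
    simp only [LinearMap.comp_apply, LinearEquiv.coe_coe]
    rw [tensorPairing_assoc,
      tensorPairing_rTensor (fun x => hb.pairing_transposeMul (b A ⊗ₜ[ℝ] b B) x),
      tensorPairing_lTensor (hf (b B) (n i) (hn i)), hf _ _ (hM _ _ (hn i)), hf _ _ (hn i),
      LinearMap.mul'_apply, map_mul, Module.End.mul_apply]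
  counit := by
    refine LinearMap.ext fun x => (TensorProduct.lid ℝ V).injective (hp.ext fun i => ?_)
    rw [LinearMap.comp_apply, hb.pairing_lid_rTensor, hf _ _ (hn i), map_one,
      Module.End.one_apply, TensorProduct.mk_apply, TensorProduct.lid_tmul, one_smul]

end IsDividedPowerBasis

end DividedPowers

/-! ### Positivity of the weights, the transposed action on the model space, and the main theorem.
-/

namespace RegParams

variable {d : ℕ} {𝔏 : Type*} (P : RegParams d 𝔏)

/-- The degree of (γ,𝐧) is only known to be positive; adding the noise homogeneity of γ, a positive
integer, creates the uniform gap needed for the antipode. -/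
theorem one_le_genWt_one (hscal : ∀ i, 1 ≤ P.scal i) (g : P.PlusGen) : 1 ≤ P.genWt 1 g := by
  rcases g with p | i
  · have h1 : (1 : ℝ) ≤ noiseHom p.1.1 := by exact_mod_cast p.2.1.2
    have h2 := p.2.2
    simp only [genWt, coordWt, Sum.elim_inl, one_mul]
    linarith
  · exact hscal i

theorem genDeg_pos (hscal : ∀ i, 1 ≤ P.scal i) (g : P.PlusGen) : 0 < P.genDeg g := by
  rcases g with p | i
  · have h2 := p.2.2
    simp only [genDeg, Sum.elim_inl]
    linarith
  · exact zero_lt_one.trans_le (hscal i)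

/-- The pairing of polynomials with the model space for which the monomials are dual to the basis
`z_β`. -/
noncomputable def modelPairing : CoordPoly d 𝔏 →ₗ[ℝ] P.ModelSpace →ₗ[ℝ] ℝ :=
  (Finsupp.basisSingleOne.constr ℝ fun β : P.ModelIdx => MvPolynomial.lcoeff ℝ β.1).flip

theorem modelPairing_single (q : CoordPoly d 𝔏) (β : P.ModelIdx) :
    P.modelPairing q (Finsupp.single β 1) = MvPolynomial.coeff β.1 q := by
  have h : (Finsupp.single β (1 : ℝ) : P.ModelSpace) = Finsupp.basisSingleOne β := by
    rw [Finsupp.coe_basisSingleOne]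
  rw [modelPairing, LinearMap.flip_apply, h,
    Module.Basis.constr_basis, MvPolynomial.lcoeff_apply]

theorem isDualFamily_modelPairing :
    IsDualFamily P.modelPairing (fun γ : P.ModelIdx => MvPolynomial.monomial γ.1 (1 : ℝ))
      Finsupp.basisSingleOne := by
  classical
  intro γ
  refine Finsupp.basisSingleOne.ext fun β => ?_
  rw [Finsupp.coe_basisSingleOne, modelPairing_single, MvPolynomial.coeff_monomial,
    Module.Basis.coord_apply, ← Finsupp.coe_basisSingleOne, Module.Basis.repr_self,
    Finsupp.single_apply]
  simp only [Subtype.ext_iff, eq_comm]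

section Main

variable (hscal : ∀ i, 1 ≤ P.scal i) (hsol : ∀ i, P.regSol ≤ P.scal i)
include hscal hsol

local notation "𝒃" => dBasis P hscal hsol

theorem isDividedPowerBasis_dBasis :
    IsDividedPowerBasis 𝒃 envelopingComul envelopingCounit where
  one := by rw [dBasis_apply, dividedD_zero]
  coord_zero := P.coord_zero hscal hsol
  coord_add := P.coord_add hscal hsol
  finite := P.finite_prodCoeff hscal hsol

theorem finite_actCoeff (β : P.ModelIdx) :
    {q : P.PlusIdx × P.ModelIdx | actCoeff 𝒃 q.1 β.1 q.2.1 ≠ 0}.Finite := by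
  have hinj : Function.Injective
      (fun q : P.PlusIdx × P.ModelIdx => ((q.1, q.2.1) : P.PlusIdx × CoordIdx d 𝔏)) := by
    intro q r h
    rw [Prod.mk.injEq] at h
    exact Prod.ext h.1 (Subtype.ext h.2)
  refine ((P.finite_coeff_rho hscal hsol β.1).preimage hinj.injOn).subset fun q hq => ?_
  change actCoeff 𝒃 q.1 β.1 q.2.1 ≠ 0 at hq
  rwa [actCoeff, dBasis_apply] at hq

theorem coactPlus_single (β : P.ModelIdx) :
    coactPlus 𝒃 (Finsupp.single β 1) = ∑ q ∈ (P.finite_actCoeff hscal hsol β).toFinset,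
      actCoeff 𝒃 q.1 β.1 q.2.1 • (P.Zmon q.1 ⊗ₜ[ℝ] Finsupp.single q.2 (1 : ℝ)) := by
  have h : (Finsupp.single β (1 : ℝ) : P.ModelSpace) = Finsupp.basisSingleOne β := by
    rw [Finsupp.coe_basisSingleOne]
  rw [coactPlus, h, Module.Basis.constr_basis]
  refine finsum_eq_sum_of_support_subset _ fun q hq => ?_
  rw [Set.Finite.coe_toFinset]
  intro h0
  refine hq ?_
  simp only [h0, zero_smul]

/-- The sum defining `coactPlus` runs over model indices γ only, so q must be a combination of the
corresponding monomials. By linearity the claim reduces to 𝖣_K, z^γ and z_β. -/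
theorem tensorPairing_coactPlus (u : P.UPlus) (q : CoordPoly d 𝔏)
    (hq : q ∈ monSpan (P.Populated ∪ P.NMinus)) (z : P.ModelSpace) :
    tensorPairing (monomialPairing 𝒃) P.modelPairing (u ⊗ₜ[ℝ] q) (coactPlus 𝒃 z) =
      P.modelPairing (P.rho u q) z := by
  classical
  have hbasis : ∀ (K : P.PlusIdx) (γ : P.ModelIdx) (β : P.ModelIdx),
      tensorPairing (monomialPairing 𝒃) P.modelPairing
        (𝒃 K ⊗ₜ[ℝ] MvPolynomial.monomial γ.1 (1 : ℝ)) (coactPlus 𝒃 (Finsupp.single β 1)) =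
      P.modelPairing (P.rho (𝒃 K) (MvPolynomial.monomial γ.1 1)) (Finsupp.single β 1) := by
    intro K γ β
    rw [coactPlus_single, map_sum, modelPairing_single]
    have : ∀ q ∈ (P.finite_actCoeff hscal hsol β).toFinset,
        tensorPairing (monomialPairing 𝒃) P.modelPairing
          (𝒃 K ⊗ₜ[ℝ] MvPolynomial.monomial γ.1 (1 : ℝ)) (actCoeff 𝒃 q.1 β.1 q.2.1 •
            (P.Zmon q.1 ⊗ₜ[ℝ] Finsupp.single q.2 (1 : ℝ))) =
        if q = (K, γ) then actCoeff 𝒃 K β.1 γ.1 else 0 := by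
      rintro ⟨K', γ'⟩ -
      rw [map_smul, tensorPairing_tmul, Zmon, monomialPairing_monomial, Module.Basis.coord_apply,
        Module.Basis.repr_self, Finsupp.single_apply, modelPairing_single,
        MvPolynomial.coeff_monomial]
      by_cases h1 : K = K'
      · subst h1
        by_cases h2 : γ = γ'
        · subst h2
          simp
        · simp [Ne.symm h2, Subtype.ext_iff.not.mp h2]
      · simp [h1, Ne.symm h1]
    refine (Finset.sum_congr rfl this).trans
      ((Finset.sum_eq_single (K, γ) ?_ ?_).trans (if_pos rfl))
    · intro q _ hne
      exact if_neg hne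
    · intro h
      rw [Set.Finite.mem_toFinset] at h
      rw [if_pos rfl]
      exact not_not.mp h
  have hz : ∀ (K : P.PlusIdx) (γ : P.ModelIdx) (z : P.ModelSpace),
      tensorPairing (monomialPairing 𝒃) P.modelPairing
        (𝒃 K ⊗ₜ[ℝ] MvPolynomial.monomial γ.1 (1 : ℝ)) (coactPlus 𝒃 z) =
      P.modelPairing (P.rho (𝒃 K) (MvPolynomial.monomial γ.1 1)) z := by
    intro K γ z
    have : tensorPairing (monomialPairing 𝒃) P.modelPairing
        (𝒃 K ⊗ₜ[ℝ] MvPolynomial.monomial γ.1 (1 : ℝ)) ∘ₗ coactPlus 𝒃 =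
      P.modelPairing (P.rho (𝒃 K) (MvPolynomial.monomial γ.1 1)) := by
      refine Finsupp.basisSingleOne.ext fun β => ?_
      rw [Finsupp.coe_basisSingleOne]
      exact hbasis K γ β
    exact LinearMap.congr_fun this z
  have hu : u ∈ Submodule.span ℝ (Set.range 𝒃) := by
    rw [Module.Basis.span_eq]
    exact Submodule.mem_top
  induction hu using Submodule.span_induction with
  | mem u hu =>
    obtain ⟨K, rfl⟩ := hu
    induction hq using Submodule.span_induction with
    | mem q hq =>
      obtain ⟨γ, hγ, rfl⟩ := hq
      exact hz K ⟨γ, hγ⟩ z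
    | zero => simp only [TensorProduct.tmul_zero, map_zero, LinearMap.zero_apply]
    | add q r _ _ hq hr =>
      simp only [TensorProduct.tmul_add, map_add, LinearMap.add_apply, hq, hr]
    | smul a q _ hq => simp only [TensorProduct.tmul_smul, map_smul, LinearMap.smul_apply, hq]
  | zero => simp only [TensorProduct.zero_tmul, map_zero, LinearMap.zero_apply]
  | add u v _ _ hu hv =>
    simp only [TensorProduct.add_tmul, map_add, LinearMap.add_apply, hu, hv]
  | smul a u _ hu =>
    simp only [← TensorProduct.smul_tmul', map_smul, LinearMap.smul_apply, hu]

end Main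

end RegParams

theorem mainTheorem4 {d : ℕ} {𝔏 : Type*} [Finite 𝔏] (P : RegParams d 𝔏)
    (hscal : ∀ i, 1 ≤ P.scal i) (hη : 0 < P.η) (hreg : ∀ l, P.reg l < P.alpha l)
    (hsol : ∀ i, P.regSol ≤ P.scal i) :
    ∃ b : Module.Basis P.PlusIdx ℝ P.UPlus,
      (∀ (K : P.PlusIdx) (l : List P.MPlus), (l : Multiset P.MPlus) = P.jPart K →
        b K = P.sfD K l) ∧
      (∀ K : P.PlusIdx,
        {q : P.PlusIdx × P.PlusIdx | RegParams.prodCoeff b q.1 q.2 K ≠ 0}.Finite) ∧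
      (∀ β : P.ModelIdx,
        {q : P.PlusIdx × P.ModelIdx | RegParams.actCoeff b q.1 β.1 q.2.1 ≠ 0}.Finite) ∧
      (∃ A : P.TPlus →ₗ[ℝ] P.TPlus,
        IsConnectedGradedHopfAlgebra (RegParams.comulPlus b) P.counitPlus A P.gradePlus ∧
        ∀ (U : P.UPlus) (M : P.TPlus),
          RegParams.pairing b U (A M) = RegParams.pairing b (envelopingAntipode U) M) ∧
      IsLeftComodule (RegParams.comulPlus b) P.counitPlus (RegParams.coactPlus b) := by
  have hb := P.isDividedPowerBasis_dBasis hscal hsol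
  have hw : ∀ (t : ℝ) (K K' K'' : P.PlusIdx),
      (P.dBasis hscal hsol).repr (P.dBasis hscal hsol K' * P.dBasis hscal hsol K'') K ≠ 0 →
      Finsupp.weight (P.genWt t) K' + Finsupp.weight (P.genWt t) K'' =
        Finsupp.weight (P.genWt t) K := fun t K K' K'' h =>
    P.weight_of_prodCoeff hscal hsol t K K' K'' h
  -- t = 0 gives the degree that defines the grading; t = 1, used below, gives the weight driving
  -- the recursion for the antipode.
  have hw₀ := hw 0
  rw [P.genWt_zero] at hw₀
  refine ⟨P.dBasis hscal hsol, fun K l hl => ?_, P.finite_prodCoeff hscal hsol,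
    P.finite_actCoeff hscal hsol, ?_, ?_⟩
  · rw [P.dBasis_apply, P.dividedD_eq_sfD hscal hsol hl]
  -- `comulPlus`, `counitPlus`, `gradePlus` and `pairing` unfold to the general constructions for a
  -- basis of divided powers.
  · exact hb.exists_isConnectedGradedHopfAlgebra envelopingAntipode_left_inv
      envelopingAntipode_right_inv (P.genWt 1) P.genDeg (P.one_le_genWt_one hscal)
      (P.genDeg_pos hscal) (hw 1) hw₀
  · exact hb.isLeftComodule P.rho (RegParams.monSpan (P.Populated ∪ P.NMinus))
      (P.rho_mem_modelSpan hscal hsol) (fun γ => RegParams.monomial_mem_monSpan γ.2)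
      P.isDualFamily_modelPairing (P.tensorPairing_coactPlus hscal hsol)
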